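/- Let $d\ge 1$, $H\in[1/2,1)$, $T>0$, and let $X=(X_t)_{t\ge 0}$ be a $d$-dimensional fractional Brownian motion with Hurst index $H$, i.e. the coordinates of $X$ are independent centred real Gaussian processes with a.s. continuous paths and covariance $\frac12\left(s^{2H}+t^{2H}-|s-t|^{2H}\right)$. For $\varepsilon>0$ let $D^-_\varepsilon X_t=(X_{t+\varepsilon}-X_t)/\varepsilon$. For $\alpha>0$ let $$K_\alpha(x)=\frac{1}{\Gamma(\alpha)(4\pi)^{d/2}}\int_0^\infty t^{\alpha-\frac d2}\,e^{-\frac{|x|^2}{4t}-t}\,\frac{dt}{t}\in[0,\infty],\qquad x\in\mathbb R^d,$$ be the convolution kernel of $(1-\Delta)^{-\alpha}$, and let $$Z_{\alpha,\varepsilon}=\int_0^T\!\!\int_0^T K_\alpha(X_t-X_s)\,\langle D^-_\varepsilon X_t,D^-_\varepsilon X_s\rangle\,dt\,ds,\qquad \alpha_H=\frac d2-1+\frac1{2H}.$$ The double integral and the expectation are understood as extended integrals: the integral of the positive part minus the integral of the negative part, with the value $-\infty$ if the latter is infinite. 1. For every $\alpha>\alpha_H$: for every $\varepsilon>0$, $E\int_0^T\int_0^T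 K_\alpha(X_t-X_s)\,|\langle D^-_\varepsilon X_t,D^-_\varepsilon X_s\rangle|\,dt\,ds<\infty$ (so that $Z_{\alpha,\varepsilon}$ is a.s. finite and integrable), and $\sup_{\varepsilon>0}E Z_{\alpha,\varepsilon}<\infty$. 2. For every $\alpha$ with $0<\alpha<\alpha_H$: $\liminf_{\varepsilon\to0^+}E Z_{\alpha,\varepsilon}=+\infty$. -/

import Mathlib

open MeasureTheory ProbabilityTheory Filter Set
open scoped NNReal ENNReal Topology

noncomputable section

/-- Real fractional Brownian motion with Hurst index `H`: a centred Gaussian process on `[0, ∞)` with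
almost surely continuous paths and
covariance `(s ^ (2H) + t ^ (2H) - |s - t| ^ (2H)) / 2`. -/
structure IsFractionalBrownianReal {Ω : Type*} [MeasurableSpace Ω]
    (H : ℝ) (B : ℝ≥0 → Ω → ℝ) (P : Measure Ω) : Prop where
  gaussian : IsGaussianProcess B P
  centered : ∀ t, ∫ ω, B t ω ∂P = 0
  covariance : ∀ s t : ℝ≥0, cov[B s, B t; P] =
    ((s : ℝ) ^ (2 * H) + (t : ℝ) ^ (2 * H) - |(s : ℝ) - (t : ℝ)| ^ (2 * H)) / 2
  continuous_paths : ∀ᵐ ω ∂P, Continuous fun t => B t ω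

/-- `d`-dimensional fractional Brownian motion with Hurst index `H`: its coordinates are independent
real fractional Brownian motions. -/
structure IsFractionalBrownian {Ω : Type*} [MeasurableSpace Ω] {d : ℕ}
    (H : ℝ) (X : ℝ≥0 → Ω → EuclideanSpace ℝ (Fin d)) (P : Measure Ω) : Prop where
  coord : ∀ i, IsFractionalBrownianReal H (fun t ω => X t ω i) P
  indep : iIndepFun (fun (i : Fin d) (ω : Ω) (t : ℝ≥0) => X t ω i) P

/-- The convolution kernel of `(1 - Δ) ^ (-α)` on `ℝ ^ d` for `α > 0`,
`K_α(x) = 1 / (Γ(α) (4π) ^ (d/2)) * ∫₀^∞ t ^ (α - d/2) exp (-|x|² / (4t) - t) dt / t`,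
with values in `[0, ∞]`: it is finite for `x ≠ 0`, and infinite at `x = 0` exactly
when `α ≤ d/2`. -/
def besselKernel {d : ℕ} (α : ℝ) (x : EuclideanSpace ℝ (Fin d)) : ℝ≥0∞ :=
  ENNReal.ofReal (1 / (Real.Gamma α * (4 * Real.pi) ^ ((d : ℝ) / 2))) *
    ∫⁻ t in Ioi (0 : ℝ), ENNReal.ofReal
      (t ^ (α - (d : ℝ) / 2) * Real.exp (-‖x‖ ^ 2 / (4 * t) - t) / t)

/-- The forward difference quotient `D⁻_ε x_t = (x_{t+ε} - x_t) / ε` of a path on `[0, ∞)`, for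
`t ≥ 0` and `ε > 0`. -/
def forwardQuotient {d : ℕ} (ε : ℝ) (x : ℝ≥0 → EuclideanSpace ℝ (Fin d)) (t : ℝ) :
    EuclideanSpace ℝ (Fin d) :=
  ε⁻¹ • (x (t + ε).toNNReal - x t.toNNReal)

/-- The integral of an extended-real function, `∫ f⁺ - ∫ f⁻`. It is the usual integral when `f` is
integrable and `+∞` when only `∫ f⁺` is infinite; it takes the value `-∞` if `∫ f⁻ = ∞`
(in particular in the undefined case `∞ - ∞`). -/
def extIntegral {S : Type*} [MeasurableSpace S] (μ : Measure S) (f : S → EReal) : EReal :=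
  ((∫⁻ x, (f x).toENNReal ∂μ : ℝ≥0∞) : EReal) - ((∫⁻ x, (-f x).toENNReal ∂μ : ℝ≥0∞) : EReal)

/-- Lebesgue measure on the square `[0, T]²`. -/
def timeSquare (T : ℝ) : Measure (ℝ × ℝ) :=
  volume.restrict (Icc 0 T ×ˢ Icc 0 T)

/-- The integrand `K_α(x_t - x_s) ⟨D⁻_ε x_t, D⁻_ε x_s⟩` at `p = (t, s)`. -/
def forwardIntegrand {d : ℕ} (α ε : ℝ) (x : ℝ≥0 → EuclideanSpace ℝ (Fin d)) (p : ℝ × ℝ) : EReal :=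
  (besselKernel α (x p.1.toNNReal - x p.2.toNNReal) : EReal) *
    ((inner ℝ (forwardQuotient ε x p.1) (forwardQuotient ε x p.2) : ℝ) : EReal)

/-- `Z_{α,ε} = ∫₀ᵀ ∫₀ᵀ K_α(X_t - X_s) ⟨D⁻_ε X_t, D⁻_ε X_s⟩ dt ds`, evaluated on the path of `ω`. -/
def forwardZ {Ω : Type*} {d : ℕ} (T : ℝ) (X : ℝ≥0 → Ω → EuclideanSpace ℝ (Fin d))
    (α ε : ℝ) (ω : Ω) : EReal :=
  extIntegral (timeSquare T) (forwardIntegrand α ε fun t => X t ω)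

/-- The critical exponent `α_H = d/2 - 1 + 1/(2H)`. -/
def criticalExponent (d : ℕ) (H : ℝ) : ℝ := (d : ℝ) / 2 - 1 + 1 / (2 * H)

end

/-! Write p = 2H, r = |t - s|, D = d/2. The Bessel kernel is a positive mixture over τ > 0 of the
Gaussians exp(-|x|²/(4τ)), so by Tonelli everything reduces to fixed τ. There the expectation of
exp(-|X_t - X_s|²/(4τ)) times the inner product of the difference quotients is explicit
(`heatMean`): it is d ε⁻² (τ/(τ + r^p/2))^D times half the second difference of x ↦ |x|^p at r with
step ε, minus a product of two covariances divided by τ + r^p/2. Positive and negative parts are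
carried separately, because the difference of the two integrals need not make sense in advance.

Above the critical exponent, the subtracted product is nonnegative and is dropped
(`heatMean_abs_le`). The second difference is O(ε² r^(p-2)), and integrating the Gaussian factor
against the weight in τ costs r^(-pβ) for any β in (D - α, D] with β ≥ 0. The result is bounded
uniformly in ε as soon as r^(p-2-pβ) is integrable, that is, β < 1 - 1/(2H); such a β exists because
α exceeds the critical exponent. For H = 1/2 one takes β = 0, and the second difference lives on r <
ε.

Below the critical exponent two things are needed. First, the negative part must have finite
expectation for every α > 0, although the kernel may be very singular. If ⟨U, V⟩ < 0 then |U| ≤ |U -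
V|; near the diagonal U - V has variance of order r^p while U has variance ε^p per coordinate, so
this event has probability of order r^(pd/2), which cancels the singularity (`neg_inner_le_exp`,
`lintegral_exp_three_le`, `exists_lintegral_heatFactor_mul_neg_le`).

Second, a lower bound is needed. The Gaussian kernel is positive definite, so each τ contributes a
nonnegative amount, path by path (`partMean_neg_le`). For τ of order ε^p the contribution is
quantitative: with Φ'(w) = w^(-D), `heatMean` dominates, up to a positive factor, the second
difference in x of Φ(τ + |x|^p/2) plus a positive remainder of order (τ + |x|^p/2)^(-D-1) ε^(2p)
(`second_difference_heatProfile_le`). The second difference of a function increasing in |x| has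
nonnegative integral over the square (`integral_second_difference_nonneg`), and the remainder is
bounded below on the strip r ≤ ε. Integrating over the window of τ gives a constant times ε^(2H(α -
d/2 + 1) - 1), whose exponent is negative exactly below the critical value. -/

/-! ### Increments and second differences of power functions -/

/-- Tangent line inequality for the convex power functions. -/
lemma rpow_add_mul_sub_le_rpow {p a b : ℝ} (hp : 1 ≤ p) (ha : 0 < a) (hb : 0 ≤ b) :
    a ^ p + p * a ^ (p - 1) * (b - a) ≤ b ^ p := by
  have h := one_add_mul_self_le_rpow_one_add (s := b / a - 1) (by
    have : 0 ≤ b / a := div_nonneg hb ha.le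
    linarith) hp
  rw [add_sub_cancel, Real.div_rpow hb ha.le, le_div_iff₀ (by positivity)] at h
  have h1 : a ^ (p - 1) * a = a ^ p := by
    rw [← Real.rpow_add_one ha.ne', sub_add_cancel]
  calc a ^ p + p * a ^ (p - 1) * (b - a) = (1 + p * (b / a - 1)) * a ^ p := by
        rw [← h1]; field_simp
    _ ≤ b ^ p := h

/-- Tangent line inequality for the concave power functions. -/
lemma rpow_le_rpow_add_mul_sub {q a b : ℝ} (hq : 0 ≤ q) (hq1 : q ≤ 1) (ha : 0 < a) (hb : 0 ≤ b) :
    b ^ q ≤ a ^ q + q * a ^ (q - 1) * (b - a) := by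
  have h := rpow_one_add_le_one_add_mul_self (s := b / a - 1) (by
    have : 0 ≤ b / a := div_nonneg hb ha.le
    linarith) hq hq1
  rw [add_sub_cancel, Real.div_rpow hb ha.le, div_le_iff₀ (by positivity)] at h
  have h1 : a ^ (q - 1) * a = a ^ q := by
    rw [← Real.rpow_add_one ha.ne', sub_add_cancel]
  calc b ^ q ≤ (1 + q * (b / a - 1)) * a ^ q := h
    _ = a ^ q + q * a ^ (q - 1) * (b - a) := by rw [← h1]; field_simp

/-- Convexity; ε may exceed r, since in the tangent inequality at r replacing r - ε by |r - ε| only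
increases the linear term. -/
lemma two_mul_rpow_le_add {p r ε : ℝ} (hp : 1 ≤ p) (hr : 0 ≤ r) (hε : 0 ≤ ε) :
    2 * r ^ p ≤ (r + ε) ^ p + |r - ε| ^ p := by
  rcases hr.eq_or_lt with rfl | hr
  · rw [Real.zero_rpow (by linarith), mul_zero]; positivity
  have h1 := rpow_add_mul_sub_le_rpow hp hr (b := r + ε) (by linarith)
  have h2 := rpow_add_mul_sub_le_rpow hp hr (b := |r - ε|) (abs_nonneg _)
  have h3 : 0 ≤ p * r ^ (p - 1) := by positivity
  have h4 := mul_le_mul_of_nonneg_left (le_abs_self (r - ε)) h3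
  nlinarith

lemma rpow_sub_two_half_le {p r s : ℝ} (hp : 1 ≤ p) (hp2 : p ≤ 2) (hr : 0 < r) (hs : r / 2 ≤ s) :
    s ^ (p - 2) ≤ 2 * r ^ (p - 2) := by
  calc s ^ (p - 2) ≤ (r / 2) ^ (p - 2) :=
        Real.rpow_le_rpow_of_nonpos (by positivity) hs (by linarith)
    _ = r ^ (p - 2) * 2 ^ (2 - p) := by
        rw [Real.div_rpow hr.le (by norm_num), div_eq_mul_inv, ← Real.rpow_neg (by norm_num)]
        ring_nf
    _ ≤ r ^ (p - 2) * 2 ^ (1 : ℝ) := by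
        gcongr
        · norm_num
        · linarith
    _ = _ := by rw [Real.rpow_one]; ring

/-- The second difference of `|x| ^ p` for `1 ≤ p ≤ 2` is `O(ε ^ 2 r ^ (p - 2))`. -/
lemma second_difference_rpow_le {p r ε : ℝ} (hp : 1 ≤ p) (hp2 : p ≤ 2) (hr : 0 < r) (hε : 0 < ε) :
    (r + ε) ^ p + |r - ε| ^ p - 2 * r ^ p ≤ 20 * ε ^ 2 * r ^ (p - 2) := by
  have hrp : 0 < r ^ p := by positivity
  -- If ε is comparable to r or larger, bound each term by a multiple of ε^p = ε² ε^(p-2). Otherwise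
  -- use convexity of x^p once and concavity of x^(p-1) once, between r - ε and r + ε.
  rcases le_or_gt (r / 2) ε with h | h
  · have h1 : (r + ε) ^ p ≤ 9 * ε ^ p := by
      calc (r + ε) ^ p ≤ (3 * ε) ^ p := by gcongr; linarith
        _ = 3 ^ p * ε ^ p := Real.mul_rpow (by norm_num) hε.le
        _ ≤ 3 ^ (2 : ℝ) * ε ^ p := by gcongr; norm_num
        _ = _ := by norm_num
    have h2 : |r - ε| ^ p ≤ ε ^ p := by
      gcongr
      rw [abs_le]; constructor <;> linarith
    have h3 : ε ^ p = ε ^ 2 * ε ^ (p - 2) := by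
      rw [← Real.rpow_natCast ε 2, ← Real.rpow_add hε]; norm_num
    have h4 := mul_le_mul_of_nonneg_left (rpow_sub_two_half_le hp hp2 hr h) (sq_nonneg ε)
    nlinarith
  · have hd : 0 < r - ε := by linarith
    rw [abs_of_pos hd]
    have h1 := rpow_add_mul_sub_le_rpow hp (a := r + ε) (b := r) (by linarith) hr.le
    have h2 := rpow_add_mul_sub_le_rpow hp (a := r - ε) (b := r) hd hr.le
    have h3 := rpow_le_rpow_add_mul_sub (q := p - 1) (a := r - ε) (b := r + ε) (by linarith)
      (by linarith) hd (by linarith)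
    have h4 := rpow_sub_two_half_le (s := r - ε) hp hp2 hr (by linarith)
    rw [show p - 1 - 1 = p - 2 by ring] at h3
    have h5 : (p - 1) * (r - ε) ^ (p - 2) * (r + ε - (r - ε)) ≤ 4 * r ^ (p - 2) * ε := by
      have : (p - 1) * (r - ε) ^ (p - 2) ≤ 1 * (2 * r ^ (p - 2)) := by
        gcongr; linarith
      nlinarith
    have h6 : p * ε * ((r + ε) ^ (p - 1) - (r - ε) ^ (p - 1)) ≤ 2 * ε * (4 * r ^ (p - 2) * ε) := by
      have hm : (r - ε) ^ (p - 1) ≤ (r + ε) ^ (p - 1) :=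
        Real.rpow_le_rpow hd.le (by linarith) (by linarith)
      have : (r + ε) ^ (p - 1) - (r - ε) ^ (p - 1) ≤ 4 * r ^ (p - 2) * ε := by linarith
      calc p * ε * ((r + ε) ^ (p - 1) - (r - ε) ^ (p - 1)) 
          ≤ 2 * ε * ((r + ε) ^ (p - 1) - (r - ε) ^ (p - 1)) := by
            gcongr
        _ ≤ _ := by gcongr
    have h7 : 0 < ε ^ 2 * r ^ (p - 2) := by positivity
    nlinarith

lemma cube_sub_cube_le {P N : ℝ} (hN : -P ≤ N) (hNP : N ≤ P) :
    P ^ 3 - N ^ 3 ≤ (P - N) * (3 * P ^ 2) := by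
  have h1 : P ^ 3 - N ^ 3 = (P - N) * (P ^ 2 + P * N + N ^ 2) := by ring
  rw [h1]
  refine mul_le_mul_of_nonneg_left ?_ (by linarith)
  nlinarith

/-- The difference of the cubes of the forward and backward increments of `u ^ p` is `o(u ^ p)`
when `p < 2`. -/
lemma exists_cube_sub_cube_rpow_le {p η : ℝ} (hp : 1 ≤ p) (hp2 : p < 2) (hη : 0 < η) :
    ∃ θ : ℝ, 0 < θ ∧ ∀ u : ℝ, 0 ≤ u →
      ((u + 1) ^ p - u ^ p) ^ 3 - (u ^ p - |u - 1| ^ p) ^ 3 ≤ η * (θ + u ^ p / 2) := by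
  -- For large u the difference of increments is O(u^(p-2)) and each increment is O(u^(p-1)), so the
  -- difference of cubes is O(u^(3p-4)) = O(u^p · u^(-(4-2p))). The explicit constant is 20 · 3 · 4²
  -- = 960, and half of u^p is available, whence 1920.
  have ht : Tendsto (fun u : ℝ => u ^ (-(4 - 2 * p))) atTop (𝓝 0) :=
    tendsto_rpow_neg_atTop (by linarith)
  obtain ⟨u₁, hu₁⟩ := eventually_atTop.1
    (ht.eventually (gt_mem_nhds (show (0 : ℝ) < η / 1920 by positivity)))
  set u₀ := max u₁ 1
  have h0 : 1 ≤ u₀ := le_max_right _ _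
  -- η θ absorbs the bounded range u ≤ u₀, where the first cube is at most ((u₀ + 1)^p)³ and the
  -- second is at least -1.
  refine ⟨(((u₀ + 1) ^ p) ^ 3 + 1) / η, by positivity, fun u hu => ?_⟩
  have hup : 0 ≤ u ^ p := by positivity
  rw [mul_add, mul_div_cancel₀ _ hη.ne']
  rcases le_or_gt u u₀ with h | h
  · have h1 : (u + 1) ^ p - u ^ p ≤ (u₀ + 1) ^ p := by
      have : (u + 1) ^ p ≤ (u₀ + 1) ^ p := by gcongr
      linarith
    have h2 : 0 ≤ (u + 1) ^ p - u ^ p := by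
      have : u ^ p ≤ (u + 1) ^ p := by gcongr; linarith
      linarith
    have h3 : -1 ≤ u ^ p - |u - 1| ^ p := by
      rcases le_or_gt u 1 with h | h
      · have : |u - 1| ^ p ≤ 1 :=
          Real.rpow_le_one (abs_nonneg _) (by rw [abs_le]; constructor <;> linarith) (by linarith)
        linarith
      · have : |u - 1| ^ p ≤ u ^ p := by
          gcongr
          rw [abs_le]; constructor <;> linarith
        linarith
    have h4 : ((u + 1) ^ p - u ^ p) ^ 3 ≤ ((u₀ + 1) ^ p) ^ 3 := by gcongr
    have h5 : (-1) ^ 3 ≤ (u ^ p - |u - 1| ^ p) ^ 3 := by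
      have : Odd 3 := by decide
      exact this.strictMono_pow.monotone h3
    have : 0 ≤ η * (u ^ p / 2) := by positivity
    linarith
  · have hu1 : 1 < u := h0.trans_lt h
    have hu0 : 0 < u := by linarith
    have hS := second_difference_rpow_le hp hp2.le hu0 one_pos
    have hS0 := two_mul_rpow_le_add hp hu0.le zero_le_one
    have hN : |u - 1| ^ p ≤ u ^ p := by
      gcongr
      rw [abs_le]; constructor <;> linarith
    have hP : u ^ p ≤ (u + 1) ^ p := by gcongr; linarith
    have hP' : (u + 1) ^ p - u ^ p ≤ 4 * u ^ (p - 1) := by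
      have h1 := rpow_add_mul_sub_le_rpow hp (a := u + 1) (b := u) (by linarith) hu
      have h2 : (u + 1) ^ (p - 1) ≤ 2 * u ^ (p - 1) := by
        calc (u + 1) ^ (p - 1) ≤ (2 * u) ^ (p - 1) :=
              Real.rpow_le_rpow (by linarith) (by linarith) (by linarith)
          _ = 2 ^ (p - 1) * u ^ (p - 1) := Real.mul_rpow (by norm_num) hu
          _ ≤ 2 ^ (1 : ℝ) * u ^ (p - 1) := by
              gcongr
              · norm_num
              · linarith
          _ = _ := by rw [Real.rpow_one]
      have h3 : p * (u + 1) ^ (p - 1) ≤ 2 * (2 * u ^ (p - 1)) := by gcongr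
      linarith
    have hq := hu₁ u ((le_max_left _ _).trans h.le)
    have hc := cube_sub_cube_le (P := (u + 1) ^ p - u ^ p) (N := u ^ p - |u - 1| ^ p)
      (by linarith) (by linarith)
    have e1 : u ^ (p - 2) * (u ^ (p - 1)) ^ 2 = u ^ p * u ^ (-(4 - 2 * p)) := by
      rw [← Real.rpow_natCast, ← Real.rpow_mul hu, ← Real.rpow_add hu0, ← Real.rpow_add hu0]
      congr 1; push_cast; ring
    calc _ ≤ _ := hc
      _ ≤ (20 * u ^ (p - 2)) * (3 * (4 * u ^ (p - 1)) ^ 2) := by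
          have : ((u + 1) ^ p - u ^ p) ^ 2 ≤ (4 * u ^ (p - 1)) ^ 2 :=
            pow_le_pow_left₀ (by linarith) hP' 2
          refine mul_le_mul ?_ (by linarith) (by positivity) (by positivity)
          linarith
      _ = 960 * (u ^ (p - 2) * (u ^ (p - 1)) ^ 2) := by ring
      _ = 960 * (u ^ p * u ^ (-(4 - 2 * p))) := by rw [e1]
      _ ≤ 960 * (u ^ p * (η / 1920)) := by gcongr
      _ = η * (u ^ p / 2) := by ring
      _ ≤ _ := by linarith [show 0 ≤ ((u₀ + 1) ^ p) ^ 3 by positivity]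

/-- Homogeneity: take u = r/ε and multiply by ε^(3p). -/
lemma cube_sub_cube_rpow_le_of_scale {p η θ : ℝ}
    (h : ∀ u : ℝ, 0 ≤ u →
      ((u + 1) ^ p - u ^ p) ^ 3 - (u ^ p - |u - 1| ^ p) ^ 3 ≤ η * (θ + u ^ p / 2))
    {r ε : ℝ} (hr : 0 ≤ r) (hε : 0 < ε) :
    ((r + ε) ^ p - r ^ p) ^ 3 - (r ^ p - |r - ε| ^ p) ^ 3 ≤
      η * (ε ^ p) ^ 2 * (θ * ε ^ p + r ^ p / 2) := by
  have h1 := h (r / ε) (by positivity)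
  have e1 : r / ε + 1 = (r + ε) / ε := by field_simp
  have e2 : |r / ε - 1| = |r - ε| / ε := by
    rw [show r / ε - 1 = (r - ε) / ε by field_simp, abs_div, abs_of_pos hε]
  rw [e1, e2, Real.div_rpow (by linarith) hε.le, Real.div_rpow hr hε.le,
    Real.div_rpow (abs_nonneg _) hε.le] at h1
  have he : 0 < ε ^ p := by positivity
  have h2 := mul_le_mul_of_nonneg_right h1 (show 0 ≤ (ε ^ p) ^ 3 by positivity)
  calc _ = _ := ?_
    _ ≤ _ := h2
    _ = _ := ?_
  · field_simp
  · field_simp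

/-! ### Taylor bound for the profile Φ and the algebraic lower bound -/

/-- The primitive of `x ^ (-D)` on `(0, ∞)` that vanishes at `1`. -/
noncomputable def powPrimitive (D w : ℝ) : ℝ := ∫ x in (1 : ℝ)..w, x ^ (-D)

lemma hasDerivAt_powPrimitive (D : ℝ) {w : ℝ} (hw : 0 < w) :
    HasDerivAt (powPrimitive D) (w ^ (-D)) w := by
  refine intervalIntegral.integral_hasDerivAt_right ?_ ?_ ?_
  · refine ContinuousOn.intervalIntegrable fun x hx => ?_
    have : 0 < x := lt_of_lt_of_le (lt_min one_pos hw) hx.1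
    exact (Real.continuousAt_rpow_const _ _ (Or.inl this.ne')).continuousWithinAt
  · exact (Measurable.stronglyMeasurable (by fun_prop)).stronglyMeasurableAtFilter
  · exact Real.continuousAt_rpow_const _ _ (Or.inl hw.ne')

lemma powPrimitive_le_powPrimitive (D : ℝ) {v w : ℝ} (hv : 0 < v) (hvw : v ≤ w) :
    powPrimitive D v ≤ powPrimitive D w := by
  have hd : ∀ x ∈ Ici v, HasDerivAt (powPrimitive D) (x ^ (-D)) x := fun x hx =>
    hasDerivAt_powPrimitive D (lt_of_lt_of_le hv hx)
  refine monotoneOn_of_deriv_nonneg (convex_Ici v)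
    (fun x hx => (hd x hx).continuousAt.continuousWithinAt)
    (fun x hx => (hd x (interior_subset hx)).differentiableAt.differentiableWithinAt)
    (fun x hx => ?_) self_mem_Ici hvw hvw
  rw [(hd x (interior_subset hx)).deriv]
  have : 0 < x := lt_of_lt_of_le hv (interior_subset hx)
  positivity

/-- Bernoulli's inequality for negative exponents, from exp y ≥ 1 + y and log(1 + x) ≤ x. -/
lemma one_sub_mul_le_one_add_rpow_neg {s x : ℝ} (hs : 0 ≤ s) (hx : -1 < x) :
    1 - s * x ≤ (1 + x) ^ (-s) := by
  have h0 : 0 < 1 + x := by linarith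
  rw [Real.rpow_def_of_pos h0]
  have h1 := Real.add_one_le_exp (Real.log (1 + x) * -s)
  have h2 := Real.log_le_sub_one_of_pos h0
  nlinarith

/-- A function on `(-1, ∞)` vanishing at `0` whose derivative has the sign of `x` is nonnegative. -/
lemma nonneg_of_deriv_sign {f f' : ℝ → ℝ} (hf : ∀ x, -1 < x → HasDerivAt f (f' x) x)
    (h0 : f 0 = 0) (hpos : ∀ x, 0 ≤ x → 0 ≤ f' x) (hneg : ∀ x, -1 < x → x ≤ 0 → f' x ≤ 0)
    {z : ℝ} (hz : -1 < z) : 0 ≤ f z := by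
  rcases le_total 0 z with h | h
  · have : MonotoneOn f (Ici 0) := by
      refine monotoneOn_of_deriv_nonneg (convex_Ici 0)
        (fun x hx => (hf x (by linarith [mem_Ici.1 hx])).continuousAt.continuousWithinAt)
        (fun x hx => (hf x (by linarith [mem_Ici.1 (interior_subset hx)])).differentiableAt.differentiableWithinAt)
        fun x hx => ?_
      have := mem_Ici.1 (interior_subset hx)
      rw [(hf x (by linarith)).deriv]
      exact hpos x this
    have := this self_mem_Ici (mem_Ici.2 h) h
    linarith
  · have : AntitoneOn f (Icc z 0) := by
      refine antitoneOn_of_deriv_nonpos (convex_Icc z 0)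
        (fun x hx => (hf x (by linarith [hx.1])).continuousAt.continuousWithinAt)
        (fun x hx => (hf x (by linarith [(interior_subset hx).1])).differentiableAt.differentiableWithinAt)
        fun x hx => ?_
      have := interior_subset hx
      rw [(hf x (by linarith [this.1])).deriv]
      exact hneg x (by linarith [this.1]) this.2
    have := this (left_mem_Icc.2 h) (right_mem_Icc.2 h) h
    linarith

/-- Third order Taylor bound for the primitive of `x ^ (-D)`. -/
lemma powPrimitive_taylor_le {D w z : ℝ} (hD : 0 ≤ D) (hw : 0 < w) (hz : -1 < z) :
    powPrimitive D (w + w * z) - powPrimitive D w ≤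
      w ^ (1 - D) * (z - D * z ^ 2 / 2 + D * (D + 1) * z ^ 3 / 6) := by
  -- w^(1-D) h is the derivative in z of the right side minus the left. Bernoulli's inequality makes
  -- h increasing, and h(0) = 0, so this derivative has the sign of z although z³ changes sign.
  set h : ℝ → ℝ := fun x => 1 - D * x + D * (D + 1) / 2 * x ^ 2 - (1 + x) ^ (-D) with h_def
  have hh : ∀ x, -1 < x → HasDerivAt h (D * ((1 + x) ^ (-(D + 1)) - (1 - (D + 1) * x))) x := by
    intro x hx
    have h1 : HasDerivAt (fun x : ℝ => (1 + x) ^ (-D)) (1 * (-D) * (1 + x) ^ (-D - 1)) x :=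
      ((hasDerivAt_id x).const_add 1).rpow_const (Or.inl (by simp; linarith))
    have h2 : HasDerivAt (fun x : ℝ => 1 - D * x + D * (D + 1) / 2 * x ^ 2)
        (-(D * 1) + D * (D + 1) / 2 * (2 * x)) x := by
      refine ((((hasDerivAt_id x).const_mul D).const_sub 1)).add ?_
      simpa using (hasDerivAt_pow 2 x).const_mul (D * (D + 1) / 2)
    refine (h2.sub h1).congr_deriv ?_
    rw [show -D - 1 = -(D + 1) by ring]; ring
  have hmono : MonotoneOn h (Ioi (-1)) := by
    refine monotoneOn_of_deriv_nonneg (convex_Ioi _)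
      (fun x hx => (hh x hx).continuousAt.continuousWithinAt)
      (fun x hx => (hh x (interior_subset hx)).differentiableAt.differentiableWithinAt)
      fun x hx => ?_
    have hx' : -1 < x := interior_subset hx
    rw [(hh x hx').deriv]
    exact mul_nonneg hD (by linarith [one_sub_mul_le_one_add_rpow_neg (s := D + 1) (by linarith) hx'])
  have h_zero : h 0 = 0 := by simp [h_def]
  have hwp : 0 < w ^ (1 - D) := by positivity
  have key := nonneg_of_deriv_sign (z := z)
    (f := fun z => w ^ (1 - D) * (z - D * z ^ 2 / 2 + D * (D + 1) * z ^ 3 / 6) -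
      (powPrimitive D (w + w * z) - powPrimitive D w)) (f' := fun z => w ^ (1 - D) * h z) ?_ (by simp)
    (fun x hx => mul_nonneg hwp.le ?_) (fun x hx1 hx => mul_nonpos_of_nonneg_of_nonpos hwp.le ?_) hz
  · linarith
  · intro x hx
    have hx0 : 0 < w + w * x := by nlinarith
    have h1 : HasDerivAt (fun z : ℝ => w + w * z) (w * 1) x :=
      ((hasDerivAt_id x).const_mul w).const_add w
    have h2 := ((hasDerivAt_powPrimitive D hx0).comp x h1).sub_const (powPrimitive D w)
    have h3 : HasDerivAt (fun z : ℝ => z - D * z ^ 2 / 2 + D * (D + 1) * z ^ 3 / 6)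
        (1 - D * (2 * x) / 2 + D * (D + 1) * (3 * x ^ 2) / 6) x := by
      refine ((hasDerivAt_id x).sub ?_).add ?_
      · simpa using ((hasDerivAt_pow 2 x).const_mul D).div_const 2
      · simpa using ((hasDerivAt_pow 3 x).const_mul (D * (D + 1))).div_const 6
    refine ((h3.const_mul (w ^ (1 - D))).sub h2).congr_deriv ?_
    rw [show w + w * x = w * (1 + x) by ring, Real.mul_rpow hw.le (by linarith),
      show 1 - D = -D + 1 by ring, Real.rpow_add_one hw.ne']
    simp only [h_def]; ring
  · rw [← h_zero]; exact hmono (by simp) (mem_Ioi.2 (by linarith)) hx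
  · rw [← h_zero]; exact hmono (mem_Ioi.2 hx1) (by simp) hx

/-- The function `Φ(τ + |x| ^ p / 2)` where `Φ' (w) = w ^ (-D)`. -/
noncomputable def heatProfile (D p τ x : ℝ) : ℝ := powPrimitive D (τ + |x| ^ p / 2)

lemma heatProfile_le_heatProfile {D p τ x y : ℝ} (hp : 0 ≤ p) (hτ : 0 < τ) (h : |x| ≤ |y|) :
    heatProfile D p τ x ≤ heatProfile D p τ y := by
  unfold heatProfile
  apply powPrimitive_le_powPrimitive
  · positivity
  · gcongr

lemma continuous_heatProfile {D p τ : ℝ} (hp : 0 < p) (hτ : 0 < τ) :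
    Continuous (heatProfile D p τ) := by
  refine continuous_iff_continuousAt.2 fun x => ?_
  have h1 : 0 < τ + |x| ^ p / 2 := by positivity
  refine ContinuousAt.comp (f := fun x : ℝ => τ + |x| ^ p / 2)
    (hasDerivAt_powPrimitive D h1).continuousAt ?_
  have : Continuous fun x : ℝ => |x| ^ p := continuous_abs.rpow_const fun _ => Or.inr hp.le
  exact (continuous_const.add (this.div_const 2)).continuousAt

/-- Lower bound for the one-time density by an exact second difference plus a positive term. -/
lemma second_difference_heatProfile_le {D p τ r ε : ℝ} (hD : 1 / 2 ≤ D) (hp : 1 ≤ p) (hτ : 0 < τ)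
    (hr : 0 ≤ r) (hε : 0 < ε)
    (hcube : ((r + ε) ^ p - r ^ p) ^ 3 - (r ^ p - |r - ε| ^ p) ^ 3 ≤
      3 / (D + 1) * (ε ^ p) ^ 2 * (τ + r ^ p / 2)) :
    (heatProfile D p τ (r + ε) + heatProfile D p τ (r - ε) - 2 * heatProfile D p τ r) / (2 * D) +
        (τ + r ^ p / 2) ^ (-D - 1) * ((ε ^ p) ^ 2 / 32) ≤
      (τ + r ^ p / 2) ^ (-D - 1) * ((τ + r ^ p / 2) * (((r + ε) ^ p + |r - ε| ^ p - 2 * r ^ p) / 2) -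
        ((r + ε) ^ p - r ^ p - ε ^ p) * (ε ^ p + r ^ p - |r - ε| ^ p) / 8) := by
  have hS := two_mul_rpow_le_add hp hr hε.le
  unfold heatProfile
  rw [abs_of_nonneg (by linarith : 0 ≤ r + ε), abs_of_nonneg hr]
  have hrp : 0 ≤ r ^ p := by positivity
  have hap : 0 < (r + ε) ^ p := by positivity
  have hbp : 0 ≤ |r - ε| ^ p := by positivity
  generalize |r - ε| ^ p = b at *
  generalize (r + ε) ^ p = a at *
  generalize r ^ p = c at *
  generalize ε ^ p = e at *
  obtain ⟨w, hw⟩ : ∃ w, w = τ + c / 2 := ⟨_, rfl⟩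
  rw [← hw] at hcube ⊢
  have hw0 : 0 < w := by linarith
  -- Here a, b, c, e stand for (r+ε)^p, |r-ε|^p, r^p, ε^p. The third-order expansion at w = τ + c/2
  -- is used for both increments (a-c)/2 and (b-c)/2.
  have t1 := powPrimitive_taylor_le (D := D) (z := (a - c) / (2 * w)) (by linarith) hw0
    (by rw [lt_div_iff₀ (by linarith)]; linarith)
  have t2 := powPrimitive_taylor_le (D := D) (z := (b - c) / (2 * w)) (by linarith) hw0
    (by rw [lt_div_iff₀ (by linarith)]; linarith)
  rw [show w + w * ((a - c) / (2 * w)) = τ + a / 2 by field_simp; linarith] at t1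
  rw [show w + w * ((b - c) / (2 * w)) = τ + b / 2 by field_simp; linarith] at t2
  have ew : w ^ (1 - D) = w ^ (-D - 1) * w ^ 2 := by
    rw [← Real.rpow_natCast w 2, ← Real.rpow_add hw0]; congr 1; push_cast; ring
  rw [ew] at t1 t2
  have hW : 0 < w ^ (-D - 1) := by positivity
  generalize w ^ (-D - 1) = W at *
  have t3 : (powPrimitive D (τ + a / 2) + powPrimitive D (τ + b / 2) - 2 * powPrimitive D w) / (2 * D)
      ≤ W * (w * (a + b - 2 * c) / (4 * D) - ((a - c) ^ 2 + (c - b) ^ 2) / 16 +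
        (D + 1) * ((a - c) ^ 3 - (c - b) ^ 3) / (96 * w)) := by
    rw [div_le_iff₀ (by linarith)]
    calc _ = (powPrimitive D (τ + a / 2) - powPrimitive D w) +
          (powPrimitive D (τ + b / 2) - powPrimitive D w) := by ring
      _ ≤ _ := add_le_add t1 t2
      _ = _ := by field_simp; ring
  refine (add_le_add_left t3 _).trans ?_
  rw [← mul_add]
  refine mul_le_mul_of_nonneg_left ?_ hW.le
  -- The cubic Taylor term is allowed to spend half of the gain e²/16 obtained below; the constant
  -- 3/(D+1) in the hypothesis is chosen for this.
  have q1 : (D + 1) * ((a - c) ^ 3 - (c - b) ^ 3) / (96 * w) ≤ e ^ 2 / 32 := by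
    rw [div_le_iff₀ (by linarith)]
    calc _ ≤ (D + 1) * (3 / (D + 1) * e ^ 2 * w) := by gcongr
      _ = _ := by field_simp; ring
  -- The second difference a + b - 2c is nonnegative and 2D ≥ 1, so the first-order term only loses.
  have q2 : w * (a + b - 2 * c) / (4 * D) ≤ w * ((a + b - 2 * c) / 2) := by
    rw [mul_div_assoc]
    gcongr
    linarith
  -- With S = a + b - 2c, the quadratic terms satisfy -(a-c-e)(e+c-b)/8 + ((a-c)² + (c-b)²)/16 =
  -- ((S-e)² + e²)/16.
  nlinarith [sq_nonneg (a + b - 2 * c - e)]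

/-! ### Integrals over the time square -/

lemma timeSquare_eq_prod (T : ℝ) :
    timeSquare T = (volume.restrict (Icc 0 T)).prod (volume.restrict (Icc 0 T)) := by
  rw [timeSquare, Measure.prod_restrict]; rfl

instance (T : ℝ) : IsFiniteMeasure (timeSquare T) := by
  rw [timeSquare_eq_prod]; infer_instance

lemma Continuous.integrable_timeSquare {f : ℝ × ℝ → ℝ} (hf : Continuous f) (T : ℝ) :
    Integrable f (timeSquare T) :=
  hf.continuousOn.integrableOn_compact (isCompact_Icc.prod isCompact_Icc)

lemma integral_timeSquare {f : ℝ × ℝ → ℝ} (hf : Continuous f) {T : ℝ} (hT : 0 ≤ T) :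
    ∫ p, f p ∂(timeSquare T) = ∫ t in (0 : ℝ)..T, ∫ s in (0 : ℝ)..T, f (t, s) := by
  have := hf.integrable_timeSquare T
  rw [timeSquare_eq_prod] at this ⊢
  rw [integral_prod _ this, intervalIntegral.integral_of_le hT, integral_Icc_eq_integral_Ioc]
  simp_rw [intervalIntegral.integral_of_le hT, integral_Icc_eq_integral_Ioc]

/-- The double integral of a second difference of a profile increasing with `|x|` is nonnegative. -/
lemma integral_second_difference_nonneg {Ψ : ℝ → ℝ} (hΨ : Continuous Ψ)
    (hmono : ∀ x y, |x| ≤ |y| → Ψ x ≤ Ψ y) {T ε : ℝ} (hε : 0 ≤ ε) (hεT : ε ≤ T / 2) :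
    0 ≤ ∫ p, (Ψ (p.1 - p.2 + ε) + Ψ (p.1 - p.2 - ε) - 2 * Ψ (p.1 - p.2)) ∂(timeSquare T) := by
  have hT : 0 ≤ T := by linarith
  set G : ℝ → ℝ := fun x => ∫ y in (0 : ℝ)..x, Ψ y
  have hG : ∀ x, HasDerivAt G (Ψ x) x := fun x =>
    intervalIntegral.integral_hasDerivAt_right (hΨ.intervalIntegrable _ _)
      hΨ.stronglyMeasurable.stronglyMeasurableAtFilter hΨ.continuousAt
  have hGc : Continuous G := continuous_iff_continuousAt.2 fun x => (hG x).continuousAt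
  set Θ : ℝ → ℝ := fun x => ∫ y in (0 : ℝ)..x, G y
  have hΘ : ∀ x, HasDerivAt Θ (G x) x := fun x =>
    intervalIntegral.integral_hasDerivAt_right (hGc.intervalIntegrable _ _)
      hGc.stronglyMeasurable.stronglyMeasurableAtFilter hGc.continuousAt
  have hGi : ∀ a b, ∫ y in a..b, Ψ y = G b - G a := fun a b =>
    intervalIntegral.integral_eq_sub_of_hasDerivAt (fun x _ => hG x) (hΨ.intervalIntegrable _ _)
  have hΘi : ∀ a b, ∫ y in a..b, G y = Θ b - Θ a := fun a b =>
    intervalIntegral.integral_eq_sub_of_hasDerivAt (fun x _ => hΘ x) (hGc.intervalIntegrable _ _)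
  -- Since Θ'' = Ψ, the double integral of a function of t - s is a second difference of Θ with step
  -- T. The steps T and h can then be exchanged.
  have hJ : ∀ h : ℝ, ∫ p, Ψ (p.1 - p.2 + h) ∂(timeSquare T) = Θ (T + h) - 2 * Θ h + Θ (h - T) := by
    intro h
    rw [integral_timeSquare (by fun_prop) hT]
    have : ∀ t : ℝ, ∫ s in (0 : ℝ)..T, Ψ (t - s + h) = G (t + h) - G (t + (h - T)) := by
      intro t
      have e : ∀ s, Ψ (t - s + h) = Ψ (t + h - s) := fun s => by ring_nf
      simp_rw [e]
      rw [intervalIntegral.integral_comp_sub_left (fun x => Ψ x), hGi]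
      ring_nf
    simp_rw [this]
    rw [intervalIntegral.integral_sub ((by fun_prop : Continuous _).intervalIntegrable _ _)
      ((by fun_prop : Continuous _).intervalIntegrable _ _),
      intervalIntegral.integral_comp_add_right (fun x => G x),
      intervalIntegral.integral_comp_add_right (fun x => G x), hΘi, hΘi]
    ring_nf
  set J : ℝ → ℝ := fun h => Θ (T + h) - 2 * Θ h + Θ (h - T)
  have hJ' : ∀ h, HasDerivAt (fun h => J h + J (-h) - 2 * J 0)
      (∫ x in (-h)..h, (Ψ (x + T) - 2 * Ψ x + Ψ (x - T))) h := by
    intro h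
    have hJ1 : ∀ h, HasDerivAt J (G (T + h) - 2 * G h + G (h - T)) h := by
      intro h
      refine (((hΘ (T + h)).comp_const_add T h).sub ((hΘ h).const_mul 2)).add ?_
      exact (hΘ (h - T)).comp_sub_const h T
    have hJ2 : HasDerivAt (fun h => J (-h)) (-(G (T + -h) - 2 * G (-h) + G (-h - T))) h :=
      ((hJ1 (-h)).comp h (hasDerivAt_neg h)).congr_deriv (by ring)
    refine (((hJ1 h).add hJ2).sub_const _).congr_deriv ?_
    rw [intervalIntegral.integral_add ((by fun_prop : Continuous _).intervalIntegrable _ _)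
      ((by fun_prop : Continuous _).intervalIntegrable _ _),
      intervalIntegral.integral_sub ((by fun_prop : Continuous _).intervalIntegrable _ _)
      ((by fun_prop : Continuous _).intervalIntegrable _ _),
      intervalIntegral.integral_comp_add_right (fun x => Ψ x),
      intervalIntegral.integral_comp_sub_right (fun x => Ψ x),
      intervalIntegral.integral_const_mul, hGi, hGi, hGi]
    ring_nf
  have hm : MonotoneOn (fun h => J h + J (-h) - 2 * J 0) (Icc 0 ε) := by
    refine monotoneOn_of_deriv_nonneg (convex_Icc 0 ε)
      (fun x hx => (hJ' x).continuousAt.continuousWithinAt)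
      (fun x hx => (hJ' x).differentiableAt.differentiableWithinAt) fun x hx => ?_
    rw [(hJ' x).deriv]
    have hx := interior_subset hx
    refine intervalIntegral.integral_nonneg (by linarith [hx.1]) fun y hy => ?_
    -- As |y| ≤ T/2, both |y + T| and |y - T| are at least T/2 ≥ |y|; this is where ε ≤ T/2 is
    -- needed.
    have hy1 : |y| ≤ T / 2 := abs_le.2 ⟨by linarith [hy.1, hx.2], by linarith [hy.2, hx.2]⟩
    have hy2 := abs_le.1 hy1
    have h1 := hmono y (y + T) (by rw [abs_of_nonneg (a := y + T) (by linarith)]; linarith)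
    have h2 := hmono y (y - T) (by rw [abs_of_nonpos (a := y - T) (by linarith)]; linarith)
    linarith
  have hfin := hm (left_mem_Icc.2 hε) (right_mem_Icc.2 hε) hε
  have e0 : J 0 + J (-0) - 2 * J 0 = 0 := by rw [neg_zero]; ring
  simp only [e0] at hfin
  have i1 : Integrable (fun p : ℝ × ℝ => Ψ (p.1 - p.2 + ε)) (timeSquare T) :=
    Continuous.integrable_timeSquare (by fun_prop) T
  have i2 : Integrable (fun p : ℝ × ℝ => Ψ (p.1 - p.2 + -ε)) (timeSquare T) :=
    Continuous.integrable_timeSquare (by fun_prop) T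
  have i3 : Integrable (fun p : ℝ × ℝ => Ψ (p.1 - p.2 + 0)) (timeSquare T) :=
    Continuous.integrable_timeSquare (by fun_prop) T
  calc 0 ≤ _ := hfin
    _ = ∫ p, (Ψ (p.1 - p.2 + ε) + Ψ (p.1 - p.2 + -ε) - 2 * Ψ (p.1 - p.2 + 0)) ∂(timeSquare T) := by
      have i12 : Integrable (fun p : ℝ × ℝ => Ψ (p.1 - p.2 + ε) + Ψ (p.1 - p.2 + -ε))
        (timeSquare T) := i1.add i2
      rw [integral_sub i12 (i3.const_mul 2), integral_add i1 i2, integral_const_mul,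
        hJ, hJ, hJ]
    _ = _ := by simp_rw [add_zero, ← sub_eq_add_neg]

/-! ### One-dimensional Gaussian integrals -/

/-- Tilting a centred Gaussian by `exp (-c x ^ 2)` gives a multiple of a centred Gaussian. -/
lemma gaussianReal_withDensity_exp_neg_sq {v : ℝ≥0} {c : ℝ} (hv : v ≠ 0) (h : 0 < 1 + 2 * c * v) :
    (gaussianReal 0 v).withDensity (fun x => ENNReal.ofReal (Real.exp (-c * x ^ 2))) =
      ENNReal.ofReal (√(1 + 2 * c * v))⁻¹ • gaussianReal 0 (v / (1 + 2 * c * v)).toNNReal := by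
  have hv0 : 0 < (v : ℝ) := by positivity
  have hv' : (v / (1 + 2 * c * v) : ℝ).toNNReal ≠ 0 := by
    simp only [ne_eq, Real.toNNReal_eq_zero, not_le]
    positivity
  rw [gaussianReal_of_var_ne_zero _ hv, gaussianReal_of_var_ne_zero _ hv',
    ← withDensity_mul _ (measurable_gaussianPDF _ _) (by fun_prop),
    ← withDensity_smul _ (measurable_gaussianPDF _ _)]
  congr 1
  ext x
  simp only [Pi.mul_apply, Pi.smul_apply, gaussianPDF, smul_eq_mul, gaussianPDFReal, sub_zero]
  rw [← ENNReal.ofReal_mul (by positivity), ← ENNReal.ofReal_mul (by positivity),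
    Real.coe_toNNReal _ (by positivity)]
  congr 1
  rw [mul_assoc, ← Real.exp_add, ← mul_assoc, ← mul_inv, ← Real.sqrt_mul h.le]
  congr 2
  · have h' : 1 + 2 * (v : ℝ) * c ≠ 0 := by rw [mul_right_comm]; exact h.ne'
    congr 1; field_simp
  · field_simp; ring

lemma lintegral_mul_exp_neg_sq_gaussianReal {v : ℝ≥0} {c : ℝ} (hv : v ≠ 0) (h : 0 < 1 + 2 * c * v)
    {f : ℝ → ℝ≥0∞} (hf : Measurable f) :
    ∫⁻ x, ENNReal.ofReal (Real.exp (-c * x ^ 2)) * f x ∂(gaussianReal 0 v) =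
      ENNReal.ofReal (√(1 + 2 * c * v))⁻¹ *
        ∫⁻ x, f x ∂(gaussianReal 0 (v / (1 + 2 * c * v)).toNNReal) := by
  have := lintegral_withDensity_eq_lintegral_mul (gaussianReal 0 v)
    (f := fun x => ENNReal.ofReal (Real.exp (-c * x ^ 2))) (by fun_prop) hf
  rw [gaussianReal_withDensity_exp_neg_sq hv h, lintegral_smul_measure] at this
  simpa using this.symm

lemma lintegral_exp_neg_sq_gaussianReal {v : ℝ≥0} {c : ℝ} (hv : v ≠ 0) (h : 0 < 1 + 2 * c * v) :
    ∫⁻ x, ENNReal.ofReal (Real.exp (-c * x ^ 2)) ∂(gaussianReal 0 v) =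
      ENNReal.ofReal (√(1 + 2 * c * v))⁻¹ := by
  simpa using lintegral_mul_exp_neg_sq_gaussianReal hv h (f := fun _ => 1) measurable_const

lemma integral_exp_neg_sq_mul_gaussianReal {v : ℝ≥0} {c : ℝ} (hv : v ≠ 0) (h : 0 < 1 + 2 * c * v)
    (f : ℝ → ℝ) :
    ∫ x, Real.exp (-c * x ^ 2) * f x ∂(gaussianReal 0 v) =
      (√(1 + 2 * c * v))⁻¹ * ∫ x, f x ∂(gaussianReal 0 (v / (1 + 2 * c * v)).toNNReal) := by
  have := integral_withDensity_eq_integral_toReal_smul (μ := gaussianReal 0 v)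
    (f := fun x => ENNReal.ofReal (Real.exp (-c * x ^ 2))) (by fun_prop)
    (ae_of_all _ fun x => ENNReal.ofReal_lt_top) f
  rw [gaussianReal_withDensity_exp_neg_sq hv h, integral_smul_measure,
    ENNReal.toReal_ofReal (by positivity)] at this
  rw [← smul_eq_mul, this]
  refine integral_congr_ae (ae_of_all _ fun x => ?_)
  simp [ENNReal.toReal_ofReal (Real.exp_pos _).le]

lemma integral_exp_neg_sq_gaussianReal {v : ℝ≥0} {c : ℝ} (hv : v ≠ 0) (h : 0 < 1 + 2 * c * v) :
    ∫ x, Real.exp (-c * x ^ 2) ∂(gaussianReal 0 v) = (√(1 + 2 * c * v))⁻¹ := by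
  simpa using integral_exp_neg_sq_mul_gaussianReal hv h (fun _ => 1)

lemma integral_sq_gaussianReal (v : ℝ≥0) : ∫ x, x ^ 2 ∂(gaussianReal 0 v) = v := by
  have h := variance_fun_id_gaussianReal (μ := 0) (v := v)
  rw [variance_of_integral_eq_zero (by fun_prop) (by simp)] at h
  simpa using h

lemma integral_exp_neg_sq_mul_sq_gaussianReal {v : ℝ≥0} {c : ℝ} (hv : v ≠ 0) (h : 0 < 1 + 2 * c * v) :
    ∫ x, Real.exp (-c * x ^ 2) * x ^ 2 ∂(gaussianReal 0 v) =
      (√(1 + 2 * c * v))⁻¹ * (v / (1 + 2 * c * v)) := by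
  rw [integral_exp_neg_sq_mul_gaussianReal hv h, integral_sq_gaussianReal,
    Real.coe_toNNReal _ (by positivity)]

/-- A Gaussian of variance `v` charges shifted Gaussian profiles of width `μ ^ (-1 / 2)` by at most
`(2 μ v) ^ (-1 / 2)`. -/
lemma lintegral_exp_neg_sq_add_gaussianReal_le {v : ℝ≥0} {μ : ℝ} (hv : 0 < v) (hμ : 0 < μ) (m : ℝ) :
    ∫⁻ x, ENNReal.ofReal (Real.exp (-μ * (x + m) ^ 2)) ∂(gaussianReal 0 v) ≤
      ENNReal.ofReal (√(2 * μ * v))⁻¹ := by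
  have hv0 : 0 < (v : ℝ) := hv
  rw [gaussianReal_of_var_ne_zero _ hv.ne',
    lintegral_withDensity_eq_lintegral_mul _ (measurable_gaussianPDF _ _) (by fun_prop)]
  have hpi := Real.pi_pos
  calc _ ≤ ∫⁻ x, ENNReal.ofReal (√(2 * Real.pi * v))⁻¹ *
        ENNReal.ofReal (Real.exp (-μ * (x + m) ^ 2)) := by
        refine lintegral_mono fun x => ?_
        simp only [Pi.mul_apply, gaussianPDF, gaussianPDFReal]
        gcongr
        refine mul_le_of_le_one_right (by positivity) (Real.exp_le_one_iff.2 ?_)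
        rw [neg_div]
        have : 0 ≤ (x - 0) ^ 2 / (2 * (v : ℝ)) := by positivity
        linarith
    _ = ENNReal.ofReal (√(2 * Real.pi * v))⁻¹ *
        ∫⁻ x, ENNReal.ofReal (Real.exp (-μ * x ^ 2)) := by
        rw [lintegral_const_mul _ (by fun_prop),
          lintegral_add_right_eq_self (fun x => ENNReal.ofReal (Real.exp (-μ * x ^ 2)))]
    _ = ENNReal.ofReal (√(2 * Real.pi * v))⁻¹ * ENNReal.ofReal √(Real.pi / μ) := by
        rw [← ofReal_integral_eq_lintegral_ofReal (integrable_exp_neg_mul_sq hμ)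
          (ae_of_all _ fun x => (Real.exp_pos _).le), integral_gaussian]
    _ = _ := by
        rw [← ENNReal.ofReal_mul (by positivity), ← Real.sqrt_inv, ← Real.sqrt_inv,
          ← Real.sqrt_mul (by positivity)]
        congr 2
        field_simp

/-! ### Gaussian pairs: regression and weighted moments -/

section Pair

variable {Ω : Type*} [MeasurableSpace Ω] {P : Measure Ω} {y u : Ω → ℝ}

lemma ProbabilityTheory.HasGaussianLaw.map_eq_gaussianReal_of_centered (hy : HasGaussianLaw y P)
    (h0 : ∫ ω, y ω ∂P = 0) : P.map y = gaussianReal 0 Var[y; P].toNNReal := by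
  rw [hy.map_eq_gaussianReal, h0]

lemma ProbabilityTheory.HasGaussianLaw.regression (h : HasGaussianLaw (fun ω => (y ω, u ω)) P) (a : ℝ) :
    HasGaussianLaw (fun ω => (y ω, u ω - a * y ω)) P := by
  let L : ℝ × ℝ →L[ℝ] ℝ × ℝ := (ContinuousLinearMap.fst ℝ ℝ ℝ).prod
    (ContinuousLinearMap.snd ℝ ℝ ℝ - a • ContinuousLinearMap.fst ℝ ℝ ℝ)
  exact h.map_fun L

lemma covariance_regression [IsProbabilityMeasure P] (hy : MemLp y 2 P) (hu : MemLp u 2 P)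
    (hv : Var[y; P] ≠ 0) :
    cov[y, fun ω => u ω - cov[y, u; P] / Var[y; P] * y ω; P] = 0 := by
  rw [covariance_fun_sub_right hy hu (hy.const_mul _), covariance_const_mul_right,
    covariance_self hy.aemeasurable]
  field_simp
  ring

lemma variance_regression [IsProbabilityMeasure P] (hy : MemLp y 2 P) (hu : MemLp u 2 P)
    (hv : Var[y; P] ≠ 0) :
    Var[fun ω => u ω - cov[y, u; P] / Var[y; P] * y ω; P] =
      Var[u; P] - cov[y, u; P] ^ 2 / Var[y; P] := by
  rw [variance_fun_sub hu (hy.const_mul _), variance_const_mul, covariance_const_mul_right,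
    covariance_comm u y]
  field_simp
  ring

lemma integral_comp_of_centered (hy : HasGaussianLaw y P) (h0 : ∫ ω, y ω ∂P = 0) {f : ℝ → ℝ}
    (hf : Measurable f) : ∫ ω, f (y ω) ∂P = ∫ x, f x ∂(gaussianReal 0 Var[y; P].toNNReal) := by
  rw [← hy.map_eq_gaussianReal_of_centered h0, integral_map hy.aemeasurable
    hf.aestronglyMeasurable]

lemma integrable_exp_neg_sq_mul {c : ℝ} (hc : 0 ≤ c) (hy : AEMeasurable y P) {f : Ω → ℝ}
    (hf : Integrable f P) : Integrable (fun ω => Real.exp (-c * y ω ^ 2) * f ω) P := by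
  refine hf.bdd_mul (c := 1) (by fun_prop) (ae_of_all _ fun ω => ?_)
  rw [Real.norm_eq_abs, abs_of_pos (Real.exp_pos _), Real.exp_le_one_iff]
  nlinarith [sq_nonneg (y ω)]

/-- Gaussian weighted second moment of a jointly Gaussian pair. -/
lemma integral_exp_neg_sq_mul_sq (h : HasGaussianLaw (fun ω => (y ω, u ω)) P)
    (hy0 : ∫ ω, y ω ∂P = 0) (hu0 : ∫ ω, u ω ∂P = 0) {c : ℝ} (hc : 0 ≤ c) (hv : 0 < Var[y; P]) :
    ∫ ω, Real.exp (-c * y ω ^ 2) * u ω ^ 2 ∂P =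
      (√(1 + 2 * c * Var[y; P]))⁻¹ *
        (Var[u; P] - 2 * c * cov[y, u; P] ^ 2 / (1 + 2 * c * Var[y; P])) := by
  have := h.isProbabilityMeasure
  have hy := h.fst
  have hu := h.snd
  -- Regression u = a y + n with n independent of y: the square expands into a tilted second moment
  -- of y, a vanishing cross term, and Var n times the tilting factor.
  set a := cov[y, u; P] / Var[y; P] with ha
  set n : Ω → ℝ := fun ω => u ω - a * y ω with hn_def
  have hn := (h.regression a).snd
  have hn0 : ∫ ω, n ω ∂P = 0 := by
    rw [hn_def, integral_sub hu.integrable (hy.integrable.const_mul _), integral_const_mul,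
      hy0, hu0]; simp
  have hvn : ∫ ω, n ω ^ 2 ∂P = Var[u; P] - cov[y, u; P] ^ 2 / Var[y; P] := by
    rw [← variance_regression hy.memLp_two hu.memLp_two hv.ne',
      variance_of_integral_eq_zero hn.aemeasurable hn0]
  have hind : IndepFun y n P := (h.regression a).indepFun_of_covariance_eq_zero
    (covariance_regression hy.memLp_two hu.memLp_two hv.ne')
  have hvv : ((Var[y; P].toNNReal : ℝ≥0) : ℝ) = Var[y; P] := Real.coe_toNNReal _ hv.le
  have hvv0 : Var[y; P].toNNReal ≠ 0 := by simpa using hv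
  have hpos : 0 < 1 + 2 * c * ((Var[y; P].toNNReal : ℝ≥0) : ℝ) := by rw [hvv]; positivity
  have e1 : ∫ ω, Real.exp (-c * y ω ^ 2) * y ω ^ 2 ∂P =
      (√(1 + 2 * c * Var[y; P]))⁻¹ * (Var[y; P] / (1 + 2 * c * Var[y; P])) := by
    rw [integral_comp_of_centered hy hy0 (f := fun x => Real.exp (-c * x ^ 2) * x ^ 2)
      (by fun_prop), integral_exp_neg_sq_mul_sq_gaussianReal hvv0 hpos, hvv]
  have e2 : ∫ ω, Real.exp (-c * y ω ^ 2) * y ω * n ω ∂P = 0 := by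
    have := hind.integral_fun_comp_mul_comp (f := fun x => Real.exp (-c * x ^ 2) * x) (g := id)
      hy.aemeasurable hn.aemeasurable (by fun_prop) (by fun_prop)
    simpa [hn0] using this
  have e3 : ∫ ω, Real.exp (-c * y ω ^ 2) * n ω ^ 2 ∂P =
      (√(1 + 2 * c * Var[y; P]))⁻¹ * (Var[u; P] - cov[y, u; P] ^ 2 / Var[y; P]) := by
    have := hind.integral_fun_comp_mul_comp (f := fun x => Real.exp (-c * x ^ 2))
      (g := fun x => x ^ 2) hy.aemeasurable hn.aemeasurable (by fun_prop) (by fun_prop)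
    rw [this, hvn, integral_comp_of_centered hy hy0 (f := fun x => Real.exp (-c * x ^ 2))
      (by fun_prop), integral_exp_neg_sq_gaussianReal hvv0 hpos, hvv]
  have i1 := integrable_exp_neg_sq_mul hc hy.aemeasurable hy.memLp_two.integrable_sq
  have i3 := integrable_exp_neg_sq_mul hc hy.aemeasurable hn.memLp_two.integrable_sq
  have i2 : Integrable (fun ω => Real.exp (-c * y ω ^ 2) * y ω * n ω) P := by
    simp_rw [mul_assoc]
    exact integrable_exp_neg_sq_mul hc hy.aemeasurable (hy.memLp_two.integrable_mul hn.memLp_two)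
  have i12 : Integrable (fun ω => a ^ 2 * (Real.exp (-c * y ω ^ 2) * y ω ^ 2) +
      2 * a * (Real.exp (-c * y ω ^ 2) * y ω * n ω)) P := (i1.const_mul _).add (i2.const_mul _)
  calc _ = ∫ ω, (a ^ 2 * (Real.exp (-c * y ω ^ 2) * y ω ^ 2) +
      2 * a * (Real.exp (-c * y ω ^ 2) * y ω * n ω) + Real.exp (-c * y ω ^ 2) * n ω ^ 2) ∂P := by
        refine integral_congr_ae (ae_of_all _ fun ω => ?_)
        simp only [hn_def]; ring
    _ = a ^ 2 * ∫ ω, Real.exp (-c * y ω ^ 2) * y ω ^ 2 ∂P +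
      2 * a * ∫ ω, Real.exp (-c * y ω ^ 2) * y ω * n ω ∂P +
        ∫ ω, Real.exp (-c * y ω ^ 2) * n ω ^ 2 ∂P := by
        rw [integral_add i12 i3, integral_add (i1.const_mul _) (i2.const_mul _),
          integral_const_mul, integral_const_mul]
    _ = _ := by
        rw [e1, e2, e3, ha]
        have : 0 < 1 + 2 * c * Var[y; P] := by positivity
        field_simp
        ring

end Pair

/-! ### Gaussian triples: concentration of one variable under weights in the others -/

lemma ProbabilityTheory.IndepFun.lintegral_comp_prod {Ω E F : Type*} [MeasurableSpace Ω]
    [MeasurableSpace E] [MeasurableSpace F] {P : Measure Ω} [IsFiniteMeasure P] {Z : Ω → E}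
    {n : Ω → F} (h : IndepFun Z n P) (hZ : AEMeasurable Z P) (hn : AEMeasurable n P)
    {K : E × F → ℝ≥0∞} (hK : Measurable K) :
    ∫⁻ ω, K (Z ω, n ω) ∂P = ∫⁻ ω, ∫⁻ x, K (Z ω, x) ∂(P.map n) ∂P := by
  have h1 := h.map_prod_eq_prod_map_map hZ hn
  have h2 := lintegral_map' (μ := P) (f := K) (g := fun ω => (Z ω, n ω)) hK.aemeasurable
    (hZ.prodMk hn)
  rw [← h2, h1, lintegral_prod _ hK.aemeasurable,
    lintegral_map' (hK.lintegral_prod_right').aemeasurable hZ]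

lemma covariance_fun_add_right {Ω : Type*} [MeasurableSpace Ω] {P : Measure Ω} [IsFiniteMeasure P]
    {X Y Z : Ω → ℝ} (hX : MemLp X 2 P) (hY : MemLp Y 2 P) (hZ : MemLp Z 2 P) :
    cov[X, fun ω => Y ω + Z ω; P] = cov[X, Y; P] + cov[X, Z; P] :=
  covariance_add_right hX hY hZ

section Triple

variable {Ω : Type*} [MeasurableSpace Ω] {P : Measure Ω} {y z n : Ω → ℝ}

lemma iIndepFun_of_covariance_three (h : HasGaussianLaw (fun ω => (y ω, z ω, n ω)) P)
    (hyz : cov[y, z; P] = 0) (hyn : cov[y, n; P] = 0) (hzn : cov[z, n; P] = 0) :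
    IndepFun y z P ∧ IndepFun (fun ω => (y ω, z ω)) n P := by
  have hprob := h.isProbabilityMeasure
  let L : ℝ × ℝ × ℝ →L[ℝ] (Fin 3 → ℝ) := ContinuousLinearMap.pi
    ![ContinuousLinearMap.fst ℝ ℝ (ℝ × ℝ),
      (ContinuousLinearMap.fst ℝ ℝ ℝ).comp (ContinuousLinearMap.snd ℝ ℝ (ℝ × ℝ)),
      (ContinuousLinearMap.snd ℝ ℝ ℝ).comp (ContinuousLinearMap.snd ℝ ℝ (ℝ × ℝ))]
  have h1 : HasGaussianLaw (fun ω i => (![y, z, n] : Fin 3 → Ω → ℝ) i ω) P := by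
    have e : (fun ω i => (![y, z, n] : Fin 3 → Ω → ℝ) i ω) = fun ω => L (y ω, z ω, n ω) := by
      funext ω i
      fin_cases i <;> rfl
    rw [e]
    exact h.map_fun L
  have h2 := h1.iIndepFun_of_covariance_eq_zero (fun i j hij => by
    fin_cases i <;> fin_cases j <;>
      simp_all [covariance_comm z y, covariance_comm n y, covariance_comm n z])
  refine ⟨h2.indepFun (i := 0) (j := 1) (by decide), ?_⟩
  have h3 := h2.indepFun_prodMk₀ (fun i => by
    fin_cases i
    · exact h.fst.aemeasurable
    · exact h.snd.fst.aemeasurable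
    · exact h.snd.snd.aemeasurable) 0 1 2 (by decide) (by decide)
  exact h3

/-- Given (y, z), the integral over n is bounded uniformly in the shift a y + b z. What remains
factors by independence of y and z. The rate 1/(64v) is small enough that the positive exponents in
y and z cost a factor √2 each, which gives the 2. -/
lemma lintegral_exp_mul_exp_mul_exp_le [IsProbabilityMeasure P] (hy : HasGaussianLaw y P)
    (hz_law : HasGaussianLaw z P) (hn_law : HasGaussianLaw n P)
    (hy0 : ∫ ω, y ω ∂P = 0) (hz0 : ∫ ω, z ω ∂P = 0) (hn0 : ∫ ω, n ω ∂P = 0)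
    (hind1 : IndepFun y z P) (hind2 : IndepFun (fun ω => (y ω, z ω)) n P)
    {c v q : ℝ} (hc : 0 ≤ c) (hv : 0 < v) (hq : 0 < q) (hvy : Var[y; P] = v)
    (hvz0 : 0 < Var[z; P]) (hvz2 : Var[z; P] ≤ v) (hvn : q ≤ Var[n; P]) (a b : ℝ) :
    ∫⁻ ω, ENNReal.ofReal (Real.exp (-(c - 16 * (1 / (64 * v))) * y ω ^ 2)) *
      ENNReal.ofReal (Real.exp (-(-(4 * (1 / (64 * v)))) * z ω ^ 2)) *
      ENNReal.ofReal (Real.exp (-(1 / (64 * v)) * (n ω + (a * y ω + b * z ω)) ^ 2)) ∂P ≤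
      ENNReal.ofReal (2 * (√(1 + 2 * c * v))⁻¹ * (√(q / (32 * v)))⁻¹) := by
  set μ := 1 / (64 * v) with hμ
  have hμ0 : 0 < μ := by positivity
  have hμv : μ * v = 1 / 64 := by rw [hμ]; field_simp
  set K : (ℝ × ℝ) × ℝ → ℝ≥0∞ := fun w =>
    ENNReal.ofReal (Real.exp (-(c - 16 * μ) * w.1.1 ^ 2)) *
      ENNReal.ofReal (Real.exp (-(-(4 * μ)) * w.1.2 ^ 2)) *
      ENNReal.ofReal (Real.exp (-μ * (w.2 + (a * w.1.1 + b * w.1.2)) ^ 2)) with hK_def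
  have hK : Measurable K := by fun_prop
  have hvvn : ((Var[n; P].toNNReal : ℝ≥0) : ℝ) = Var[n; P] := Real.coe_toNNReal _ (by linarith)
  have hvvy : ((v.toNNReal : ℝ≥0) : ℝ) = v := Real.coe_toNNReal _ hv.le
  have hvvz : ((Var[z; P].toNNReal : ℝ≥0) : ℝ) = Var[z; P] := Real.coe_toNNReal _ hvz0.le
  calc _ = ∫⁻ ω, K ((y ω, z ω), n ω) ∂P := rfl
    _ = ∫⁻ ω, ∫⁻ x, K ((y ω, z ω), x) ∂(P.map n) ∂P :=
        hind2.lintegral_comp_prod (hy.aemeasurable.prodMk hz_law.aemeasurable)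
          hn_law.aemeasurable hK
    _ ≤ ∫⁻ ω, ENNReal.ofReal (Real.exp (-(c - 16 * μ) * y ω ^ 2)) *
      ENNReal.ofReal (Real.exp (-(-(4 * μ)) * z ω ^ 2)) *
        ENNReal.ofReal (√(2 * μ * Var[n; P]))⁻¹ ∂P := by
        refine lintegral_mono fun ω => ?_
        simp only [hK_def]
        rw [lintegral_const_mul _ (by fun_prop),
          hn_law.map_eq_gaussianReal_of_centered hn0]
        gcongr
        have := lintegral_exp_neg_sq_add_gaussianReal_le (v := Var[n; P].toNNReal)
          (by simp; linarith) hμ0 (a * y ω + b * z ω)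
        rwa [hvvn] at this
    _ = (∫⁻ ω, ENNReal.ofReal (Real.exp (-(c - 16 * μ) * y ω ^ 2)) ∂P) *
      (∫⁻ ω, ENNReal.ofReal (Real.exp (-(-(4 * μ)) * z ω ^ 2)) ∂P) *
        ENNReal.ofReal (√(2 * μ * Var[n; P]))⁻¹ := by
        have m1 := hy.aemeasurable
        have m2 := hz_law.aemeasurable
        rw [lintegral_mul_const'' _ (by fun_prop)]
        congr 1
        exact lintegral_mul_eq_lintegral_mul_lintegral_of_indepFun'' (by fun_prop) (by fun_prop)
          (hind1.comp (φ := fun x => ENNReal.ofReal (Real.exp (-(c - 16 * μ) * x ^ 2)))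
            (ψ := fun x => ENNReal.ofReal (Real.exp (-(-(4 * μ)) * x ^ 2)))
            (by fun_prop) (by fun_prop))
    _ = ENNReal.ofReal (√(1 + 2 * (c - 16 * μ) * v))⁻¹ *
      ENNReal.ofReal (√(1 + 2 * (-(4 * μ)) * Var[z; P]))⁻¹ *
        ENNReal.ofReal (√(2 * μ * Var[n; P]))⁻¹ := by
        have f1 := lintegral_map' (μ := P) (g := y)
          (f := fun x => ENNReal.ofReal (Real.exp (-(c - 16 * μ) * x ^ 2))) (by fun_prop)
          hy.aemeasurable
        have f2 := lintegral_map' (μ := P) (g := z)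
          (f := fun x => ENNReal.ofReal (Real.exp (-(-(4 * μ)) * x ^ 2))) (by fun_prop)
          hz_law.aemeasurable
        rw [hy.map_eq_gaussianReal_of_centered hy0, hvy,
          lintegral_exp_neg_sq_gaussianReal (by simpa using hv) (by rw [hvvy]; nlinarith),
          hvvy] at f1
        rw [hz_law.map_eq_gaussianReal_of_centered hz0,
          lintegral_exp_neg_sq_gaussianReal (by simpa using hvz0) (by rw [hvvz]; nlinarith),
          hvvz] at f2
        rw [← f1, ← f2]
    _ ≤ ENNReal.ofReal (√((1 + 2 * c * v) / 2))⁻¹ * ENNReal.ofReal (√(1 / 2))⁻¹ *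
        ENNReal.ofReal (√(q / (32 * v)))⁻¹ := by
        gcongr
        · nlinarith
        · nlinarith
        · rw [div_le_iff₀ (by positivity)]
          have : 2 * μ * Var[n; P] * (32 * v) = 64 * (μ * v) * Var[n; P] := by ring
          rw [this, hμv]
          linarith
    _ = _ := by
        rw [← ENNReal.ofReal_mul (by positivity), ← ENNReal.ofReal_mul (by positivity)]
        congr 2
        rw [← mul_inv, ← Real.sqrt_mul (by positivity),
          show (1 + 2 * c * v) / 2 * (1 / 2) = (1 + 2 * c * v) / 2 ^ 2 by ring,
          Real.sqrt_div (by positivity), Real.sqrt_sq (by norm_num), inv_div]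
        ring

/-- A Gaussian bound expressing that `exp (-c y ^ 2)` and the concentration of `u` at scale
`√v` act independently when `u` is nearly uncorrelated with the increments `y` and `y'`. -/
lemma lintegral_exp_three_le {y y' u : Ω → ℝ}
    (h : HasGaussianLaw (fun ω => (y ω, y' ω, u ω)) P)
    (hy0 : ∫ ω, y ω ∂P = 0) (hy'0 : ∫ ω, y' ω ∂P = 0) (hu0 : ∫ ω, u ω ∂P = 0)
    {c v q l : ℝ} (hc : 0 ≤ c) (hv : 0 < v) (hq : 0 < q)
    (hvy : Var[y; P] = v) (hvy' : Var[y'; P] = v) (hvu : 2 * q ≤ Var[u; P])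
    (hyy' : |cov[y, y'; P]| ≤ v / 2) (hyu : |cov[y, u; P]| ≤ l) (hy'u : |cov[y', u; P]| ≤ l)
    (hl : 7 * l ^ 2 ≤ q * v) :
    ∫⁻ ω, ENNReal.ofReal (Real.exp (-c * y ω ^ 2 + 2 * (1 / (64 * v)) * (y' ω - y ω) ^ 2 -
      1 / (64 * v) * u ω ^ 2)) ∂P ≤
      ENNReal.ofReal (2 * (√(1 + 2 * c * v))⁻¹ * (√(q / (32 * v)))⁻¹) := by
  have hprob := h.isProbabilityMeasure
  have hy := h.fst
  have hy' := h.snd.fst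
  have hu := h.snd.snd
  -- Gram–Schmidt on (y, y', u): z is y' minus its projection on y, and n is u minus its projections
  -- on y and z. Uncorrelated jointly Gaussian variables are independent.
  obtain ⟨ρ, hρ⟩ : ∃ ρ, ρ = cov[y, y'; P] / Var[y; P] := ⟨_, rfl⟩
  have hρ1 : |ρ| ≤ 1 / 2 := by
    rw [hρ, hvy, abs_div, abs_of_pos hv, div_le_iff₀ hv]; linarith
  obtain ⟨z, hz⟩ : ∃ z : Ω → ℝ, z = fun ω => y' ω - ρ * y ω := ⟨_, rfl⟩
  have hyz : cov[y, z; P] = 0 := by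
    rw [hz, hρ]
    exact covariance_regression hy.memLp_two hy'.memLp_two (by rw [hvy]; exact hv.ne')
  have hvz : Var[z; P] = v - ρ ^ 2 * v := by
    rw [hz, hρ, variance_regression hy.memLp_two hy'.memLp_two (by rw [hvy]; exact hv.ne'),
      hvy, hvy']
    field_simp
  have hz_law : HasGaussianLaw z P := by
    rw [hz]
    let L : ℝ × ℝ × ℝ →L[ℝ] ℝ :=
      (ContinuousLinearMap.fst ℝ ℝ ℝ).comp (ContinuousLinearMap.snd ℝ ℝ (ℝ × ℝ)) -
        ρ • ContinuousLinearMap.fst ℝ ℝ (ℝ × ℝ)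
    exact h.map_fun L
  have hρ2 : ρ ^ 2 ≤ 1 / 4 := by
    rw [← sq_abs]; nlinarith [abs_nonneg ρ]
  have hvz1 : 3 / 4 * v ≤ Var[z; P] := by rw [hvz]; nlinarith
  have hvz2 : Var[z; P] ≤ v := by rw [hvz]; nlinarith [sq_nonneg ρ]
  have hvz0 : 0 < Var[z; P] := by linarith
  have hzu : |cov[z, u; P]| ≤ 3 / 2 * l := by
    rw [hz, covariance_fun_sub_left hy'.memLp_two (hy.memLp_two.const_mul _) hu.memLp_two,
      covariance_const_mul_left]
    calc _ ≤ |cov[y', u; P]| + |ρ * cov[y, u; P]| := abs_sub _ _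
      _ ≤ l + 1 / 2 * l := by rw [abs_mul]; gcongr
      _ = _ := by ring
  obtain ⟨a, ha⟩ : ∃ a, a = cov[y, u; P] / v := ⟨_, rfl⟩
  obtain ⟨b, hb⟩ : ∃ b, b = cov[z, u; P] / Var[z; P] := ⟨_, rfl⟩
  obtain ⟨n, hn⟩ : ∃ n : Ω → ℝ, n = fun ω => u ω - (a * y ω + b * z ω) := ⟨_, rfl⟩
  have hmay := hy.memLp_two.const_mul a
  have hmbz := hz_law.memLp_two.const_mul b
  have hmab : MemLp (fun ω => a * y ω + b * z ω) 2 P := hmay.add hmbz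
  have hyn : cov[y, n; P] = 0 := by
    rw [hn, covariance_fun_sub_right hy.memLp_two hu.memLp_two hmab,
      covariance_fun_add_right hy.memLp_two hmay hmbz, covariance_const_mul_right,
      covariance_const_mul_right, hyz, covariance_self hy.aemeasurable, hvy, ha]
    field_simp; ring
  have hzn : cov[z, n; P] = 0 := by
    rw [hn, covariance_fun_sub_right hz_law.memLp_two hu.memLp_two hmab,
      covariance_fun_add_right hz_law.memLp_two hmay hmbz, covariance_const_mul_right,
      covariance_const_mul_right, covariance_comm z y, hyz, covariance_self hz_law.aemeasurable, hb]
    field_simp; ring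
  have hlaw : HasGaussianLaw (fun ω => (y ω, z ω, n ω)) P := by
    let p1 := ContinuousLinearMap.fst ℝ ℝ (ℝ × ℝ)
    let p2 := (ContinuousLinearMap.fst ℝ ℝ ℝ).comp (ContinuousLinearMap.snd ℝ ℝ (ℝ × ℝ))
    let p3 := (ContinuousLinearMap.snd ℝ ℝ ℝ).comp (ContinuousLinearMap.snd ℝ ℝ (ℝ × ℝ))
    let L : ℝ × ℝ × ℝ →L[ℝ] ℝ × ℝ × ℝ :=
      p1.prod ((p2 - ρ • p1).prod (p3 - (a • p1 + b • (p2 - ρ • p1))))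
    rw [hn, hz]
    exact h.map_fun L
  have hn_law := hlaw.snd.snd
  have hn0 : ∫ ω, n ω ∂P = 0 := by
    rw [hn, integral_sub hu.integrable ((hmab.integrable (by norm_num))),
      integral_add (hmay.integrable (by norm_num)) (hmbz.integrable (by norm_num)),
      integral_const_mul, integral_const_mul, hz,
      integral_sub hy'.integrable (hy.integrable.const_mul _), integral_const_mul, hy0, hy'0, hu0]
    simp
  have hz0 : ∫ ω, z ω ∂P = 0 := by
    rw [hz, integral_sub hy'.integrable (hy.integrable.const_mul _), integral_const_mul, hy0, hy'0]
    simp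
  have hvn : q ≤ Var[n; P] := by
    have e1 : Var[n; P] = cov[u, n; P] := by
      rw [← covariance_self hn_law.aemeasurable]
      conv_lhs => rw [hn]
      rw [covariance_fun_sub_left hu.memLp_two hmab (by rw [← hn]; exact hn_law.memLp_two),
        covariance_comm (fun ω => a * y ω + b * z ω), ← hn,
        covariance_fun_add_right hn_law.memLp_two hmay hmbz, covariance_const_mul_right,
        covariance_const_mul_right, covariance_comm n, covariance_comm n z, hyn, hzn]
      ring
    have e2 : Var[n; P] = Var[u; P] - cov[y, u; P] ^ 2 / v - cov[z, u; P] ^ 2 / Var[z; P] := by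
      rw [e1, hn, covariance_fun_sub_right hu.memLp_two hu.memLp_two hmab,
        covariance_fun_add_right hu.memLp_two hmay hmbz, covariance_const_mul_right,
        covariance_const_mul_right, covariance_self hu.aemeasurable, ha, hb, covariance_comm u y,
        covariance_comm u z]
      ring
    have e3 : cov[y, u; P] ^ 2 / v ≤ l ^ 2 / v := by
      rw [← sq_abs]; gcongr
    have e4 : cov[z, u; P] ^ 2 / Var[z; P] ≤ (3 / 2 * l) ^ 2 / (3 / 4 * v) := by
      rw [← sq_abs]; gcongr
    -- The two projections remove at most 4l²/v ≤ q from Var u ≥ 2q, so n keeps variance at least q.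
    have e5 : l ^ 2 / v + (3 / 2 * l) ^ 2 / (3 / 4 * v) ≤ q := by
      have : l ^ 2 / v + (3 / 2 * l) ^ 2 / (3 / 4 * v) = 4 * l ^ 2 / v := by field_simp; ring
      rw [this, div_le_iff₀ hv]
      nlinarith [sq_nonneg l]
    linarith
  obtain ⟨hind1, hind2⟩ := iIndepFun_of_covariance_three hlaw hyz hyn hzn
  refine (lintegral_mono fun ω => ?_).trans (lintegral_exp_mul_exp_mul_exp_le hy hz_law hn_law hy0 hz0
    hn0 hind1 hind2 hc hv hq hvy hvz0 hvz2 hvn a b)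
  set μ := 1 / (64 * v)
  have hμ0 : 0 < μ := by positivity
  rw [← ENNReal.ofReal_mul (by positivity), ← ENNReal.ofReal_mul (by positivity),
    ← Real.exp_add, ← Real.exp_add]
  refine ENNReal.ofReal_le_ofReal (Real.exp_le_exp.2 ?_)
  have e1 : n ω + (a * y ω + b * z ω) = u ω := by simp [hn]
  have e2 : y' ω - y ω = z ω + (ρ - 1) * y ω := by simp only [hz]; ring
  rw [e1, e2]
  -- Multiplied by 2/(64v), this produces exactly the weights 4/(64v) on z² and 16/(64v) on y² of
  -- the factorised bound.
  have e3 : (z ω + (ρ - 1) * y ω) ^ 2 ≤ 2 * z ω ^ 2 + 8 * y ω ^ 2 := by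
    have h4 : (ρ - 1) ^ 2 ≤ 4 := by nlinarith [abs_le.1 hρ1]
    have h5 := mul_le_mul_of_nonneg_right h4 (sq_nonneg (y ω))
    have h6 := sq_nonneg (z ω - (ρ - 1) * y ω)
    linarith [show (z ω + (ρ - 1) * y ω) ^ 2 = 2 * z ω ^ 2 + 2 * ((ρ - 1) ^ 2 * y ω ^ 2) -
      (z ω - (ρ - 1) * y ω) ^ 2 by ring]
  have e4 := mul_le_mul_of_nonneg_left e3 hμ0.le
  linarith

end Triple

/-! ### Increments of fractional Brownian motion: from one coordinate to d -/

section

variable {Ω : Type*} [MeasurableSpace Ω] {P : Measure Ω}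

/-- Gaussian weighted mixed second moment of a jointly Gaussian triple. -/
lemma integral_exp_neg_sq_mul_mul {y u v : Ω → ℝ}
    (h : HasGaussianLaw (fun ω => (y ω, u ω, v ω)) P)
    (hy0 : ∫ ω, y ω ∂P = 0) (hu0 : ∫ ω, u ω ∂P = 0) (hv0 : ∫ ω, v ω ∂P = 0) {c : ℝ} (hc : 0 ≤ c)
    (hv : 0 < Var[y; P]) :
    ∫ ω, Real.exp (-c * y ω ^ 2) * (u ω * v ω) ∂P =
      (√(1 + 2 * c * Var[y; P]))⁻¹ *
        (cov[u, v; P] - 2 * c * (cov[y, u; P] * cov[y, v; P]) / (1 + 2 * c * Var[y; P])) := by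
  have hprob := h.isProbabilityMeasure
  have hy := h.fst
  have hu := h.snd.fst
  have hv' := h.snd.snd
  let p1 := ContinuousLinearMap.fst ℝ ℝ (ℝ × ℝ)
  let p2 := (ContinuousLinearMap.fst ℝ ℝ ℝ).comp (ContinuousLinearMap.snd ℝ ℝ (ℝ × ℝ))
  let p3 := (ContinuousLinearMap.snd ℝ ℝ ℝ).comp (ContinuousLinearMap.snd ℝ ℝ (ℝ × ℝ))
  -- Polarisation: uv = ((u+v)² - (u-v)²)/4.
  have h1 : HasGaussianLaw (fun ω => (y ω, u ω + v ω)) P := h.map_fun (p1.prod (p2 + p3))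
  have h2 : HasGaussianLaw (fun ω => (y ω, u ω - v ω)) P := h.map_fun (p1.prod (p2 - p3))
  have e1 := integral_exp_neg_sq_mul_sq h1 hy0
    (by rw [integral_add hu.integrable hv'.integrable, hu0, hv0, add_zero]) hc hv
  have e2 := integral_exp_neg_sq_mul_sq h2 hy0
    (by rw [integral_sub hu.integrable hv'.integrable, hu0, hv0, sub_zero]) hc hv
  rw [variance_fun_add hu.memLp_two hv'.memLp_two,
    covariance_fun_add_right hy.memLp_two hu.memLp_two hv'.memLp_two] at e1
  rw [variance_fun_sub hu.memLp_two hv'.memLp_two,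
    covariance_fun_sub_right hy.memLp_two hu.memLp_two hv'.memLp_two] at e2
  have i1 := integrable_exp_neg_sq_mul hc hy.aemeasurable h1.snd.memLp_two.integrable_sq
  have i2 := integrable_exp_neg_sq_mul hc hy.aemeasurable h2.snd.memLp_two.integrable_sq
  calc _ = ∫ ω, (1 / 4) * (Real.exp (-c * y ω ^ 2) * (u ω + v ω) ^ 2 -
        Real.exp (-c * y ω ^ 2) * (u ω - v ω) ^ 2) ∂P := by
        refine integral_congr_ae (ae_of_all _ fun ω => ?_)
        ring
    _ = _ := by
        rw [integral_const_mul, integral_sub i1 i2, e1, e2]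
        ring

/-- The expectation of a product of functions of independent variables. -/
lemma ProbabilityTheory.iIndepFun.lintegral_prod_comp {ι E : Type*} [Fintype ι] [MeasurableSpace E]
    {Z : ι → Ω → E} (hZ : iIndepFun Z P) (mZ : ∀ i, AEMeasurable (Z i) P) {f : ι → E → ℝ≥0∞}
    (hf : ∀ i, Measurable (f i)) :
    ∫⁻ ω, ∏ i, f i (Z i ω) ∂P = ∏ i, ∫⁻ ω, f i (Z i ω) ∂P := by
  have h1 : iIndepFun (fun i => (mZ i).mk (Z i)) P := hZ.congr fun i => (mZ i).ae_eq_mk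
  have h2 := lintegral_prod_eq_prod_lintegral_of_indepFun Finset.univ
    (fun i ω => f i ((mZ i).mk (Z i) ω)) (h1.comp f hf)
    fun i => (hf i).comp (mZ i).measurable_mk
  have h3 : ∀ᵐ ω ∂P, ∀ i, Z i ω = (mZ i).mk (Z i) ω := ae_all_iff.2 fun i => (mZ i).ae_eq_mk
  calc _ = _ := lintegral_congr_ae (h3.mono fun ω hω => by simp only [hω])
    _ = _ := h2
    _ = _ := Finset.prod_congr rfl fun i _ =>
      lintegral_congr_ae ((mZ i).ae_eq_mk.mono fun ω hω => by simp only [← hω])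

/-- If ⟨U, V⟩ < 0 then Cauchy–Schwarz for ⟨U, U - V⟩ gives |U| ≤ |U - V| and -⟨U, V⟩ ≤ |U - V|²/4.
The exponential encodes both the smallness of U and the size of U - V, and it factors over
coordinates. -/
lemma neg_inner_le_exp {E : Type*} [NormedAddCommGroup E] [InnerProductSpace ℝ E] {μ : ℝ}
    (hμ : 0 < μ) (U V : E) :
    -inner ℝ U V ≤ 1 / (4 * μ) * Real.exp (2 * μ * ‖U - V‖ ^ 2 - μ * ‖U‖ ^ 2) := by
  rcases le_or_gt 0 (inner ℝ U V) with h | h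
  · have : 0 ≤ 1 / (4 * μ) * Real.exp (2 * μ * ‖U - V‖ ^ 2 - μ * ‖U‖ ^ 2) := by positivity
    linarith
  · have e1 : inner ℝ U (U - V) = ‖U‖ ^ 2 - inner ℝ U V := by
      rw [inner_sub_right, real_inner_self_eq_norm_sq]
    have e2 := real_inner_le_norm U (U - V)
    generalize ‖U - V‖ = w at *
    have e3 : ‖U‖ ^ 2 ≤ w ^ 2 := by nlinarith [sq_nonneg (‖U‖ - w)]
    have e4 : -inner ℝ U V ≤ w ^ 2 / 4 := by nlinarith [sq_nonneg (‖U‖ - w / 2)]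
    have e5 := Real.add_one_le_exp (2 * μ * w ^ 2 - μ * ‖U‖ ^ 2)
    have e6 : μ * w ^ 2 ≤ 2 * μ * w ^ 2 - μ * ‖U‖ ^ 2 := by nlinarith
    calc -inner ℝ U V ≤ w ^ 2 / 4 := e4
      _ = 1 / (4 * μ) * (μ * w ^ 2) := by field_simp
      _ ≤ _ := by gcongr; linarith

/-- The covariance of `B a - B b` and `B c - B d` for a fractional Brownian motion `B`
with Hurst index `p / 2`. -/
noncomputable def incrementCov (p a b c d : ℝ) : ℝ :=
  (|a - d| ^ p + |b - c| ^ p - |a - c| ^ p - |b - d| ^ p) / 2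

lemma incrementCov_self {p : ℝ} (hp : 0 < p) (a b : ℝ) : incrementCov p a b a b = |a - b| ^ p := by
  simp only [incrementCov, sub_self, abs_zero, Real.zero_rpow hp.ne', abs_sub_comm b a]
  ring

namespace IsFractionalBrownianReal

variable {H : ℝ} {B : ℝ≥0 → Ω → ℝ}

lemma integral_increment (hB : IsFractionalBrownianReal H B P) (a b : ℝ≥0) :
    ∫ ω, (B a ω - B b ω) ∂P = 0 := by
  rw [integral_sub (hB.gaussian.hasGaussianLaw_eval a).integrable
    (hB.gaussian.hasGaussianLaw_eval b).integrable, hB.centered, hB.centered, sub_zero]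

lemma covariance_increment [IsProbabilityMeasure P] (hB : IsFractionalBrownianReal H B P)
    (a b c d : ℝ≥0) :
    cov[fun ω => B a ω - B b ω, fun ω => B c ω - B d ω; P] = incrementCov (2 * H) a b c d := by
  have hm : ∀ t, MemLp (B t) 2 P := fun t => (hB.gaussian.hasGaussianLaw_eval t).memLp_two
  rw [covariance_fun_sub_fun_sub (hm a) (hm b) (hm c) (hm d), hB.covariance, hB.covariance,
    hB.covariance, hB.covariance, incrementCov]
  ring

lemma hasGaussianLaw_increment_three (hB : IsFractionalBrownianReal H B P) (a b c d e f : ℝ≥0) :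
    HasGaussianLaw (fun ω => (B a ω - B b ω, B c ω - B d ω, B e ω - B f ω)) P := by
  classical
  let I : Finset ℝ≥0 := {a, b, c, d, e, f}
  let L : (I → ℝ) →L[ℝ] ℝ × ℝ × ℝ :=
    { toFun x := (x ⟨a, by simp [I]⟩ - x ⟨b, by simp [I]⟩,
        x ⟨c, by simp [I]⟩ - x ⟨d, by simp [I]⟩, x ⟨e, by simp [I]⟩ - x ⟨f, by simp [I]⟩)
      map_add' x y := by ext <;> simp <;> ring
      map_smul' m x := by ext <;> simp <;> ring }
  exact (hB.gaussian.hasGaussianLaw I).map_fun L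

lemma variance_increment [IsProbabilityMeasure P] (hB : IsFractionalBrownianReal H B P)
    (hH : 0 < H) (a b : ℝ≥0) :
    Var[fun ω => B a ω - B b ω; P] = |(a : ℝ) - b| ^ (2 * H) := by
  rw [← incrementCov_self (by linarith), ← hB.covariance_increment, covariance_self]
  exact (hB.gaussian.aemeasurable a).sub (hB.gaussian.aemeasurable b)

end IsFractionalBrownianReal

namespace IsFractionalBrownian

variable {d : ℕ} {H : ℝ} {X : ℝ≥0 → Ω → EuclideanSpace ℝ (Fin d)}

lemma aemeasurable_coord (hX : IsFractionalBrownian H X P) (t : ℝ≥0) (i : Fin d) :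
    AEMeasurable (fun ω => X t ω i) P := (hX.coord i).gaussian.aemeasurable t

lemma iIndepFun_increments (hX : IsFractionalBrownian H X P) (a b c d' e f : ℝ≥0) :
    iIndepFun (fun (i : Fin d) ω => (X a ω i - X b ω i, X c ω i - X d' ω i, X e ω i - X f ω i)) P :=
  hX.indep.comp (fun _ x => (x a - x b, x c - x d', x e - x f)) fun _ => by fun_prop

variable [IsProbabilityMeasure P]

/-- In the i-th term of the inner product only coordinate i carries the product of increments; every
other coordinate contributes the bare factor (1 + 2cv)^(-1/2), where v = |a - b|^(2H). Independence
multiplies these, and a ≠ b keeps v positive. -/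
lemma integral_exp_neg_norm_sq_mul_inner (hX : IsFractionalBrownian H X P) (hH : 0 < H) {c : ℝ}
    (hc : 0 ≤ c) {a b : ℝ≥0} (hab : a ≠ b) (a₁ a₂ b₁ b₂ : ℝ≥0) :
    Integrable (fun ω => Real.exp (-c * ‖X a ω - X b ω‖ ^ 2) *
      inner ℝ (X a₁ ω - X a₂ ω) (X b₁ ω - X b₂ ω)) P ∧
    ∫ ω, Real.exp (-c * ‖X a ω - X b ω‖ ^ 2) *
      inner ℝ (X a₁ ω - X a₂ ω) (X b₁ ω - X b₂ ω) ∂P =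
      d * (√(1 + 2 * c * |(a : ℝ) - b| ^ (2 * H)))⁻¹ ^ d * (incrementCov (2 * H) a₁ a₂ b₁ b₂ -
        2 * c * (incrementCov (2 * H) a b a₁ a₂ * incrementCov (2 * H) a b b₁ b₂) /
          (1 + 2 * c * |(a : ℝ) - b| ^ (2 * H))) := by
  have e : ∀ ω, Real.exp (-c * ‖X a ω - X b ω‖ ^ 2) *
      inner ℝ (X a₁ ω - X a₂ ω) (X b₁ ω - X b₂ ω) =
      ∑ i, ∏ j, Real.exp (-c * (X a ω j - X b ω j) ^ 2) *
        if j = i then (X a₁ ω j - X a₂ ω j) * (X b₁ ω j - X b₂ ω j) else 1 := by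
    intro ω
    simp_rw [Finset.prod_mul_distrib, ← Real.exp_sum, Finset.prod_ite_eq', Finset.mem_univ, if_true,
      ← Finset.mul_sum, EuclideanSpace.norm_sq_eq, PiLp.inner_apply]
    congr 1
    · congr 1; simp
    · refine Finset.sum_congr rfl fun i _ => ?_
      simp [mul_comm]
  simp_rw [e]
  have hind := hX.iIndepFun_increments a b a₁ a₂ b₁ b₂
  have hmeas : ∀ i, AEMeasurable (fun ω => (X a ω i - X b ω i, X a₁ ω i - X a₂ ω i,
      X b₁ ω i - X b₂ ω i)) P := fun i =>
    ((hX.coord i).hasGaussianLaw_increment_three a b a₁ a₂ b₁ b₂).aemeasurable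
  have hvar : ∀ i, Var[fun ω => X a ω i - X b ω i; P] = |(a : ℝ) - b| ^ (2 * H) := fun i =>
    (hX.coord i).variance_increment hH a b
  have hab' : 0 < |(a : ℝ) - b| := abs_pos.2 (sub_ne_zero.2 (by exact_mod_cast hab))
  have hv : 0 < |(a : ℝ) - b| ^ (2 * H) := by positivity
  have hM : ∀ i j : Fin d, ∫ ω, Real.exp (-c * (X a ω j - X b ω j) ^ 2) *
        (if j = i then (X a₁ ω j - X a₂ ω j) * (X b₁ ω j - X b₂ ω j) else 1) ∂P =
      (√(1 + 2 * c * |(a : ℝ) - b| ^ (2 * H)))⁻¹ * if j = i then (incrementCov (2 * H) a₁ a₂ b₁ b₂ -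
        2 * c * (incrementCov (2 * H) a b a₁ a₂ * incrementCov (2 * H) a b b₁ b₂) /
          (1 + 2 * c * |(a : ℝ) - b| ^ (2 * H))) else 1 := by
    intro i j
    have hl := (hX.coord j).hasGaussianLaw_increment_three a b a₁ a₂ b₁ b₂
    split_ifs
    · rw [integral_exp_neg_sq_mul_mul hl ((hX.coord j).integral_increment _ _)
        ((hX.coord j).integral_increment _ _) ((hX.coord j).integral_increment _ _) hc
        (by rw [hvar]; exact hv), hvar, (hX.coord j).covariance_increment,
        (hX.coord j).covariance_increment, (hX.coord j).covariance_increment]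
    · simp_rw [mul_one]
      have hvv : ((Var[fun ω => X a ω j - X b ω j; P].toNNReal : ℝ≥0) : ℝ) =
        |(a : ℝ) - b| ^ (2 * H) := by rw [hvar]; exact Real.coe_toNNReal _ hv.le
      rw [integral_comp_of_centered hl.fst ((hX.coord j).integral_increment _ _)
        (f := fun x => Real.exp (-c * x ^ 2)) (by fun_prop),
        integral_exp_neg_sq_gaussianReal (by simpa [hvar] using hv) (by rw [hvv]; positivity), hvv]
  have hI : ∀ i : Fin d, Integrable (fun ω => ∏ j, Real.exp (-c * (X a ω j - X b ω j) ^ 2) *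
      if j = i then (X a₁ ω j - X a₂ ω j) * (X b₁ ω j - X b₂ ω j) else 1) P := by
    intro i
    simp_rw [Finset.prod_mul_distrib, ← Real.exp_sum, Finset.prod_ite_eq', Finset.mem_univ, if_true]
    have hl := (hX.coord i).hasGaussianLaw_increment_three a b a₁ a₂ b₁ b₂
    have hm : ∀ j, AEMeasurable (fun ω => X a ω j - X b ω j) P := fun j =>
      (hX.aemeasurable_coord a j).sub (hX.aemeasurable_coord b j)
    refine (hl.snd.fst.memLp_two.integrable_mul hl.snd.snd.memLp_two).bdd_mul (c := 1)
      (AEMeasurable.aestronglyMeasurable (by fun_prop)) (ae_of_all _ fun ω => ?_)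
    rw [Real.norm_eq_abs, abs_of_pos (Real.exp_pos _), Real.exp_le_one_iff, ← Finset.mul_sum,
      neg_mul, neg_nonpos]
    positivity
  refine ⟨integrable_finsetSum _ fun i _ => hI i, ?_⟩
  rw [integral_finsetSum _ fun i _ => hI i]
  have hP : ∀ i : Fin d, ∫ ω, ∏ j, Real.exp (-c * (X a ω j - X b ω j) ^ 2) *
      (if j = i then (X a₁ ω j - X a₂ ω j) * (X b₁ ω j - X b₂ ω j) else 1) ∂P =
      (√(1 + 2 * c * |(a : ℝ) - b| ^ (2 * H)))⁻¹ ^ d * (incrementCov (2 * H) a₁ a₂ b₁ b₂ -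
        2 * c * (incrementCov (2 * H) a b a₁ a₂ * incrementCov (2 * H) a b b₁ b₂) /
          (1 + 2 * c * |(a : ℝ) - b| ^ (2 * H))) := by
    intro i
    have := hind.integral_fun_prod_comp (𝕜 := ℝ) hmeas (f := fun j (z : ℝ × ℝ × ℝ) =>
      Real.exp (-c * z.1 ^ 2) * if j = i then z.2.1 * z.2.2 else 1) (fun j =>
        (Measurable.aestronglyMeasurable (by split_ifs <;> fun_prop)))
    simp only at this
    rw [this]
    simp_rw [hM, Finset.prod_mul_distrib, Finset.prod_ite_eq', Finset.mem_univ, if_true]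
    simp
  simp_rw [hP]
  simp
  ring

/-- Near the diagonal the negative part of the inner product of the two increments compensates
the singularity of the kernel. -/
lemma lintegral_exp_neg_norm_sq_mul_neg_inner_le (hX : IsFractionalBrownian H X P) (hH : 0 < H)
    {c : ℝ} (hc : 0 ≤ c) {a b a' b' : ℝ≥0} {v q l : ℝ} (hv : 0 < v) (hq : 0 < q)
    (hab : |(a : ℝ) - b| ^ (2 * H) = v) (hab' : |(a' : ℝ) - b'| ^ (2 * H) = v)
    (hqa : 2 * q ≤ |(a' : ℝ) - a| ^ (2 * H))
    (h1 : |incrementCov (2 * H) a b a' b'| ≤ v / 2) (h2 : |incrementCov (2 * H) a b a' a| ≤ l)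
    (h3 : |incrementCov (2 * H) a' b' a' a| ≤ l) (hl : 7 * l ^ 2 ≤ q * v) :
    ∫⁻ ω, ENNReal.ofReal (Real.exp (-c * ‖X a ω - X b ω‖ ^ 2)) *
      ENNReal.ofReal (-inner ℝ (X a' ω - X a ω) (X b' ω - X b ω)) ∂P ≤
      ENNReal.ofReal (16 * v * (2 * (√(1 + 2 * c * v))⁻¹ * (√(q / (32 * v)))⁻¹) ^ d) := by
  have hind := hX.iIndepFun_increments a b a' b' a' a
  have hl3 : ∀ i, HasGaussianLaw (fun ω => (X a ω i - X b ω i, X a' ω i - X b' ω i,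
      X a' ω i - X a ω i)) P := fun i =>
    (hX.coord i).hasGaussianLaw_increment_three a b a' b' a' a
  set F : ℝ × ℝ × ℝ → ℝ≥0∞ := fun z => ENNReal.ofReal (Real.exp (-c * z.1 ^ 2 +
    2 * (1 / (64 * v)) * (z.2.1 - z.1) ^ 2 - 1 / (64 * v) * z.2.2 ^ 2)) with hF
  have hFm : Measurable F := by fun_prop
  have hprod := hind.lintegral_prod_comp (fun i => (hl3 i).aemeasurable) (f := fun _ => F)
    fun _ => hFm
  calc _ ≤ ∫⁻ ω, ENNReal.ofReal (16 * v) * ∏ i, F (X a ω i - X b ω i, X a' ω i - X b' ω i,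
        X a' ω i - X a ω i) ∂P := by
        refine lintegral_mono fun ω => ?_
        simp only [hF]
        rw [← ENNReal.ofReal_mul (by positivity), ← ENNReal.ofReal_prod_of_nonneg
          (fun i _ => by positivity), ← ENNReal.ofReal_mul (by positivity)]
        refine ENNReal.ofReal_le_ofReal ?_
        have hμ : 0 < 1 / (64 * v) := by positivity
        have key := neg_inner_le_exp hμ (X a' ω - X a ω) (X b' ω - X b ω)
        rw [← Real.exp_sum]
        -- Regrouping makes the difference of the two increments over time ε a difference of two
        -- increments over the short interval between a and b, hence of small variance.
        have e1 : X a' ω - X a ω - (X b' ω - X b ω) = X a' ω - X b' ω - (X a ω - X b ω) := by abel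
        rw [e1] at key
        have e2 : ∑ i, (-c * (X a ω i - X b ω i) ^ 2 +
            2 * (1 / (64 * v)) * (X a' ω i - X b' ω i - (X a ω i - X b ω i)) ^ 2 -
              1 / (64 * v) * (X a' ω i - X a ω i) ^ 2) =
            -c * ‖X a ω - X b ω‖ ^ 2 + (2 * (1 / (64 * v)) *
              ‖X a' ω - X b' ω - (X a ω - X b ω)‖ ^ 2 - 1 / (64 * v) * ‖X a' ω - X a ω‖ ^ 2) := by
          rw [Finset.sum_sub_distrib, Finset.sum_add_distrib, ← Finset.mul_sum, ← Finset.mul_sum,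
            ← Finset.mul_sum, EuclideanSpace.norm_sq_eq, EuclideanSpace.norm_sq_eq,
            EuclideanSpace.norm_sq_eq]
          simp
          ring
        rw [e2, Real.exp_add]
        calc _ ≤ _ := mul_le_mul_of_nonneg_left key (Real.exp_pos _).le
          _ = _ := by field_simp; ring
    _ = ENNReal.ofReal (16 * v) * ∏ i : Fin d, ∫⁻ ω, F (X a ω i - X b ω i, X a' ω i - X b' ω i,
        X a' ω i - X a ω i) ∂P := by
        rw [lintegral_const_mul' _ _ ENNReal.ofReal_ne_top, hprod]
    _ ≤ ENNReal.ofReal (16 * v) * ∏ _i : Fin d,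
        ENNReal.ofReal (2 * (√(1 + 2 * c * v))⁻¹ * (√(q / (32 * v)))⁻¹) := by
        gcongr with i
        have hB := hX.coord i
        exact lintegral_exp_three_le (hl3 i) (hB.integral_increment _ _)
          (hB.integral_increment _ _) (hB.integral_increment _ _) hc hv hq
          (by rw [hB.variance_increment hH, hab]) (by rw [hB.variance_increment hH, hab'])
          (by rwa [hB.variance_increment hH]) (by rwa [hB.covariance_increment])
          (by rwa [hB.covariance_increment]) (by rwa [hB.covariance_increment]) hl
    _ = _ := by
        rw [Finset.prod_const, Finset.card_univ, Fintype.card_fin,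
          ← ENNReal.ofReal_pow (by positivity), ← ENNReal.ofReal_mul (by positivity)]

end IsFractionalBrownian

end

/-! ### Joint measurability of the paths -/

lemma tendsto_floor_mul_div_nnreal (t : ℝ≥0) :
    Tendsto (fun n : ℕ => (⌊((n : ℝ≥0) + 1) * t⌋₊ : ℝ≥0) / (n + 1)) atTop (𝓝 t) := by
  have h1 := (tendsto_nat_floor_mul_div_atTop (R := ℝ) (a := (t : ℝ)) t.2).comp
    (tendsto_atTop_add_const_right atTop (1 : ℝ) tendsto_natCast_atTop_atTop)
  rw [← NNReal.tendsto_coe]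
  refine h1.congr fun n => ?_
  simp only [Function.comp_apply, NNReal.coe_div, NNReal.coe_natCast, NNReal.coe_add,
    NNReal.coe_one]
  congr 2
  refine Eq.trans ?_ (Nonneg.nat_floor_coe (((n : ℝ≥0) + 1) * t))
  congr 1
  change _ = (((((n : ℝ≥0) + 1) * t : ℝ≥0)) : ℝ)
  push_cast
  rw [mul_comm]

/-- A process with almost surely continuous paths is jointly measurable up to null sets. -/
lemma aemeasurable_uncurry_of_continuous_paths {Ω S E : Type*} [MeasurableSpace Ω]
    [MeasurableSpace S] [TopologicalSpace E] [TopologicalSpace.PseudoMetrizableSpace E]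
    [MeasurableSpace E] [BorelSpace E] {P : Measure Ω} {ν : Measure S} [SFinite P] [SFinite ν]
    {X : ℝ≥0 → Ω → E}
    (hX : ∀ t, AEMeasurable (X t) P) (hc : ∀ᵐ ω ∂P, Continuous fun t => X t ω) {φ : S → ℝ≥0}
    (hφ : Measurable φ) : AEMeasurable (fun z : Ω × S => X (φ z.2) z.1) (P.prod ν) := by
  have hmk : ∀ᵐ ω ∂P, ∀ k n : ℕ, X ((k : ℝ≥0) / (n + 1)) ω = (hX ((k : ℝ≥0) / (n + 1))).mk _ ω :=
    ae_all_iff.2 fun k => ae_all_iff.2 fun n => (hX _).ae_eq_mk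
  -- Round the time down to the grid of step 1/(n+1). Only countably many times occur, so measurable
  -- versions can be chosen outside a single null set.
  refine aemeasurable_of_tendsto_metrizable_ae' (f := fun (n : ℕ) (z : Ω × S) =>
    (hX ((⌊((n : ℝ≥0) + 1) * φ z.2⌋₊ : ℝ≥0) / (n + 1))).mk _ z.1) (fun n => ?_) ?_
  · have h1 : Measurable fun w : Ω × ℕ => (hX ((w.2 : ℝ≥0) / (n + 1))).mk _ w.1 :=
      measurable_from_prod_countable_left fun k => (hX ((k : ℝ≥0) / (n + 1))).measurable_mk
    have h2 : Measurable fun z : Ω × S => (z.1, ⌊((n : ℝ≥0) + 1) * φ z.2⌋₊) :=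
      measurable_fst.prodMk (Nat.measurable_floor.comp
        ((hφ.comp measurable_snd).const_mul ((n : ℝ≥0) + 1)))
    exact (h1.comp h2).aemeasurable
  · have h1 : ∀ᵐ z ∂(P.prod ν), Continuous (fun t => X t z.1) ∧
        ∀ k n : ℕ, X ((k : ℝ≥0) / (n + 1)) z.1 = (hX ((k : ℝ≥0) / (n + 1))).mk _ z.1 :=
      Measure.quasiMeasurePreserving_fst.ae (hc.and hmk)
    filter_upwards [h1] with z hz
    simp_rw [← hz.2]
    exact (hz.1.tendsto _).comp (tendsto_floor_mul_div_nnreal (φ z.2))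

/-! ### Positive definiteness of the Gaussian kernel -/

/-- Real part of the characteristic function; it exhibits the Gaussian kernel as an average of
cosines. -/
lemma integral_cos_inner_stdGaussian {E : Type*} [NormedAddCommGroup E] [InnerProductSpace ℝ E]
    [FiniteDimensional ℝ E] [MeasurableSpace E] [BorelSpace E] (x : E) :
    ∫ z, Real.cos (inner ℝ z x) ∂(stdGaussian E) = Real.exp (-‖x‖ ^ 2 / 2) := by
  have h1 := charFun_stdGaussian x
  rw [charFun_apply] at h1
  have h2 := congrArg Complex.re h1
  have hi : Integrable (fun z : E => Complex.exp (inner ℝ z x * Complex.I)) (stdGaussian E) := by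
    refine (integrable_const (1 : ℝ)).mono' (Continuous.aestronglyMeasurable (by fun_prop))
      (ae_of_all _ fun z => ?_)
    rw [Complex.norm_exp_ofReal_mul_I]
  have h3 := integral_re hi
  simp only [RCLike.re_to_complex, Complex.exp_ofReal_mul_I_re] at h3
  rw [h3, h2, show (-(‖x‖ : ℂ) ^ 2 / 2) = ((-‖x‖ ^ 2 / 2 : ℝ) : ℂ) by push_cast; ring,
    Complex.exp_ofReal_re]

/-- The double integral is the squared norm of the integral of A over [0, T]. -/
lemma integral_inner_timeSquare_nonneg {E : Type*} [NormedAddCommGroup E] [InnerProductSpace ℝ E]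
    [CompleteSpace E] {A : ℝ → E} (hA : Continuous A) (T : ℝ) :
    0 ≤ ∫ p, inner ℝ (A p.1) (A p.2) ∂(timeSquare T) := by
  have hi : Integrable (fun p : ℝ × ℝ => inner ℝ (A p.1) (A p.2)) (timeSquare T) :=
    Continuous.integrable_timeSquare (by fun_prop) T
  have hA' : Integrable A (volume.restrict (Icc 0 T)) :=
    hA.continuousOn.integrableOn_compact isCompact_Icc
  rw [timeSquare_eq_prod] at hi ⊢
  rw [integral_prod _ hi]
  simp_rw [integral_inner hA', real_inner_comm (∫ y, A y ∂(volume.restrict (Icc 0 T)))]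
  rw [integral_inner hA']
  exact real_inner_self_nonneg

/-- The Gaussian kernel is positive definite. -/
lemma integral_exp_neg_norm_sq_mul_inner_nonneg {E : Type*} [NormedAddCommGroup E]
    [InnerProductSpace ℝ E] [FiniteDimensional ℝ E] [MeasurableSpace E] [BorelSpace E]
    {x D : ℝ → E} (hx : Continuous x) (hD : Continuous D) {c : ℝ} (hc : 0 ≤ c) (T : ℝ) :
    0 ≤ ∫ p, Real.exp (-c * ‖x p.1 - x p.2‖ ^ 2) * inner ℝ (D p.1) (D p.2) ∂(timeSquare T) := by
  -- The scale k turns exp(-|kx|²/2) into exp(-c|x|²). After cos(a - b) = cos a cos b + sin a sin b,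
  -- each frequency z contributes two squared norms.
  set k := √(2 * c)
  have hk : k ^ 2 = 2 * c := Real.sq_sqrt (by positivity)
  have e : ∀ p : ℝ × ℝ, Real.exp (-c * ‖x p.1 - x p.2‖ ^ 2) * inner ℝ (D p.1) (D p.2) =
      ∫ z, Real.cos (inner ℝ z (k • (x p.1 - x p.2))) * inner ℝ (D p.1) (D p.2)
        ∂(stdGaussian E) := by
    intro p
    rw [integral_mul_const, integral_cos_inner_stdGaussian, norm_smul, mul_pow, Real.norm_eq_abs,
      sq_abs, hk]
    ring_nf
  simp_rw [e]
  have hDi : Integrable (fun p : ℝ × ℝ => inner ℝ (D p.1) (D p.2)) (timeSquare T) :=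
    Continuous.integrable_timeSquare (by fun_prop) T
  rw [integral_integral_swap]
  · refine integral_nonneg fun z => ?_
    have i1 : Integrable (fun p : ℝ × ℝ => inner ℝ (Real.cos (inner ℝ z (k • x p.1)) • D p.1)
        (Real.cos (inner ℝ z (k • x p.2)) • D p.2)) (timeSquare T) :=
      Continuous.integrable_timeSquare (by fun_prop) T
    have i2 : Integrable (fun p : ℝ × ℝ => inner ℝ (Real.sin (inner ℝ z (k • x p.1)) • D p.1)
        (Real.sin (inner ℝ z (k • x p.2)) • D p.2)) (timeSquare T) :=
      Continuous.integrable_timeSquare (by fun_prop) T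
    have h1 := integral_inner_timeSquare_nonneg
      (A := fun t => Real.cos (inner ℝ z (k • x t)) • D t) (by fun_prop) T
    have h2 := integral_inner_timeSquare_nonneg
      (A := fun t => Real.sin (inner ℝ z (k • x t)) • D t) (by fun_prop) T
    refine (add_nonneg h1 h2).trans_eq ?_
    rw [← integral_add i1 i2]
    refine integral_congr_ae (ae_of_all _ fun p => ?_)
    simp only [smul_sub, inner_sub_right, Real.cos_sub, real_inner_smul_left, real_inner_smul_right]
    ring
  · refine Integrable.mono' (hDi.norm.comp_fst (stdGaussian E))
      (Continuous.aestronglyMeasurable (by fun_prop)) (ae_of_all _ fun w => ?_)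
    simp only [Function.uncurry, norm_mul]
    exact mul_le_of_le_one_left (norm_nonneg _) (Real.abs_cos_le_one _)

/-! ### Extended integrals of differences of nonnegative functions -/

section ExtIntegral

variable {Ω : Type*} [MeasurableSpace Ω] {P : Measure Ω} {F G : Ω → ℝ≥0∞}

/-- Finiteness of G almost everywhere excludes ∞ - ∞, the case in which negating F - G does not give
G - F. -/
lemma extIntegral_sub_eq (hG : ∀ᵐ ω ∂P, G ω < ∞) :
    extIntegral P (fun ω => (F ω : EReal) - (G ω : EReal)) =
      ((∫⁻ ω, (F ω - G ω) ∂P : ℝ≥0∞) : EReal) - ((∫⁻ ω, (G ω - F ω) ∂P : ℝ≥0∞) : EReal) := by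
  unfold extIntegral
  have h1 : ∫⁻ ω, ((F ω : EReal) - (G ω : EReal)).toENNReal ∂P = ∫⁻ ω, (F ω - G ω) ∂P :=
    lintegral_congr fun ω => by
      rw [EReal.toENNReal_sub (EReal.coe_ennreal_nonneg _), EReal.toENNReal_coe,
        EReal.toENNReal_coe]
  have h2 : ∫⁻ ω, (-((F ω : EReal) - (G ω : EReal))).toENNReal ∂P = ∫⁻ ω, (G ω - F ω) ∂P :=
    lintegral_congr_ae (hG.mono fun ω hω => by
      simp only
      rw [EReal.neg_sub (Or.inl (EReal.coe_ennreal_ne_bot _))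
        (Or.inr (by simpa using hω.ne)), add_comm, ← sub_eq_add_neg,
        EReal.toENNReal_sub (EReal.coe_ennreal_nonneg _), EReal.toENNReal_coe,
        EReal.toENNReal_coe])
  rw [h1, h2]

/-- Subtraction-free form of (F - G)⁺ - (F - G)⁻ = F - G, valid even when integrals are infinite. -/
lemma lintegral_tsub_add (hF : AEMeasurable F P) (hG : AEMeasurable G P) :
    ∫⁻ ω, (F ω - G ω) ∂P + ∫⁻ ω, G ω ∂P = ∫⁻ ω, F ω ∂P + ∫⁻ ω, (G ω - F ω) ∂P := by
  rw [← lintegral_add_right' _ hG, ← lintegral_add_left' hF]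
  refine lintegral_congr fun ω => ?_
  rcases le_total (F ω) (G ω) with h | h
  · rw [tsub_eq_zero_of_le h, zero_add, add_tsub_cancel_of_le h]
  · rw [tsub_eq_zero_of_le h, add_zero, tsub_add_cancel_of_le h]

lemma extIntegral_sub_le (hF : AEMeasurable F P) (hG : AEMeasurable G P)
    (hGi : ∫⁻ ω, G ω ∂P ≠ ∞) {m : ℝ≥0∞} (h : ∫⁻ ω, F ω ∂P ≤ ∫⁻ ω, G ω ∂P + m) :
    extIntegral P (fun ω => (F ω : EReal) - (G ω : EReal)) ≤ m := by
  rw [extIntegral_sub_eq (ae_lt_top' hG hGi)]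
  have h1 := lintegral_tsub_add hF hG
  refine EReal.sub_le_of_le_add ?_
  rw [← EReal.coe_ennreal_add, EReal.coe_ennreal_le_coe_ennreal_iff]
  rw [← ENNReal.add_le_add_iff_right hGi, h1]
  calc _ ≤ (∫⁻ ω, G ω ∂P + m) + ∫⁻ ω, (G ω - F ω) ∂P := by gcongr
    _ = _ := by ring

/-- Only the integral of G has to be finite: F may have infinite integral, and the extended integral
is then +∞. -/
lemma le_extIntegral_sub (hF : AEMeasurable F P) (hG : AEMeasurable G P)
    (hGi : ∫⁻ ω, G ω ∂P ≠ ∞) {m : ℝ≥0∞} (h : ∫⁻ ω, G ω ∂P + m ≤ ∫⁻ ω, F ω ∂P) :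
    (m : EReal) ≤ extIntegral P (fun ω => (F ω : EReal) - (G ω : EReal)) := by
  rw [extIntegral_sub_eq (ae_lt_top' hG hGi)]
  have h1 := lintegral_tsub_add hF hG
  have h2 : ∫⁻ ω, (G ω - F ω) ∂P ≠ ∞ :=
    ((lintegral_mono fun ω => tsub_le_self).trans_lt hGi.lt_top).ne
  refine EReal.le_sub_iff_add_le (Or.inl (EReal.coe_ennreal_ne_bot _))
    (Or.inl (by simpa using h2)) |>.2 ?_
  rw [← EReal.coe_ennreal_add, EReal.coe_ennreal_le_coe_ennreal_iff]
  rw [← ENNReal.add_le_add_iff_right hGi, h1]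
  calc _ = (∫⁻ ω, G ω ∂P + m) + ∫⁻ ω, (G ω - F ω) ∂P := by ring
    _ ≤ _ := by gcongr

end ExtIntegral

/-! ### Heat kernel decomposition and reduction to fixed τ -/

section Parts

variable {d : ℕ}

/-- The weight of the heat kernel at time `τ` in the Bessel kernel. -/
noncomputable def heatWeight (d : ℕ) (α τ : ℝ) : ℝ≥0∞ :=
  ENNReal.ofReal (1 / (Real.Gamma α * (4 * Real.pi) ^ ((d : ℝ) / 2))) *
    ENNReal.ofReal (τ ^ (α - (d : ℝ) / 2 - 1) * Real.exp (-τ))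

lemma measurable_heatWeight (d : ℕ) (α : ℝ) : Measurable (heatWeight d α) := by
  unfold heatWeight; fun_prop

/-- The unnormalised heat kernel. -/
noncomputable def heatFactor (τ : ℝ) (x : EuclideanSpace ℝ (Fin d)) : ℝ≥0∞ :=
  ENNReal.ofReal (Real.exp (-(1 / (4 * τ)) * ‖x‖ ^ 2))

lemma measurable_heatFactor : Measurable fun z : ℝ × EuclideanSpace ℝ (Fin d) =>
    heatFactor z.1 z.2 := by
  unfold heatFactor; fun_prop

lemma besselKernel_eq (α : ℝ) (x : EuclideanSpace ℝ (Fin d)) :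
    besselKernel α x = ∫⁻ τ in Ioi (0 : ℝ), heatWeight d α τ * heatFactor τ x := by
  unfold besselKernel heatWeight heatFactor
  rw [← lintegral_const_mul' _ _ ENNReal.ofReal_ne_top]
  refine setLIntegral_congr_fun measurableSet_Ioi fun τ hτ => ?_
  have hτ : 0 < τ := hτ
  rw [mul_assoc, ← ENNReal.ofReal_mul
    (by positivity : 0 ≤ τ ^ (α - (d : ℝ) / 2 - 1) * Real.exp (-τ))]
  congr 2
  rw [mul_assoc, ← Real.exp_add, Real.rpow_sub_one hτ.ne']
  have e : -τ + -(1 / (4 * τ)) * ‖x‖ ^ 2 = -‖x‖ ^ 2 / (4 * τ) - τ := by field_simp; ring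
  rw [e]; ring

lemma measurable_besselKernel (α : ℝ) :
    Measurable (besselKernel α : EuclideanSpace ℝ (Fin d) → ℝ≥0∞) := by
  have : (besselKernel α : EuclideanSpace ℝ (Fin d) → ℝ≥0∞) =
      fun x => ∫⁻ τ in Ioi (0 : ℝ), heatWeight d α τ * heatFactor τ x := by
    ext x; exact besselKernel_eq α x
  rw [this]
  refine Measurable.lintegral_prod_right' (f := fun z : EuclideanSpace ℝ (Fin d) × ℝ =>
    heatWeight d α z.2 * heatFactor z.2 z.1) ?_
  exact ((measurable_heatWeight d α).comp measurable_snd).mul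
    (measurable_heatFactor.comp measurable_swap)

/-- The positive part (`σ = 1`) or negative part (`σ = -1`) of the inner product of the difference
quotients. -/
noncomputable def innerPart (σ ε : ℝ) (x : ℝ≥0 → EuclideanSpace ℝ (Fin d)) (p : ℝ × ℝ) : ℝ≥0∞ :=
  ENNReal.ofReal (σ * inner ℝ (forwardQuotient ε x p.1) (forwardQuotient ε x p.2))

lemma toENNReal_forwardIntegrand (α ε : ℝ) (x : ℝ≥0 → EuclideanSpace ℝ (Fin d)) (p : ℝ × ℝ) :
    (forwardIntegrand α ε x p).toENNReal =
      besselKernel α (x p.1.toNNReal - x p.2.toNNReal) * innerPart 1 ε x p := by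
  rw [forwardIntegrand, EReal.toENNReal_mul (EReal.coe_ennreal_nonneg _), EReal.toENNReal_coe,
    EReal.real_coe_toENNReal, innerPart, one_mul]

lemma toENNReal_neg_forwardIntegrand (α ε : ℝ) (x : ℝ≥0 → EuclideanSpace ℝ (Fin d)) (p : ℝ × ℝ) :
    (-forwardIntegrand α ε x p).toENNReal =
      besselKernel α (x p.1.toNNReal - x p.2.toNNReal) * innerPart (-1) ε x p := by
  rw [forwardIntegrand, ← mul_neg, EReal.toENNReal_mul (EReal.coe_ennreal_nonneg _),
    EReal.toENNReal_coe, ← EReal.coe_neg, EReal.real_coe_toENNReal, innerPart, neg_one_mul]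

lemma abs_forwardIntegrand (α ε : ℝ) (x : ℝ≥0 → EuclideanSpace ℝ (Fin d)) (p : ℝ × ℝ) :
    (forwardIntegrand α ε x p).abs =
      besselKernel α (x p.1.toNNReal - x p.2.toNNReal) * innerPart 1 ε x p +
      besselKernel α (x p.1.toNNReal - x p.2.toNNReal) * innerPart (-1) ε x p := by
  rw [forwardIntegrand, EReal.abs_mul, EReal.abs_def, ← mul_add]
  congr 1
  · induction besselKernel α (x p.1.toNNReal - x p.2.toNNReal) with
    | top => rfl
    | coe r =>
      exact (congrArg ENNReal.ofReal (abs_of_nonneg r.coe_nonneg)).trans ENNReal.ofReal_coe_nnreal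
  · unfold innerPart
    rcases le_total 0 (inner ℝ (forwardQuotient ε x p.1) (forwardQuotient ε x p.2)) with h | h
    · rw [abs_of_nonneg h, ENNReal.ofReal_of_nonpos (p := -1 * _) (by linarith), one_mul, add_zero]
    · rw [abs_of_nonpos h, ENNReal.ofReal_of_nonpos (p := 1 * _) (by linarith), neg_one_mul,
        zero_add]

lemma forwardZ_eq {Ω : Type*} (T : ℝ) (X : ℝ≥0 → Ω → EuclideanSpace ℝ (Fin d)) (α ε : ℝ) (ω : Ω) :
    forwardZ T X α ε ω =
      ((∫⁻ p, besselKernel α (X p.1.toNNReal ω - X p.2.toNNReal ω) *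
        innerPart 1 ε (fun t => X t ω) p ∂(timeSquare T) : ℝ≥0∞) : EReal) -
      ((∫⁻ p, besselKernel α (X p.1.toNNReal ω - X p.2.toNNReal ω) *
        innerPart (-1) ε (fun t => X t ω) p ∂(timeSquare T) : ℝ≥0∞) : EReal) := by
  unfold forwardZ extIntegral
  simp_rw [toENNReal_forwardIntegrand, toENNReal_neg_forwardIntegrand]

end Parts

namespace IsFractionalBrownian

variable {Ω : Type*} [MeasurableSpace Ω] {P : Measure Ω} {d : ℕ} {H : ℝ}
  {X : ℝ≥0 → Ω → EuclideanSpace ℝ (Fin d)}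

lemma aemeasurable (hX : IsFractionalBrownian H X P) (t : ℝ≥0) : AEMeasurable (X t) P := by
  have h : AEMeasurable (fun ω (i : Fin d) => X t ω i) P :=
    aemeasurable_pi_lambda _ fun i => hX.aemeasurable_coord t i
  exact (WithLp.measurable_toLp 2 (Fin d → ℝ)).comp_aemeasurable h

lemma ae_continuous (hX : IsFractionalBrownian H X P) :
    ∀ᵐ ω ∂P, Continuous fun t => X t ω := by
  have h : ∀ᵐ ω ∂P, ∀ i, Continuous fun t => X t ω i :=
    ae_all_iff.2 fun i => (hX.coord i).continuous_paths
  filter_upwards [h] with ω hω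
  exact (PiLp.continuous_toLp 2 (fun _ : Fin d => ℝ)).comp (continuous_pi hω)

variable [IsProbabilityMeasure P]

lemma aemeasurable_comp (hX : IsFractionalBrownian H X P) {φ : ℝ × ℝ → ℝ≥0} (hφ : Measurable φ)
    (T : ℝ) : AEMeasurable (fun z : Ω × (ℝ × ℝ) => X (φ z.2) z.1) (P.prod (timeSquare T)) :=
  aemeasurable_uncurry_of_continuous_paths hX.aemeasurable hX.ae_continuous hφ

lemma aemeasurable_innerPart (hX : IsFractionalBrownian H X P) (σ ε T : ℝ) :
    AEMeasurable (fun z : Ω × (ℝ × ℝ) => innerPart σ ε (fun t => X t z.1) z.2)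
      (P.prod (timeSquare T)) := by
  have h1 := hX.aemeasurable_comp (φ := fun p => (p.1 + ε).toNNReal) (by fun_prop) T
  have h2 := hX.aemeasurable_comp (φ := fun p => p.1.toNNReal) (by fun_prop) T
  have h3 := hX.aemeasurable_comp (φ := fun p => (p.2 + ε).toNNReal) (by fun_prop) T
  have h4 := hX.aemeasurable_comp (φ := fun p => p.2.toNNReal) (by fun_prop) T
  unfold innerPart forwardQuotient
  exact ((((h1.sub h2).const_smul ε⁻¹).inner ((h3.sub h4).const_smul ε⁻¹)).const_mul
    σ).ennreal_ofReal

lemma aemeasurable_sub (hX : IsFractionalBrownian H X P) (T : ℝ) :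
    AEMeasurable (fun z : Ω × (ℝ × ℝ) => X z.2.1.toNNReal z.1 - X z.2.2.toNNReal z.1)
      (P.prod (timeSquare T)) :=
  (hX.aemeasurable_comp (φ := fun p => p.1.toNNReal) (by fun_prop) T).sub
    (hX.aemeasurable_comp (φ := fun p => p.2.toNNReal) (by fun_prop) T)

lemma aemeasurable_besselKernel_mul (hX : IsFractionalBrownian H X P) (α σ ε T : ℝ) :
    AEMeasurable (fun z : Ω × (ℝ × ℝ) => besselKernel α (X z.2.1.toNNReal z.1 - X z.2.2.toNNReal z.1) *
      innerPart σ ε (fun t => X t z.1) z.2) (P.prod (timeSquare T)) :=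
  ((measurable_besselKernel α).comp_aemeasurable (hX.aemeasurable_sub T)).mul
    (hX.aemeasurable_innerPart σ ε T)

lemma aemeasurable_heatFactor_mul (hX : IsFractionalBrownian H X P) (τ σ ε T : ℝ) :
    AEMeasurable (fun z : Ω × (ℝ × ℝ) => heatFactor τ (X z.2.1.toNNReal z.1 - X z.2.2.toNNReal z.1) *
      innerPart σ ε (fun t => X t z.1) z.2) (P.prod (timeSquare T)) :=
  ((measurable_heatFactor.comp (measurable_const.prodMk measurable_id)).comp_aemeasurable
    (hX.aemeasurable_sub T)).mul (hX.aemeasurable_innerPart σ ε T)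

/-- Tonelli with τ outermost, applied to each sign separately so that no integrability is required.
-/
lemma lintegral_besselKernel_mul (hX : IsFractionalBrownian H X P) (α σ ε T : ℝ) :
    ∫⁻ ω, ∫⁻ p, besselKernel α (X p.1.toNNReal ω - X p.2.toNNReal ω) *
      innerPart σ ε (fun t => X t ω) p ∂(timeSquare T) ∂P =
    ∫⁻ τ in Ioi (0 : ℝ), heatWeight d α τ * ∫⁻ p, ∫⁻ ω,
      heatFactor τ (X p.1.toNNReal ω - X p.2.toNNReal ω) *
        innerPart σ ε (fun t => X t ω) p ∂P ∂(timeSquare T) := by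
  have hY := hX.aemeasurable_sub T
  have hI := hX.aemeasurable_innerPart σ ε T
  rw [← lintegral_prod _ (hX.aemeasurable_besselKernel_mul α σ ε T)]
  calc _ = ∫⁻ z, (∫⁻ τ in Ioi (0 : ℝ), heatWeight d α τ *
        (heatFactor τ (X z.2.1.toNNReal z.1 - X z.2.2.toNNReal z.1) *
        innerPart σ ε (fun t => X t z.1) z.2)) ∂(P.prod (timeSquare T)) := by
        refine lintegral_congr fun z => ?_
        rw [besselKernel_eq, ← lintegral_mul_const]
        · simp_rw [mul_assoc]
        · exact (measurable_heatWeight d α).mul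
            (measurable_heatFactor.comp (measurable_id.prodMk measurable_const))
    _ = ∫⁻ τ in Ioi (0 : ℝ), ∫⁻ z, heatWeight d α τ *
        (heatFactor τ (X z.2.1.toNNReal z.1 - X z.2.2.toNNReal z.1) *
        innerPart σ ε (fun t => X t z.1) z.2) ∂(P.prod (timeSquare T)) := by
        refine lintegral_lintegral_swap ?_
        have m1 := measurable_heatFactor.comp_aemeasurable
          (measurable_snd.aemeasurable.prodMk (hY.comp_fst (ν := volume.restrict (Ioi (0 : ℝ)))))
        have m2 := hI.comp_fst (ν := volume.restrict (Ioi (0 : ℝ)))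
        exact ((measurable_heatWeight d α).comp measurable_snd).aemeasurable.mul (m1.mul m2)
    _ = _ := by
        refine lintegral_congr fun τ => ?_
        have hm := hX.aemeasurable_heatFactor_mul τ σ ε T
        rw [lintegral_const_mul'' _ hm, lintegral_prod_symm _ hm]

end IsFractionalBrownian

/-! ### The mean at fixed τ, t and s -/

lemma lintegral_ofReal_add_ofReal_neg_integral {Ω : Type*} [MeasurableSpace Ω] {P : Measure Ω}
    {f : Ω → ℝ} (hf : Integrable f P) :
    ∫⁻ ω, ENNReal.ofReal (f ω) ∂P + ENNReal.ofReal (-∫ ω, f ω ∂P) =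
      ∫⁻ ω, ENNReal.ofReal (-f ω) ∂P + ENNReal.ofReal (∫ ω, f ω ∂P) := by
  have h1 : ∫⁻ ω, ENNReal.ofReal (f ω) ∂P ≠ ∞ :=
    hf.lintegral_lt_top.ne
  have h2 : ∫⁻ ω, ENNReal.ofReal (-f ω) ∂P ≠ ∞ := hf.neg.lintegral_lt_top.ne
  have h3 := integral_eq_lintegral_pos_part_sub_lintegral_neg_part hf
  rw [← ENNReal.toReal_eq_toReal_iff' (by finiteness) (by finiteness),
    ENNReal.toReal_add h1 (by finiteness), ENNReal.toReal_add h2 (by finiteness),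
    ENNReal.toReal_ofReal', ENNReal.toReal_ofReal']
  rcases le_total 0 (∫ ω, f ω ∂P) with h | h
  · rw [max_eq_right (by linarith), max_eq_left h]; linarith
  · rw [max_eq_left (by linarith), max_eq_right h]; linarith

/-- The expectation of `exp (-|Y|² / (4 τ)) ⟨D_ε X_t, D_ε X_s⟩` as a function of `x = t - s`. -/
noncomputable def heatMean (d : ℕ) (p τ ε x : ℝ) : ℝ :=
  ε⁻¹ ^ 2 * (d * √(τ / (τ + |x| ^ p / 2)) ^ d * ((|x + ε| ^ p + |x - ε| ^ p - 2 * |x| ^ p) / 2 -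
    (|x + ε| ^ p - |x| ^ p - ε ^ p) * (ε ^ p + |x| ^ p - |x - ε| ^ p) / (8 * (τ + |x| ^ p / 2))))

lemma inv_sqrt_one_add {τ v : ℝ} (hτ : 0 < τ) :
    (√(1 + 2 * (1 / (4 * τ)) * v))⁻¹ = √(τ / (τ + v / 2)) := by
  rw [← Real.sqrt_inv]
  congr 1
  have : 1 + 2 * (1 / (4 * τ)) * v = (τ + v / 2) / τ := by field_simp; ring
  rw [this, inv_div]

lemma heatFactor_mul_innerPart {Ω : Type*} {d : ℕ}
    (X : ℝ≥0 → Ω → EuclideanSpace ℝ (Fin d)) (τ σ ε t s : ℝ) (ω : Ω) :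
    heatFactor τ (X t.toNNReal ω - X s.toNNReal ω) * innerPart σ ε (fun t => X t ω) (t, s) =
      ENNReal.ofReal (σ * (Real.exp (-(1 / (4 * τ)) * ‖X t.toNNReal ω - X s.toNNReal ω‖ ^ 2) *
      inner ℝ (forwardQuotient ε (fun t => X t ω) t) (forwardQuotient ε (fun t => X t ω) s))) := by
  unfold heatFactor innerPart
  rw [← ENNReal.ofReal_mul (Real.exp_pos _).le]
  ring_nf

namespace IsFractionalBrownian

variable {Ω : Type*} [MeasurableSpace Ω] {P : Measure Ω} [IsProbabilityMeasure P] {d : ℕ} {H : ℝ}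
  {X : ℝ≥0 → Ω → EuclideanSpace ℝ (Fin d)}

/-- The Gaussian formula with c = 1/(4τ). All covariances involved depend on t - s only, by
stationarity of the increments. -/
lemma integral_exp_mul_inner_forwardQuotient (hX : IsFractionalBrownian H X P) (hH : 0 < H)
    {τ ε t s : ℝ} (hτ : 0 < τ) (hε : 0 < ε) (ht : 0 ≤ t) (hs : 0 ≤ s) (hts : t ≠ s) :
    Integrable (fun ω => Real.exp (-(1 / (4 * τ)) * ‖X t.toNNReal ω - X s.toNNReal ω‖ ^ 2) *
      inner ℝ (forwardQuotient ε (fun t => X t ω) t) (forwardQuotient ε (fun t => X t ω) s)) P ∧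
    ∫ ω, Real.exp (-(1 / (4 * τ)) * ‖X t.toNNReal ω - X s.toNNReal ω‖ ^ 2) *
      inner ℝ (forwardQuotient ε (fun t => X t ω) t) (forwardQuotient ε (fun t => X t ω) s) ∂P =
      heatMean d (2 * H) τ ε (t - s) := by
  obtain ⟨h1, h2⟩ := hX.integral_exp_neg_norm_sq_mul_inner hH (c := 1 / (4 * τ)) (by positivity)
    (a := t.toNNReal) (b := s.toNNReal) (fun h => hts ((Real.toNNReal_eq_toNNReal_iff ht hs).1 h))
    (t + ε).toNNReal t.toNNReal (s + ε).toNNReal s.toNNReal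
  have e : ∀ ω, Real.exp (-(1 / (4 * τ)) * ‖X t.toNNReal ω - X s.toNNReal ω‖ ^ 2) *
      inner ℝ (forwardQuotient ε (fun t => X t ω) t) (forwardQuotient ε (fun t => X t ω) s) =
      ε⁻¹ ^ 2 * (Real.exp (-(1 / (4 * τ)) * ‖X t.toNNReal ω - X s.toNNReal ω‖ ^ 2) *
        inner ℝ (X (t + ε).toNNReal ω - X t.toNNReal ω)
          (X (s + ε).toNNReal ω - X s.toNNReal ω)) := by
    intro ω
    simp only [forwardQuotient, real_inner_smul_left, real_inner_smul_right]
    ring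
  simp_rw [e]
  refine ⟨h1.const_mul _, ?_⟩
  rw [integral_const_mul, h2, inv_sqrt_one_add hτ, Real.coe_toNNReal t ht, Real.coe_toNNReal s hs,
    Real.coe_toNNReal (t + ε) (by linarith), Real.coe_toNNReal (s + ε) (by linarith), heatMean]
  have hw : 0 < τ + |t - s| ^ (2 * H) / 2 := by positivity
  have hp : 2 * H ≠ 0 := by positivity
  have e1 : incrementCov (2 * H) (t + ε) t (s + ε) s =
      (|t - s + ε| ^ (2 * H) + |t - s - ε| ^ (2 * H) - 2 * |t - s| ^ (2 * H)) / 2 := by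
    unfold incrementCov
    rw [show t + ε - s = t - s + ε by ring, show t - (s + ε) = t - s - ε by ring,
      show t + ε - (s + ε) = t - s by ring]
    ring
  have e2 : incrementCov (2 * H) t s (t + ε) t =
      (|t - s + ε| ^ (2 * H) - |t - s| ^ (2 * H) - ε ^ (2 * H)) / 2 := by
    unfold incrementCov
    rw [show s - (t + ε) = -(t - s + ε) by ring, show t - (t + ε) = -ε by ring, abs_neg, abs_neg,
      abs_of_pos hε, sub_self, abs_zero, Real.zero_rpow hp, abs_sub_comm s t]
    ring
  have e3 : incrementCov (2 * H) t s (s + ε) s =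
      (ε ^ (2 * H) + |t - s| ^ (2 * H) - |t - s - ε| ^ (2 * H)) / 2 := by
    unfold incrementCov
    rw [show t - (s + ε) = t - s - ε by ring, show s - (s + ε) = -ε by ring, abs_neg,
      abs_of_pos hε, sub_self, abs_zero, Real.zero_rpow hp]
    ring
  rw [e1, e2, e3]
  congr 3
  have : 1 + 2 * (1 / (4 * τ)) * |t - s| ^ (2 * H) = (τ + |t - s| ^ (2 * H) / 2) / τ := by
    field_simp; ring
  rw [this]
  field_simp
  ring

/-- The difference of the two parts is the mean, written with sums so that it can be integrated over
the square and over τ without finiteness conditions. -/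
lemma lintegral_heatFactor_mul_add (hX : IsFractionalBrownian H X P) (hH : 0 < H)
    {τ ε t s : ℝ} (hτ : 0 < τ) (hε : 0 < ε) (ht : 0 ≤ t) (hs : 0 ≤ s) (hts : t ≠ s) :
    ∫⁻ ω, heatFactor τ (X t.toNNReal ω - X s.toNNReal ω) *
        innerPart 1 ε (fun t => X t ω) (t, s) ∂P +
      ENNReal.ofReal (-heatMean d (2 * H) τ ε (t - s)) =
    ∫⁻ ω, heatFactor τ (X t.toNNReal ω - X s.toNNReal ω) *
        innerPart (-1) ε (fun t => X t ω) (t, s) ∂P +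
      ENNReal.ofReal (heatMean d (2 * H) τ ε (t - s)) := by
  obtain ⟨h1, h2⟩ := hX.integral_exp_mul_inner_forwardQuotient hH hτ hε ht hs hts
  simp_rw [heatFactor_mul_innerPart, one_mul, neg_one_mul]
  rw [← h2]
  exact lintegral_ofReal_add_ofReal_neg_integral h1

/-- Bound the inner product by half the sum of the squared norms. In the weighted second moment of
an increment the covariance correction is a square with a minus sign and can be dropped. -/
lemma lintegral_heatFactor_mul_le (hX : IsFractionalBrownian H X P) (hH : 0 < H)
    {τ ε t s σ : ℝ} (hτ : 0 < τ) (hε : 0 < ε) (ht : 0 ≤ t) (hs : 0 ≤ s) (hts : t ≠ s)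
    (hσ : |σ| ≤ 1) :
    ∫⁻ ω, heatFactor τ (X t.toNNReal ω - X s.toNNReal ω) *
        innerPart σ ε (fun t => X t ω) (t, s) ∂P ≤
      ENNReal.ofReal (ε⁻¹ ^ 2 * d * ε ^ (2 * H) * √(τ / (τ + |t - s| ^ (2 * H) / 2)) ^ d) := by
  have hab : t.toNNReal ≠ s.toNNReal := fun h => hts ((Real.toNNReal_eq_toNNReal_iff ht hs).1 h)
  have key : ∀ r : ℝ, 0 ≤ r → Integrable (fun ω => Real.exp (-(1 / (4 * τ)) *
      ‖X t.toNNReal ω - X s.toNNReal ω‖ ^ 2) * ‖X (r + ε).toNNReal ω - X r.toNNReal ω‖ ^ 2) P ∧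
      ∫ ω, Real.exp (-(1 / (4 * τ)) * ‖X t.toNNReal ω - X s.toNNReal ω‖ ^ 2) *
        ‖X (r + ε).toNNReal ω - X r.toNNReal ω‖ ^ 2 ∂P ≤
      d * ε ^ (2 * H) * √(τ / (τ + |t - s| ^ (2 * H) / 2)) ^ d := by
    intro r hr
    obtain ⟨h1, h2⟩ := hX.integral_exp_neg_norm_sq_mul_inner hH (c := 1 / (4 * τ)) (by positivity)
      hab (r + ε).toNNReal r.toNNReal (r + ε).toNNReal r.toNNReal
    simp_rw [real_inner_self_eq_norm_sq] at h1 h2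
    refine ⟨h1, ?_⟩
    rw [h2, inv_sqrt_one_add hτ, Real.coe_toNNReal t ht, Real.coe_toNNReal s hs,
      incrementCov_self (by linarith), Real.coe_toNNReal r hr,
      Real.coe_toNNReal (r + ε) (by linarith), add_sub_cancel_left, abs_of_pos hε]
    have : 0 ≤ 2 * (1 / (4 * τ)) * (incrementCov (2 * H) t s (r + ε) r *
        incrementCov (2 * H) t s (r + ε) r) / (1 + 2 * (1 / (4 * τ)) * |t - s| ^ (2 * H)) :=
      div_nonneg (mul_nonneg (by positivity) (mul_self_nonneg _)) (by positivity)
    calc _ ≤ d * √(τ / (τ + |t - s| ^ (2 * H) / 2)) ^ d * ε ^ (2 * H) := by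
          gcongr
          linarith
      _ = _ := by ring
  obtain ⟨i1, b1⟩ := key t ht
  obtain ⟨i2, b2⟩ := key s hs
  have i3 := ((i1.add i2).const_mul (1 / 2)).const_mul (ε⁻¹ ^ 2)
  calc _ ≤ ∫⁻ ω, ENNReal.ofReal (ε⁻¹ ^ 2 * ((1 / 2) *
        (Real.exp (-(1 / (4 * τ)) * ‖X t.toNNReal ω - X s.toNNReal ω‖ ^ 2) *
          ‖X (t + ε).toNNReal ω - X t.toNNReal ω‖ ^ 2 +
        Real.exp (-(1 / (4 * τ)) * ‖X t.toNNReal ω - X s.toNNReal ω‖ ^ 2) *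
          ‖X (s + ε).toNNReal ω - X s.toNNReal ω‖ ^ 2))) ∂P := by
        refine lintegral_mono fun ω => ?_
        simp only
        rw [heatFactor_mul_innerPart]
        refine ENNReal.ofReal_le_ofReal ?_
        simp only [forwardQuotient, real_inner_smul_left, real_inner_smul_right]
        have h1 : σ * inner ℝ (X (t + ε).toNNReal ω - X t.toNNReal ω)
            (X (s + ε).toNNReal ω - X s.toNNReal ω) ≤
            1 / 2 * (‖X (t + ε).toNNReal ω - X t.toNNReal ω‖ ^ 2 +
              ‖X (s + ε).toNNReal ω - X s.toNNReal ω‖ ^ 2) := by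
          have h2 := abs_real_inner_le_norm (X (t + ε).toNNReal ω - X t.toNNReal ω)
            (X (s + ε).toNNReal ω - X s.toNNReal ω)
          have h3 := le_abs_self (σ * inner ℝ (X (t + ε).toNNReal ω - X t.toNNReal ω)
            (X (s + ε).toNNReal ω - X s.toNNReal ω))
          rw [abs_mul] at h3
          have h4 := mul_le_mul_of_nonneg_right hσ (abs_nonneg (inner ℝ
            (X (t + ε).toNNReal ω - X t.toNNReal ω) (X (s + ε).toNNReal ω - X s.toNNReal ω)))
          nlinarith [sq_nonneg (‖X (t + ε).toNNReal ω - X t.toNNReal ω‖ -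
            ‖X (s + ε).toNNReal ω - X s.toNNReal ω‖)]
        have h5 : 0 ≤ ε⁻¹ ^ 2 *
          Real.exp (-(1 / (4 * τ)) * ‖X t.toNNReal ω - X s.toNNReal ω‖ ^ 2) := by positivity
        have h6 := mul_le_mul_of_nonneg_left h1 h5
        calc _ = _ := ?_
          _ ≤ _ := h6
          _ = _ := ?_
        · ring
        · ring
    _ = ENNReal.ofReal (∫ ω, (ε⁻¹ ^ 2 * ((1 / 2) *
        (Real.exp (-(1 / (4 * τ)) * ‖X t.toNNReal ω - X s.toNNReal ω‖ ^ 2) *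
          ‖X (t + ε).toNNReal ω - X t.toNNReal ω‖ ^ 2 +
        Real.exp (-(1 / (4 * τ)) * ‖X t.toNNReal ω - X s.toNNReal ω‖ ^ 2) *
          ‖X (s + ε).toNNReal ω - X s.toNNReal ω‖ ^ 2))) ∂P) :=
        (ofReal_integral_eq_lintegral_ofReal i3 (ae_of_all _ fun ω =>
          (by simp only [Pi.zero_apply, Pi.add_apply]; positivity))).symm
    _ ≤ _ := by
        refine ENNReal.ofReal_le_ofReal ?_
        rw [integral_const_mul, integral_const_mul, integral_add i1 i2]
        have : 0 ≤ ε⁻¹ ^ 2 := by positivity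
        calc _ ≤ ε⁻¹ ^ 2 * (1 / 2 * (d * ε ^ (2 * H) * √(τ / (τ + |t - s| ^ (2 * H) / 2)) ^ d +
            d * ε ^ (2 * H) * √(τ / (τ + |t - s| ^ (2 * H) / 2)) ^ d)) := by gcongr
          _ = _ := by ring

end IsFractionalBrownian

/-! ### Integration in τ against the Bessel weight -/

lemma lintegral_rpow_mul_exp_neg {a : ℝ} (ha : 0 < a) :
    ∫⁻ τ in Ioi (0 : ℝ), ENNReal.ofReal (τ ^ (a - 1) * Real.exp (-τ)) =
      ENNReal.ofReal (Real.Gamma a) := by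
  rw [Real.Gamma_eq_integral ha, ofReal_integral_eq_lintegral_ofReal (Real.GammaIntegral_convergent ha)]
  · simp_rw [mul_comm]
  · filter_upwards [self_mem_ae_restrict measurableSet_Ioi] with τ hτ
    have : 0 < τ := hτ
    positivity

lemma sqrt_pow_eq_rpow {x : ℝ} (hx : 0 ≤ x) (d : ℕ) : √x ^ d = x ^ ((d : ℝ) / 2) := by
  rw [Real.sqrt_eq_rpow, ← Real.rpow_natCast, ← Real.rpow_mul hx]
  congr 1; ring

/-- Integrated heat kernel bound. -/
lemma exists_lintegral_heatWeight_le (d : ℕ) {α β : ℝ} (hβ : 0 ≤ β) (hβd : β ≤ (d : ℝ) / 2)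
    (hα : (d : ℝ) / 2 - α < β) : ∃ C : ℝ, 0 ≤ C ∧ ∀ v : ℝ, 0 < v →
      ∫⁻ τ in Ioi (0 : ℝ), heatWeight d α τ * ENNReal.ofReal (√(τ / (τ + v / 2)) ^ d) ≤
        ENNReal.ofReal (C * v ^ (-β)) := by
  have hΓ := Real.Gamma_pos_of_pos (s := α - d / 2 + β) (by linarith)
  refine ⟨|1 / (Real.Gamma α * (4 * Real.pi) ^ ((d : ℝ) / 2))| *
    (Real.Gamma (α - d / 2 + β) * 2 ^ β), by positivity, fun v hv => ?_⟩
  calc _ ≤ ∫⁻ τ in Ioi (0 : ℝ), ENNReal.ofReal (|1 / (Real.Gamma α * (4 * Real.pi) ^ ((d : ℝ) / 2))| *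
        (v / 2) ^ (-β)) * ENNReal.ofReal (τ ^ (α - d / 2 + β - 1) * Real.exp (-τ)) := by
        refine setLIntegral_mono' measurableSet_Ioi fun τ hτ => ?_
        have hτ : 0 < τ := hτ
        unfold heatWeight
        rw [ENNReal.ofReal_mul (abs_nonneg (1 / (Real.Gamma α * (4 * Real.pi) ^ ((d : ℝ) / 2)))),
          mul_assoc, mul_assoc]
        refine mul_le_mul' (ENNReal.ofReal_le_ofReal (le_abs_self _)) ?_
        rw [← ENNReal.ofReal_mul (by positivity), ← ENNReal.ofReal_mul (by positivity)]
        refine ENNReal.ofReal_le_ofReal ?_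
        rw [sqrt_pow_eq_rpow (by positivity)]
        -- The base is at most 1, so lowering the exponent from d/2 to β only increases the power;
        -- the extra τ^β makes the τ-integral converge at 0.
        have h1 : (τ / (τ + v / 2)) ^ ((d : ℝ) / 2) ≤ τ ^ β * (v / 2) ^ (-β) := by
          calc (τ / (τ + v / 2)) ^ ((d : ℝ) / 2) ≤ (τ / (τ + v / 2)) ^ β :=
                Real.rpow_le_rpow_of_exponent_ge (by positivity)
                  (by rw [div_le_one (by positivity)]; linarith) hβd
            _ ≤ (τ / (v / 2)) ^ β := by gcongr; linarith
            _ = _ := by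
                rw [Real.div_rpow hτ.le (by positivity), Real.rpow_neg (by positivity),
                  div_eq_mul_inv]
        calc _ ≤ τ ^ (α - (d : ℝ) / 2 - 1) * Real.exp (-τ) * (τ ^ β * (v / 2) ^ (-β)) := by gcongr
          _ = _ := by
            rw [show α - (d : ℝ) / 2 + β - 1 = (α - (d : ℝ) / 2 - 1) + β by ring,
              Real.rpow_add hτ]
            ring
    _ = _ := by
        rw [lintegral_const_mul' _ _ ENNReal.ofReal_ne_top, lintegral_rpow_mul_exp_neg (by linarith),
          ← ENNReal.ofReal_mul (by positivity)]
        congr 1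
        rw [Real.div_rpow hv.le (by norm_num), Real.rpow_neg (by norm_num : (0:ℝ) ≤ 2)]
        field_simp

/-- The factor τ^(d/2) cancels the heat kernel normalisation and leaves the integral defining Γ(α);
hence every α > 0 is allowed. -/
lemma lintegral_heatWeight_mul_rpow_lt_top (d : ℕ) {α : ℝ} (hα : 0 < α) (C : ℝ) :
    ∫⁻ τ in Ioi (0 : ℝ), heatWeight d α τ * ENNReal.ofReal (C * τ ^ ((d : ℝ) / 2)) < ∞ := by
  calc _ = ∫⁻ τ in Ioi (0 : ℝ), (ENNReal.ofReal (1 / (Real.Gamma α * (4 * Real.pi) ^ ((d : ℝ) / 2))) *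
        ENNReal.ofReal C) * ENNReal.ofReal (τ ^ (α - 1) * Real.exp (-τ)) := by
        refine setLIntegral_congr_fun measurableSet_Ioi fun τ hτ => ?_
        have hτ : 0 < τ := hτ
        simp only [heatWeight]
        have e : τ ^ (α - 1) * Real.exp (-τ) =
            τ ^ (α - (d : ℝ) / 2 - 1) * Real.exp (-τ) * τ ^ ((d : ℝ) / 2) := by
          rw [mul_right_comm, ← Real.rpow_add hτ]
          ring_nf
        rw [e, ENNReal.ofReal_mul
          (by positivity : 0 ≤ τ ^ (α - (d : ℝ) / 2 - 1) * Real.exp (-τ)), mul_comm C,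
          ENNReal.ofReal_mul (by positivity : 0 ≤ τ ^ ((d : ℝ) / 2))]
        ring
    _ < ∞ := by
        rw [lintegral_const_mul' _ _ (by finiteness), lintegral_rpow_mul_exp_neg hα]
        finiteness

/-! ### The negative part near the diagonal -/

lemma abs_rpow_sub_rpow_le {p ε y : ℝ} (hp : 1 ≤ p) (hp2 : p < 2) (hε : 0 < ε) (hy : |y| < ε) :
    |(ε + y) ^ p - ε ^ p| ≤ 2 * (2 * ε) ^ (p - 1) * |y| := by
  obtain ⟨h1, h2⟩ := abs_lt.1 hy
  have e1 : ε ^ (p - 1) ≤ (2 * ε) ^ (p - 1) := by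
    apply Real.rpow_le_rpow <;> linarith
  have e2 : (ε + y) ^ (p - 1) ≤ (2 * ε) ^ (p - 1) := by
    apply Real.rpow_le_rpow <;> linarith
  have bound : ∀ c, 0 ≤ c → c ≤ (2 * ε) ^ (p - 1) →
      |p * c * y| ≤ 2 * (2 * ε) ^ (p - 1) * |y| := by
    intro c hc hc'
    rw [abs_mul, abs_mul, abs_of_nonneg hc, abs_of_nonneg (by linarith : 0 ≤ p)]
    gcongr
  have g1 := rpow_add_mul_sub_le_rpow hp hε (by linarith : 0 ≤ ε + y)
  have g2 := rpow_add_mul_sub_le_rpow hp (by linarith : 0 < ε + y) hε.le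
  have k1 := (abs_le.1 (bound _ (by positivity) e1)).1
  have k2 := (abs_le.1 (bound _ (Real.rpow_nonneg (by linarith) _) e2)).2
  rw [abs_le]
  constructor <;> nlinarith

lemma abs_add_rpow_add_abs_sub_rpow (p ε x : ℝ) (hε : 0 ≤ ε) :
    |x - ε| ^ p + |x + ε| ^ p = (ε + |x|) ^ p + |(ε - |x|)| ^ p := by
  rcases le_total 0 x with h | h
  · rw [abs_of_nonneg h, abs_of_nonneg (by linarith : 0 ≤ x + ε), abs_sub_comm]; ring_nf
  · rw [abs_of_nonpos h, abs_sub_comm x, abs_of_nonneg (by linarith : 0 ≤ ε - x)]; ring_nf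

/-- Covariance estimates between increments over nearby intervals. -/
lemma exists_near_diagonal {p ε : ℝ} (hp : 1 ≤ p) (hp2 : p < 2) (hε : 0 < ε) :
    ∃ r₀ : ℝ, 0 < r₀ ∧ r₀ ≤ 1 ∧ ∃ L : ℝ, ∀ x : ℝ, 0 < |x| → |x| < r₀ →
      |(|x - ε| ^ p + |x + ε| ^ p - 2 * ε ^ p) / 2| ≤ |x| ^ p / 2 ∧
      |(|x + ε| ^ p - ε ^ p - |x| ^ p) / 2| ≤ L * |x| ∧
      |(ε ^ p + |x| ^ p - |x - ε| ^ p) / 2| ≤ L * |x| ∧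
      7 * (L * |x|) ^ 2 ≤ ε ^ p / 2 * |x| ^ p := by
  -- Lipschitz constant of u^p on (0, 2ε), plus 1 for |x|^p ≤ |x|.
  set L : ℝ := 2 * (2 * ε) ^ (p - 1) + 1 with hL
  have hLpos : 0 < L := by positivity
  -- Since p < 2, |x|² = |x|^(2-p) |x|^p is negligible against |x|^p. The first bound serves the
  -- covariance condition 7(L|x|)² ≤ ε^p |x|^p / 2, the second the near independence of the two
  -- short increments.
  set δ : ℝ := min (ε ^ p / (14 * L ^ 2)) (1 / (20 * ε ^ (p - 2)))
  have hδ : 0 < δ := by positivity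
  have hq : 0 < 2 - p := by linarith
  refine ⟨min (min ε 1) (δ ^ (1 / (2 - p))), by positivity,
    (min_le_left _ _).trans (min_le_right _ _), L, fun x hx0 hx => ?_⟩
  rw [lt_min_iff, lt_min_iff] at hx
  obtain ⟨⟨hxε, hx1⟩, hxδ⟩ := hx
  have hr : |x| ^ (2 - p) ≤ δ := by
    calc |x| ^ (2 - p) ≤ (δ ^ (1 / (2 - p))) ^ (2 - p) := by gcongr
      _ = δ := by rw [← Real.rpow_mul hδ.le, one_div_mul_cancel hq.ne', Real.rpow_one]
  have hr1 : |x| ^ (2 - p) * (14 * L ^ 2) ≤ ε ^ p :=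
    (le_div_iff₀ (by positivity)).1 (hr.trans (min_le_left _ _))
  have hr2 : |x| ^ (2 - p) * (20 * ε ^ (p - 2)) ≤ 1 :=
    (le_div_iff₀ (by positivity)).1 (hr.trans (min_le_right _ _))
  have hsq : |x| ^ 2 = |x| ^ (2 - p) * |x| ^ p := by
    rw [← Real.rpow_add hx0, sub_add_cancel]; norm_cast
  have hxp : |x| ^ p ≤ |x| := by
    simpa using Real.rpow_le_rpow_of_exponent_ge hx0 hx1.le hp
  have hxp0 : 0 ≤ |x| ^ p := by positivity
  obtain ⟨hl, hu⟩ := abs_lt.1 hxε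
  have c1 := abs_rpow_sub_rpow_le hp hp2 hε hxε
  have c2 := abs_rpow_sub_rpow_le (y := -x) hp hp2 hε (by rwa [abs_neg])
  rw [abs_neg] at c2
  refine ⟨?_, ?_, ?_, ?_⟩
  · rw [abs_add_rpow_add_abs_sub_rpow p ε x hε.le]
    have h1 := second_difference_rpow_le hp hp2.le hε hx0
    have h2 := two_mul_rpow_le_add hp hε.le hx0.le
    rw [abs_of_nonneg (by linarith)]
    have : 20 * |x| ^ 2 * ε ^ (p - 2) ≤ |x| ^ p := by
      rw [hsq]; nlinarith
    linarith
  · rw [abs_of_nonneg (by linarith : 0 ≤ x + ε), add_comm x]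
    rw [abs_le] at c1 ⊢
    constructor <;> nlinarith
  · rw [abs_sub_comm, abs_of_nonneg (by linarith : 0 ≤ ε - x)]
    rw [← sub_eq_add_neg, abs_le] at c2
    rw [abs_le]
    constructor <;> nlinarith
  · rw [mul_pow, hsq]
    nlinarith

namespace IsFractionalBrownian

variable {Ω : Type*} [MeasurableSpace Ω] {P : Measure Ω} [IsProbabilityMeasure P] {d : ℕ} {H : ℝ}
  {X : ℝ≥0 → Ω → EuclideanSpace ℝ (Fin d)}

/-- For fixed ε and r small, the event that the increment over time ε is as small as r^H supplies
the power of r that the kernel loses. The bound is uniform in t and s, and its power of τ is exactly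
the one that the Bessel weight integrates for every α > 0. -/
lemma exists_lintegral_heatFactor_mul_neg_le (hX : IsFractionalBrownian H X P) (hH : 1 / 2 ≤ H)
    (hH1 : H < 1) {ε : ℝ} (hε : 0 < ε) :
    ∃ r₀ : ℝ, 0 < r₀ ∧ ∃ C : ℝ, 0 ≤ C ∧ ∀ t s τ : ℝ, 0 ≤ t → 0 ≤ s → t ≠ s → |t - s| < r₀ → 0 < τ →
      ∫⁻ ω, heatFactor τ (X t.toNNReal ω - X s.toNNReal ω) *
        innerPart (-1) ε (fun t => X t ω) (t, s) ∂P ≤ ENNReal.ofReal (C * τ ^ ((d : ℝ) / 2)) := by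
  obtain ⟨r₀, hr₀, hr₁, L, h⟩ := exists_near_diagonal (p := 2 * H) (by linarith) (by linarith) hε
  set q : ℝ := ε ^ (2 * H) / 2 with hq
  have hqpos : 0 < q := by positivity
  refine ⟨r₀, hr₀, ε⁻¹ ^ 2 * (16 * (2 ^ d * (64 / q) ^ ((d : ℝ) / 2))), by positivity, ?_⟩
  intro t s τ ht hs hts hr hτ
  have hx0 : 0 < |t - s| := abs_pos.2 (sub_ne_zero.2 hts)
  obtain ⟨h1, h2, h3, h4⟩ := h (t - s) hx0 hr
  have hp : 2 * H ≠ 0 := by linarith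
  set v : ℝ := |t - s| ^ (2 * H) with hv
  have hvpos : 0 < v := by positivity
  have hv1 : v ≤ 1 := Real.rpow_le_one hx0.le (hr.le.trans hr₁) (by linarith)
  have main := hX.lintegral_exp_neg_norm_sq_mul_neg_inner_le (by linarith) (c := 1 / (4 * τ))
    (by positivity) (a := t.toNNReal) (b := s.toNNReal) (a' := (t + ε).toNNReal)
    (b' := (s + ε).toNNReal) (v := v) (q := q) (l := L * |t - s|) hvpos hqpos
  rw [Real.coe_toNNReal t ht, Real.coe_toNNReal s hs,
    Real.coe_toNNReal (t + ε) (by linarith), Real.coe_toNNReal (s + ε) (by linarith)] at main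
  have e1 : incrementCov (2 * H) t s (t + ε) (s + ε) =
      (|t - s - ε| ^ (2 * H) + |t - s + ε| ^ (2 * H) - 2 * ε ^ (2 * H)) / 2 := by
    unfold incrementCov
    rw [show t - (s + ε) = t - s - ε by ring, show s - (t + ε) = -(t - s + ε) by ring,
      show t - (t + ε) = -ε by ring, show s - (s + ε) = -ε by ring, abs_neg, abs_neg,
      abs_of_pos hε]
    ring
  have e2 : incrementCov (2 * H) t s (t + ε) t =
      (|t - s + ε| ^ (2 * H) - ε ^ (2 * H) - |t - s| ^ (2 * H)) / 2 := by
    unfold incrementCov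
    rw [show s - (t + ε) = -(t - s + ε) by ring, show t - (t + ε) = -ε by ring, abs_neg, abs_neg,
      abs_of_pos hε, sub_self, abs_zero, Real.zero_rpow hp, abs_sub_comm s t]
    ring
  have e3 : incrementCov (2 * H) (t + ε) (s + ε) (t + ε) t =
      (ε ^ (2 * H) + |t - s| ^ (2 * H) - |t - s - ε| ^ (2 * H)) / 2 := by
    unfold incrementCov
    rw [show t + ε - t = ε by ring, show s + ε - (t + ε) = -(t - s) by ring,
      show s + ε - t = -(t - s - ε) by ring, abs_neg, abs_neg, abs_of_pos hε, sub_self,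
      abs_zero, Real.zero_rpow hp]
    ring
  specialize main rfl (by rw [hv]; congr 2; ring) (by
    rw [add_sub_cancel_left, abs_of_pos hε, hq]; linarith) (e1 ▸ h1) (e2 ▸ h2) (e3 ▸ h3) h4
  calc _ = ∫⁻ ω, ENNReal.ofReal (ε⁻¹ ^ 2) *
        (ENNReal.ofReal (Real.exp (-(1 / (4 * τ)) * ‖X t.toNNReal ω - X s.toNNReal ω‖ ^ 2)) *
        ENNReal.ofReal (-inner ℝ (X (t + ε).toNNReal ω - X t.toNNReal ω)
          (X (s + ε).toNNReal ω - X s.toNNReal ω))) ∂P := by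
        refine lintegral_congr fun ω => ?_
        rw [heatFactor_mul_innerPart, ← ENNReal.ofReal_mul (Real.exp_pos _).le,
          ← ENNReal.ofReal_mul (by positivity)]
        simp only [forwardQuotient, real_inner_smul_left, real_inner_smul_right]
        congr 1
        ring
    _ ≤ ENNReal.ofReal (ε⁻¹ ^ 2) * ENNReal.ofReal (16 * v *
        (2 * (√(1 + 2 * (1 / (4 * τ)) * v))⁻¹ * (√(q / (32 * v)))⁻¹) ^ d) := by
        rw [lintegral_const_mul' _ _ ENNReal.ofReal_ne_top]
        gcongr
    _ ≤ _ := by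
        rw [← ENNReal.ofReal_mul (by positivity), inv_sqrt_one_add hτ]
        refine ENNReal.ofReal_le_ofReal ?_
        rw [mul_assoc (ε⁻¹ ^ 2)]
        refine mul_le_mul_of_nonneg_left ?_ (by positivity)
        -- Uses v/(τ + v/2) ≤ 2; the singular factor and the small-ball factor combine here.
        have hs : √(τ / (τ + v / 2)) * (√(q / (32 * v)))⁻¹ ≤ √(64 / q * τ) := by
          rw [← Real.sqrt_inv, ← Real.sqrt_mul (by positivity)]
          refine Real.sqrt_le_sqrt ?_
          rw [inv_div, div_mul_div_comm, div_mul_eq_mul_div, div_le_div_iff₀ (by positivity) hqpos]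
          nlinarith [mul_pos hτ hqpos, mul_pos (mul_pos hτ hqpos) hτ]
        calc 16 * v * (2 * √(τ / (τ + v / 2)) * (√(q / (32 * v)))⁻¹) ^ d
            ≤ 16 * 1 * (2 * √(64 / q * τ)) ^ d := by
              rw [mul_assoc 2]
              gcongr
          _ = _ := by
              rw [mul_pow, sqrt_pow_eq_rpow (by positivity), Real.mul_rpow (by positivity) hτ.le]
              ring

end IsFractionalBrownian

/-! ### Singular integrals in |t - s| and the uniform upper bound -/

lemma ae_timeSquare (T : ℝ) :
    ∀ᵐ p ∂(timeSquare T), 0 ≤ p.1 ∧ 0 ≤ p.2 ∧ p.1 ≠ p.2 := by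
  have h1 : ∀ᵐ p ∂(timeSquare T), p ∈ Icc 0 T ×ˢ Icc 0 T :=
    ae_restrict_mem (measurableSet_Icc.prod measurableSet_Icc)
  have h2 : ∀ᵐ p ∂(timeSquare T), p.1 ≠ p.2 := by
    rw [timeSquare_eq_prod, ae_iff]
    have : MeasurableSet {p : ℝ × ℝ | ¬p.1 ≠ p.2} := by
      simp only [not_not]
      exact measurableSet_eq_fun measurable_fst measurable_snd
    rw [Measure.measure_prod_null this]
    refine ae_of_all _ fun t => ?_
    simp
  filter_upwards [h1, h2] with p hp hp2
  exact ⟨hp.1.1, hp.2.1, hp2⟩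

lemma lintegral_timeSquare_abs_sub_le {F : ℝ → ℝ≥0∞} (hF : Measurable F) (T : ℝ) :
    ∫⁻ p, F |p.1 - p.2| ∂(timeSquare T) ≤
      2 * ENNReal.ofReal T * ∫⁻ x in Ioc 0 T, F x := by
  rw [timeSquare_eq_prod, lintegral_prod _ (by fun_prop)]
  have key : ∀ t ∈ Icc 0 T, ∫⁻ s in Icc 0 T, F |t - s| ≤ 2 * ∫⁻ x in Ioc 0 T, F x := by
    intro t ht
    set G : ℝ → ℝ≥0∞ := (Ioc 0 T).indicator F
    have hG : Measurable G := hF.indicator measurableSet_Ioc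
    rw [← lintegral_indicator measurableSet_Icc]
    calc _ ≤ ∫⁻ s, (G (t - s) + G (-(t - s))) := by
          have : ∀ᵐ s : ℝ, s ≠ t := by simp [ae_iff]
          refine lintegral_mono_ae (this.mono fun s hs => ?_)
          by_cases hm : s ∈ Icc 0 T
          · rw [indicator_of_mem hm]
            rcases lt_or_gt_of_ne hs with h | h
            · rw [abs_of_pos (by linarith)]
              refine le_add_right (le_of_eq (indicator_of_mem ?_ _).symm)
              exact ⟨by linarith, by linarith [ht.2, hm.1]⟩
            · rw [abs_of_neg (by linarith)]
              refine le_add_left (le_of_eq (indicator_of_mem ?_ _).symm)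
              exact ⟨by linarith, by linarith [hm.2, ht.1]⟩
          · rw [indicator_of_notMem hm]; exact zero_le
      _ = _ := by
          rw [lintegral_add_left (by fun_prop),
            lintegral_sub_left_eq_self (fun x => G x) t,
            lintegral_sub_left_eq_self (fun x => G (-x)) t, lintegral_neg_eq_self,
            lintegral_indicator measurableSet_Ioc, two_mul]
  calc _ ≤ ∫⁻ t in Icc 0 T, 2 * ∫⁻ x in Ioc 0 T, F x := setLIntegral_mono' measurableSet_Icc key
    _ = _ := by
        rw [setLIntegral_const, Real.volume_Icc, sub_zero]; ring

lemma lintegral_Ioc_rpow_lt_top {a : ℝ} (ha : a < 1) (c T : ℝ) :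
    ∫⁻ x in Ioc 0 T, ENNReal.ofReal (c * x ^ (-a)) < ∞ := by
  rcases le_total T 0 with h | h
  · simp [Ioc_eq_empty_of_le h]
  · have := (intervalIntegral.intervalIntegrable_rpow' (a := 0) (b := T)
      (by linarith : -1 < -a)).const_mul c
    rw [intervalIntegrable_iff_integrableOn_Ioc_of_le h] at this
    exact this.lintegral_lt_top

lemma lintegral_abs_sub_rpow_lt_top {a : ℝ} (ha : a < 1) (c T : ℝ) :
    ∫⁻ p, ENNReal.ofReal (c * |p.1 - p.2| ^ (-a)) ∂(timeSquare T) < ∞ := by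
  refine (lintegral_timeSquare_abs_sub_le (F := fun x => ENNReal.ofReal (c * x ^ (-a)))
    (by fun_prop) T).trans_lt ?_
  exact ENNReal.mul_lt_top (by finiteness) (lintegral_Ioc_rpow_lt_top ha c T)

/-- Two regimes. For p = 1, a = 0, half the second difference vanishes for r ≥ ε and is at most ε,
so ε⁻² is compensated by the width ε of the strip. Otherwise it is at most 10 ε² r^(p-2), and
r^(p-2-a) is integrable because a < p - 1. -/
lemma exists_lintegral_second_difference_mul_le {p a T : ℝ} (hp : 1 ≤ p) (hp2 : p < 2)
    (ha : p = 1 ∧ a = 0 ∨ a < p - 1) (c : ℝ) (hc : 0 ≤ c) : ∃ M : ℝ≥0∞, M < ∞ ∧ ∀ ε : ℝ, 0 < ε →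
      ∫⁻ q, ENNReal.ofReal (ε⁻¹ ^ 2 * (((|q.1 - q.2| + ε) ^ p + |(|q.1 - q.2| - ε)| ^ p -
        2 * |q.1 - q.2| ^ p) / 2) * (c * |q.1 - q.2| ^ (-a))) ∂(timeSquare T) ≤ M := by
  rcases ha with ⟨rfl, rfl⟩ | ha
  · refine ⟨2 * ENNReal.ofReal T * ENNReal.ofReal c, by finiteness, fun ε hε => ?_⟩
    refine (lintegral_timeSquare_abs_sub_le (F := fun r => ENNReal.ofReal (ε⁻¹ ^ 2 *
      (((r + ε) ^ (1 : ℝ) + |r - ε| ^ (1 : ℝ) - 2 * r ^ (1 : ℝ)) / 2) *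
      (c * r ^ (-(0 : ℝ))))) (by fun_prop) T).trans ?_
    gcongr
    calc _ ≤ ∫⁻ x in Ioc 0 T, (Ioc 0 ε).indicator (fun _ => ENNReal.ofReal (ε⁻¹ * c)) x := by
          refine setLIntegral_mono' measurableSet_Ioc fun x hx => ?_
          simp only [Real.rpow_one, neg_zero, Real.rpow_zero, mul_one]
          by_cases h : x ≤ ε
          · rw [indicator_of_mem (show x ∈ Ioc 0 ε from ⟨hx.1, h⟩)]
            refine ENNReal.ofReal_le_ofReal ?_
            rw [abs_of_nonpos (by linarith)]
            have : ε⁻¹ = ε⁻¹ ^ 2 * ε := by field_simp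
            have h2 : (x + ε + -(x - ε) - 2 * x) / 2 ≤ ε := by linarith [hx.1]
            calc _ ≤ ε⁻¹ ^ 2 * ε * c := by gcongr
              _ = _ := by rw [← this]
          · rw [abs_of_pos (by linarith), ENNReal.ofReal_of_nonpos]
            · exact zero_le
            · rw [show (x + ε + (x - ε) - 2 * x) / 2 = 0 by ring]; simp
      _ ≤ ∫⁻ x, (Ioc 0 ε).indicator (fun _ => ENNReal.ofReal (ε⁻¹ * c)) x := setLIntegral_le_lintegral _ _
      _ = _ := by
          rw [lintegral_indicator measurableSet_Ioc, setLIntegral_const, Real.volume_Ioc, sub_zero,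
            ← ENNReal.ofReal_mul (by positivity)]
          congr 1; field_simp
  · refine ⟨_, lintegral_abs_sub_rpow_lt_top (a := 2 - p + a) (by linarith) (10 * c) T, fun ε hε => ?_⟩
    refine lintegral_mono_ae ((ae_timeSquare T).mono fun q hq => ?_)
    refine ENNReal.ofReal_le_ofReal ?_
    have hr : 0 < |q.1 - q.2| := abs_pos.2 (sub_ne_zero.2 hq.2.2)
    set r := |q.1 - q.2|
    have h1 := second_difference_rpow_le hp hp2.le hr hε
    calc _ ≤ ε⁻¹ ^ 2 * ((20 * ε ^ 2 * r ^ (p - 2)) / 2) * (c * r ^ (-a)) := by gcongr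
      _ = (ε⁻¹ * ε) ^ 2 * (10 * c * (r ^ (p - 2) * r ^ (-a))) := by ring
      _ = _ := by
          rw [inv_mul_cancel₀ hε.ne', ← Real.rpow_add hr, one_pow, one_mul]
          congr 2; ring

/-- Tonelli and the bound in τ with v = r^p: the kernel acts as r^(-pβ) on any nonnegative density
on the square. -/
lemma exists_lintegral_heatWeight_mul_le (d : ℕ) (T : ℝ) {p α β : ℝ} (hβ : 0 ≤ β)
    (hβd : β ≤ (d : ℝ) / 2) (hα : (d : ℝ) / 2 - α < β) : ∃ C : ℝ, 0 ≤ C ∧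
      ∀ f : ℝ × ℝ → ℝ≥0∞, Measurable f →
      ∫⁻ τ in Ioi (0 : ℝ), heatWeight d α τ * ∫⁻ q, f q *
        ENNReal.ofReal (√(τ / (τ + |q.1 - q.2| ^ p / 2)) ^ d) ∂(timeSquare T) ≤
      ∫⁻ q, f q * ENNReal.ofReal (C * |q.1 - q.2| ^ (-(p * β))) ∂(timeSquare T) := by
  obtain ⟨C, hC, h⟩ := exists_lintegral_heatWeight_le d hβ hβd hα
  refine ⟨C, hC, fun f hf => ?_⟩
  have hm : Measurable fun z : ℝ × (ℝ × ℝ) => heatWeight d α z.1 * (f z.2 *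
      ENNReal.ofReal (√(z.1 / (z.1 + |z.2.1 - z.2.2| ^ p / 2)) ^ d)) := by
    refine ((measurable_heatWeight d α).comp measurable_fst).mul
      ((hf.comp measurable_snd).mul ?_)
    fun_prop
  calc _ = ∫⁻ τ in Ioi (0 : ℝ), ∫⁻ q, heatWeight d α τ * (f q *
        ENNReal.ofReal (√(τ / (τ + |q.1 - q.2| ^ p / 2)) ^ d)) ∂(timeSquare T) :=
        lintegral_congr fun τ => (lintegral_const_mul _ (by fun_prop)).symm
    _ = ∫⁻ q, (∫⁻ τ in Ioi (0 : ℝ), heatWeight d α τ * (f q *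
        ENNReal.ofReal (√(τ / (τ + |q.1 - q.2| ^ p / 2)) ^ d))) ∂(timeSquare T) :=
        lintegral_lintegral_swap hm.aemeasurable
    _ ≤ _ := by
        refine lintegral_mono_ae ((ae_timeSquare T).mono fun q hq => ?_)
        have hr : 0 < |q.1 - q.2| := abs_pos.2 (sub_ne_zero.2 hq.2.2)
        simp_rw [mul_left_comm _ (f q)]
        have hm' : Measurable fun τ : ℝ => heatWeight d α τ *
            ENNReal.ofReal (√(τ / (τ + |q.1 - q.2| ^ p / 2)) ^ d) :=
          (measurable_heatWeight d α).mul (by fun_prop)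
        rw [lintegral_const_mul _ hm']
        gcongr
        refine (h (|q.1 - q.2| ^ p) (by positivity)).trans (le_of_eq ?_)
        rw [← Real.rpow_mul hr.le, mul_neg]

lemma heatMean_abs (d : ℕ) (p τ ε x : ℝ) : heatMean d p τ ε |x| = heatMean d p τ ε x := by
  rcases le_total 0 x with h | h
  · rw [abs_of_nonneg h]
  · rw [abs_of_nonpos h]
    unfold heatMean
    rw [abs_neg, show -x + ε = -(x - ε) by ring, show -x - ε = -(x + ε) by ring, abs_neg, abs_neg]
    ring

/-- For p ≥ 1 the power is superadditive, so both covariances in the subtracted term are nonnegative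
and the term can be discarded. -/
lemma heatMean_abs_le (d : ℕ) {p τ ε x : ℝ} (hp : 1 ≤ p) (hτ : 0 < τ) (hε : 0 < ε) :
    heatMean d p τ ε |x| ≤ d * (ε⁻¹ ^ 2 * (((|x| + ε) ^ p + |(|x| - ε)| ^ p - 2 * |x| ^ p) / 2)) *
      √(τ / (τ + |x| ^ p / 2)) ^ d := by
  have hx := abs_nonneg x
  unfold heatMean
  rw [abs_abs, abs_of_nonneg (by linarith : 0 ≤ |x| + ε)]
  set r := |x|
  have h1 : r ^ p + ε ^ p ≤ (r + ε) ^ p := Real.add_rpow_le_rpow_add hx hε.le hp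
  have h2 : |r - ε| ^ p ≤ ε ^ p + r ^ p := by
    rcases le_total r ε with h | h
    · have : |r - ε| ^ p ≤ ε ^ p := by
        refine Real.rpow_le_rpow (abs_nonneg _) ?_ (by linarith)
        rw [abs_le]; constructor <;> linarith
      have := Real.rpow_nonneg hx p
      linarith
    · have : |r - ε| ^ p ≤ r ^ p := by
        refine Real.rpow_le_rpow (abs_nonneg _) ?_ (by linarith)
        rw [abs_le]; constructor <;> linarith
      have := Real.rpow_nonneg hε.le p
      linarith
  have h3 : 0 ≤ ((r + ε) ^ p - r ^ p - ε ^ p) * (ε ^ p + r ^ p - |r - ε| ^ p) /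
      (8 * (τ + r ^ p / 2)) :=
    div_nonneg (mul_nonneg (by linarith) (by linarith)) (by positivity)
  calc _ ≤ ε⁻¹ ^ 2 * (d * √(τ / (τ + r ^ p / 2)) ^ d *
        (((r + ε) ^ p + |r - ε| ^ p - 2 * r ^ p) / 2)) := by
        gcongr
        linarith
    _ = _ := by ring

/-- The expected double integral of the positive (`σ = 1`) or negative (`σ = -1`) part of
`exp (-|X_t - X_s|² / (4 τ)) ⟨D_ε X_t, D_ε X_s⟩`. -/
noncomputable def partMean {Ω : Type*} [MeasurableSpace Ω] (P : Measure Ω) {d : ℕ}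
    (X : ℝ≥0 → Ω → EuclideanSpace ℝ (Fin d)) (T ε σ τ : ℝ) : ℝ≥0∞ :=
  ∫⁻ p, ∫⁻ ω, heatFactor τ (X p.1.toNNReal ω - X p.2.toNNReal ω) *
    innerPart σ ε (fun t => X t ω) p ∂P ∂(timeSquare T)

namespace IsFractionalBrownian

variable {Ω : Type*} [MeasurableSpace Ω] {P : Measure Ω} [IsProbabilityMeasure P] {d : ℕ} {H : ℝ}
  {X : ℝ≥0 → Ω → EuclideanSpace ℝ (Fin d)}

lemma partMean_le (hX : IsFractionalBrownian H X P) (hH : 0 < H) (T : ℝ) {τ ε σ : ℝ} (hτ : 0 < τ)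
    (hε : 0 < ε) (hσ : |σ| ≤ 1) :
    partMean P X T ε σ τ ≤ ∫⁻ q, ENNReal.ofReal (ε⁻¹ ^ 2 * d * ε ^ (2 * H)) *
      ENNReal.ofReal (√(τ / (τ + |q.1 - q.2| ^ (2 * H) / 2)) ^ d) ∂(timeSquare T) := by
  refine lintegral_mono_ae ((ae_timeSquare T).mono fun q hq => ?_)
  rw [← ENNReal.ofReal_mul (by positivity)]
  exact hX.lintegral_heatFactor_mul_le hH hτ hε hq.1 hq.2.1 hq.2.2 hσ

/-- At fixed ε only r^(-2Hβ) has to be integrable, a weaker demand on β than the bound uniform in ε.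
-/
lemma lintegral_besselKernel_mul_lt_top (hX : IsFractionalBrownian H X P) (hH : 0 < H) (T : ℝ)
    {α β ε σ : ℝ} (hβ : 0 ≤ β) (hβd : β ≤ (d : ℝ) / 2) (hα : (d : ℝ) / 2 - α < β)
    (hβH : 2 * H * β < 1) (hε : 0 < ε) (hσ : |σ| ≤ 1) :
    ∫⁻ ω, ∫⁻ p, besselKernel α (X p.1.toNNReal ω - X p.2.toNNReal ω) *
      innerPart σ ε (fun t => X t ω) p ∂(timeSquare T) ∂P < ∞ := by
  obtain ⟨C, hC, h⟩ := exists_lintegral_heatWeight_mul_le d T (p := 2 * H) hβ hβd hα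
  rw [hX.lintegral_besselKernel_mul]
  calc _ ≤ ∫⁻ τ in Ioi (0 : ℝ), heatWeight d α τ * ∫⁻ q,
        ENNReal.ofReal (ε⁻¹ ^ 2 * d * ε ^ (2 * H)) *
        ENNReal.ofReal (√(τ / (τ + |q.1 - q.2| ^ (2 * H) / 2)) ^ d) ∂(timeSquare T) :=
        setLIntegral_mono' measurableSet_Ioi fun τ hτ =>
          mul_le_mul_right (hX.partMean_le hH T hτ hε hσ) _
    _ ≤ _ := h _ measurable_const
    _ < ∞ := by
        rw [lintegral_const_mul' _ _ ENNReal.ofReal_ne_top]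
        exact ENNReal.mul_lt_top ENNReal.ofReal_lt_top (lintegral_abs_sub_rpow_lt_top hβH C T)

lemma aemeasurable_lintegral_besselKernel_mul (hX : IsFractionalBrownian H X P) (α σ ε T : ℝ) :
    AEMeasurable (fun ω => ∫⁻ p, besselKernel α (X p.1.toNNReal ω - X p.2.toNNReal ω) *
      innerPart σ ε (fun t => X t ω) p ∂(timeSquare T)) P :=
  (hX.aemeasurable_besselKernel_mul α σ ε T).lintegral_prod_right'

lemma lintegral_abs_forwardIntegrand_lt_top (hX : IsFractionalBrownian H X P) (hH : 0 < H) (T : ℝ)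
    {α β ε : ℝ} (hβ : 0 ≤ β) (hβd : β ≤ (d : ℝ) / 2) (hα : (d : ℝ) / 2 - α < β)
    (hβH : 2 * H * β < 1) (hε : 0 < ε) :
    ∫⁻ ω, ∫⁻ p, (forwardIntegrand α ε (fun t => X t ω) p).abs ∂(timeSquare T) ∂P < ∞ := by
  simp_rw [abs_forwardIntegrand]
  have h1 := hX.aemeasurable_besselKernel_mul α 1 ε T
  have h2 := hX.aemeasurable_besselKernel_mul α (-1) ε T
  refine (lintegral_prod _ (h1.add h2)).symm.trans_lt ((lintegral_add_left' h1 _).trans_lt ?_)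
  rw [lintegral_prod _ h1, lintegral_prod _ h2]
  exact ENNReal.add_lt_top.2
    ⟨hX.lintegral_besselKernel_mul_lt_top hH T hβ hβd hα hβH hε (by norm_num),
      hX.lintegral_besselKernel_mul_lt_top hH T hβ hβd hα hβH hε (by norm_num)⟩

lemma aemeasurable_lintegral_heatFactor_mul (hX : IsFractionalBrownian H X P) (τ σ ε T : ℝ) :
    AEMeasurable (fun p : ℝ × ℝ => ∫⁻ ω, heatFactor τ (X p.1.toNNReal ω - X p.2.toNNReal ω) *
        innerPart σ ε (fun t => X t ω) p ∂P) (timeSquare T) :=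
  (hX.aemeasurable_heatFactor_mul τ σ ε T).prod_swap.lintegral_prod_right'

/-- For each τ the positive part exceeds the negative one by at most the second-difference bound.
Integrating in τ yields an excess bounded independently of ε, and the finite negative part cancels.
-/
lemma exists_extIntegral_forwardZ_le (hX : IsFractionalBrownian H X P) (hH : 1 / 2 ≤ H)
    (hH1 : H < 1) (T : ℝ) {α β : ℝ} (hβ : 0 ≤ β) (hβd : β ≤ (d : ℝ) / 2)
    (hα : (d : ℝ) / 2 - α < β) (hβH : 2 * H = 1 ∧ β = 0 ∨ 2 * H * β < 2 * H - 1) :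
    ∃ M : ℝ≥0∞, M < ∞ ∧ ∀ ε : ℝ, 0 < ε → extIntegral P (forwardZ T X α ε) ≤ M := by
  obtain ⟨C, hC, h⟩ := exists_lintegral_heatWeight_mul_le d T (p := 2 * H) hβ hβd hα
  have hβH' : 2 * H * β < 1 := by
    rcases hβH with ⟨-, rfl⟩ | hh <;> linarith
  obtain ⟨M, hM, hM'⟩ := exists_lintegral_second_difference_mul_le (p := 2 * H) (a := 2 * H * β)
    (T := T) (by linarith) (by linarith)
    (hβH.imp_left fun hh => ⟨hh.1, by rw [hh.2, mul_zero]⟩) (d * C) (by positivity)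
  refine ⟨M, hM, fun ε hε => ?_⟩
  have hZ : forwardZ T X α ε = fun ω => _ := funext fun ω => forwardZ_eq T X α ε ω
  rw [hZ]
  refine extIntegral_sub_le (hX.aemeasurable_lintegral_besselKernel_mul α 1 ε T)
    (hX.aemeasurable_lintegral_besselKernel_mul α (-1) ε T)
    (hX.lintegral_besselKernel_mul_lt_top (by linarith) T hβ hβd hα hβH' hε (by norm_num)).ne ?_
  rw [hX.lintegral_besselKernel_mul, hX.lintegral_besselKernel_mul]
  set f : ℝ × ℝ → ℝ≥0∞ := fun q => ENNReal.ofReal (d * (ε⁻¹ ^ 2 *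
    (((|q.1 - q.2| + ε) ^ (2 * H) + |(|q.1 - q.2| - ε)| ^ (2 * H) -
      2 * |q.1 - q.2| ^ (2 * H)) / 2)))
  have hnn : ∀ q : ℝ × ℝ, 0 ≤ (d : ℝ) * (ε⁻¹ ^ 2 *
    (((|q.1 - q.2| + ε) ^ (2 * H) + |(|q.1 - q.2| - ε)| ^ (2 * H) -
      2 * |q.1 - q.2| ^ (2 * H)) / 2)) := fun q => by
    have := two_mul_rpow_le_add (p := 2 * H) (by linarith) (abs_nonneg (q.1 - q.2)) hε.le
    have h2 : 0 ≤ ((|q.1 - q.2| + ε) ^ (2 * H) + |(|q.1 - q.2| - ε)| ^ (2 * H) -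
      2 * |q.1 - q.2| ^ (2 * H)) / 2 := by linarith
    positivity
  have hf : Measurable f := by fun_prop
  have h1 : ∀ τ ∈ Ioi (0 : ℝ), partMean P X T ε 1 τ ≤ partMean P X T ε (-1) τ +
      ∫⁻ q, f q * ENNReal.ofReal (√(τ / (τ + |q.1 - q.2| ^ (2 * H) / 2)) ^ d) ∂(timeSquare T) := by
    intro τ hτ
    unfold partMean
    rw [← lintegral_add_left' (hX.aemeasurable_lintegral_heatFactor_mul τ (-1) ε T)]
    refine lintegral_mono_ae ((ae_timeSquare T).mono fun q hq => ?_)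
    have e := hX.lintegral_heatFactor_mul_add (by linarith) hτ hε hq.1 hq.2.1 hq.2.2
    refine (le_self_add.trans e.le).trans ?_
    gcongr
    rw [← ENNReal.ofReal_mul (hnn q), ← heatMean_abs]
    exact ENNReal.ofReal_le_ofReal (heatMean_abs_le d (by linarith) hτ hε)
  calc _ ≤ ∫⁻ τ in Ioi (0 : ℝ), (heatWeight d α τ * partMean P X T ε (-1) τ + heatWeight d α τ *
        ∫⁻ q, f q * ENNReal.ofReal (√(τ / (τ + |q.1 - q.2| ^ (2 * H) / 2)) ^ d) ∂(timeSquare T)) := by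
        refine setLIntegral_mono' measurableSet_Ioi fun τ hτ => ?_
        rw [← mul_add]
        exact mul_le_mul_right (h1 τ hτ) _
    _ = (∫⁻ τ in Ioi (0 : ℝ), heatWeight d α τ * partMean P X T ε (-1) τ) +
        ∫⁻ τ in Ioi (0 : ℝ), heatWeight d α τ * ∫⁻ q, f q *
          ENNReal.ofReal (√(τ / (τ + |q.1 - q.2| ^ (2 * H) / 2)) ^ d) ∂(timeSquare T) := by
        refine lintegral_add_right _ ((measurable_heatWeight d α).mul ?_)
        refine Measurable.lintegral_prod_right' (f := fun z : ℝ × (ℝ × ℝ) => f z.2 *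
          ENNReal.ofReal (√(z.1 / (z.1 + |z.2.1 - z.2.2| ^ (2 * H) / 2)) ^ d)) ?_
        exact (hf.comp measurable_snd).mul (by fun_prop)
    _ ≤ _ := by
        refine add_le_add le_rfl ?_
        refine (h f hf).trans (le_trans (le_of_eq ?_) (hM' ε hε))
        refine lintegral_congr fun q => ?_
        rw [← ENNReal.ofReal_mul (hnn q)]
        congr 1
        ring

end IsFractionalBrownian

/-- For H > 1/2 the interval (d/2 - α, 1 - 1/(2H)) is nonempty precisely because α exceeds the
critical exponent; take its midpoint, truncated at 0. It stays below 1/2 ≤ d/2. For H = 1/2 the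
critical exponent is d/2 and β = 0 works. -/
lemma exists_exponent {d : ℕ} (hd : 1 ≤ d) {H α : ℝ} (hH : 1 / 2 ≤ H) (hH1 : H < 1)
    (hα : criticalExponent d H < α) : ∃ β : ℝ, 0 ≤ β ∧ β ≤ (d : ℝ) / 2 ∧ (d : ℝ) / 2 - α < β ∧
      (2 * H = 1 ∧ β = 0 ∨ 2 * H * β < 2 * H - 1) := by
  unfold criticalExponent at hα
  have hd' : (1 : ℝ) ≤ d := by exact_mod_cast hd
  have hHpos : 0 < H := by linarith
  have e : 2 * H * (1 / (2 * H)) = 1 := by field_simp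
  rcases hH.eq_or_lt with h | h
  · subst h
    norm_num at hα
    exact ⟨0, le_rfl, by linarith, by linarith, Or.inl ⟨by norm_num, rfl⟩⟩
  · have h1 : 1 / (2 * H) < 1 := by rw [div_lt_one (by linarith)]; linarith
    have h2 : 1 / 2 < 1 / (2 * H) := by
      rw [div_lt_div_iff₀ (by norm_num) (by linarith)]; linarith
    refine ⟨max 0 (((d : ℝ) / 2 - α + 1 - 1 / (2 * H)) / 2), le_max_left _ _, ?_, ?_, Or.inr ?_⟩
    · exact max_le (by linarith) (by linarith)
    · rcases le_or_gt ((d : ℝ) / 2 - α) (((d : ℝ) / 2 - α + 1 - 1 / (2 * H)) / 2) with h3 | h3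
      · refine lt_of_lt_of_le ?_ (le_max_right _ _)
        linarith
      · linarith
    · have : max 0 (((d : ℝ) / 2 - α + 1 - 1 / (2 * H)) / 2) < 1 - 1 / (2 * H) :=
        max_lt (by linarith) (by linarith)
      nlinarith

/-! ### Finiteness of the negative part and positivity for every α > 0 -/

namespace IsFractionalBrownian

variable {Ω : Type*} [MeasurableSpace Ω] {P : Measure Ω} [IsProbabilityMeasure P] {d : ℕ} {H : ℝ}
  {X : ℝ≥0 → Ω → EuclideanSpace ℝ (Fin d)}

/-- Near the diagonal the small-ball bound C τ^(d/2) applies. At distance at least r₀ the crude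
second-moment bound with β = d/2 suffices, the singularity being cut off at r₀. -/
lemma lintegral_heatWeight_mul_partMean_neg_lt_top (hX : IsFractionalBrownian H X P)
    (hH : 1 / 2 ≤ H) (hH1 : H < 1) (T : ℝ) {α ε : ℝ} (hα : 0 < α) (hε : 0 < ε) :
    ∫⁻ τ in Ioi (0 : ℝ), heatWeight d α τ * partMean P X T ε (-1) τ < ∞ := by
  obtain ⟨r₀, hr₀, C, hC, h⟩ := hX.exists_lintegral_heatFactor_mul_neg_le hH hH1 hε
  obtain ⟨C', hC', h'⟩ := exists_lintegral_heatWeight_mul_le d T (p := 2 * H) (α := α)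
    (β := (d : ℝ) / 2) (by positivity) le_rfl (by linarith)
  set S : Set (ℝ × ℝ) := {q | r₀ ≤ |q.1 - q.2|}
  have hS : MeasurableSet S := measurableSet_le measurable_const (by fun_prop)
  set c : ℝ := ε⁻¹ ^ 2 * d * ε ^ (2 * H)
  have hc : 0 ≤ c := by positivity
  set f : ℝ × ℝ → ℝ≥0∞ := S.indicator fun _ => ENNReal.ofReal c
  have hf : Measurable f := measurable_const.indicator hS
  have hm : Measurable fun z : ℝ × (ℝ × ℝ) => f z.2 *
      ENNReal.ofReal (√(z.1 / (z.1 + |z.2.1 - z.2.2| ^ (2 * H) / 2)) ^ d) :=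
    (hf.comp measurable_snd).mul (by fun_prop)
  have h1 : ∀ τ ∈ Ioi (0 : ℝ), partMean P X T ε (-1) τ ≤
      ENNReal.ofReal (C * τ ^ ((d : ℝ) / 2)) * timeSquare T univ +
      ∫⁻ q, f q * ENNReal.ofReal (√(τ / (τ + |q.1 - q.2| ^ (2 * H) / 2)) ^ d) ∂(timeSquare T) := by
    intro τ hτ
    rw [← lintegral_const, ← lintegral_add_left measurable_const]
    refine lintegral_mono_ae ((ae_timeSquare T).mono fun q hq => ?_)
    by_cases hqS : q ∈ S
    · simp only [f, indicator_of_mem hqS]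
      refine le_add_left ?_
      rw [← ENNReal.ofReal_mul hc]
      exact hX.lintegral_heatFactor_mul_le (by linarith) hτ hε hq.1 hq.2.1 hq.2.2 (by norm_num)
    · exact le_add_right (h q.1 q.2 τ hq.1 hq.2.1 hq.2.2 (not_le.1 hqS) hτ)
  calc _ ≤ ∫⁻ τ in Ioi (0 : ℝ), (heatWeight d α τ * ENNReal.ofReal (C * τ ^ ((d : ℝ) / 2)) *
        timeSquare T univ + heatWeight d α τ * ∫⁻ q, f q *
          ENNReal.ofReal (√(τ / (τ + |q.1 - q.2| ^ (2 * H) / 2)) ^ d) ∂(timeSquare T)) := by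
        refine setLIntegral_mono' measurableSet_Ioi fun τ hτ => ?_
        rw [mul_assoc, ← mul_add]
        exact mul_le_mul_right (h1 τ hτ) _
    _ = (∫⁻ τ in Ioi (0 : ℝ), heatWeight d α τ * ENNReal.ofReal (C * τ ^ ((d : ℝ) / 2))) *
          timeSquare T univ + ∫⁻ τ in Ioi (0 : ℝ), heatWeight d α τ * ∫⁻ q, f q *
          ENNReal.ofReal (√(τ / (τ + |q.1 - q.2| ^ (2 * H) / 2)) ^ d) ∂(timeSquare T) := by
        refine (lintegral_add_right _
          ((measurable_heatWeight d α).mul hm.lintegral_prod_right')).trans ?_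
        rw [lintegral_mul_const' _ _ (measure_ne_top _ _)]
        rfl
    _ ≤ (∫⁻ τ in Ioi (0 : ℝ), heatWeight d α τ * ENNReal.ofReal (C * τ ^ ((d : ℝ) / 2))) *
          timeSquare T univ + ∫⁻ _, ENNReal.ofReal c * ENNReal.ofReal
            (C' * r₀ ^ (-(2 * H * ((d : ℝ) / 2)))) ∂(timeSquare T) := by
        refine add_le_add le_rfl ((h' f hf).trans (lintegral_mono fun q => ?_))
        by_cases hqS : q ∈ S
        · simp only [f, indicator_of_mem hqS]
          gcongr ENNReal.ofReal c * ENNReal.ofReal (C' * ?_)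
          exact Real.rpow_le_rpow_of_nonpos hr₀ hqS (by
            have : 0 ≤ 2 * H * ((d : ℝ) / 2) := by positivity
            linarith)
        · simp only [f, indicator_of_notMem hqS, zero_mul]
          exact zero_le
    _ < ∞ := by
        rw [lintegral_const]
        have := lintegral_heatWeight_mul_rpow_lt_top d hα C
        finiteness

/-- Positive definiteness of the Gaussian kernel along each continuous path, integrated over ω. -/
lemma partMean_neg_le (hX : IsFractionalBrownian H X P) (T ε : ℝ) {τ : ℝ} (hτ : 0 < τ) :
    partMean P X T ε (-1) τ ≤ partMean P X T ε 1 τ := by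
  have swap : ∀ σ, partMean P X T ε σ τ = ∫⁻ ω, ∫⁻ p,
      heatFactor τ (X p.1.toNNReal ω - X p.2.toNNReal ω) *
        innerPart σ ε (fun t => X t ω) p ∂(timeSquare T) ∂P := fun σ =>
    (lintegral_lintegral_swap (hX.aemeasurable_heatFactor_mul τ σ ε T)).symm
  rw [swap, swap]
  refine lintegral_mono_ae (hX.ae_continuous.mono fun ω hω => ?_)
  have hx : Continuous fun t : ℝ => X t.toNNReal ω := hω.comp continuous_real_toNNReal
  have hD : Continuous fun t : ℝ => forwardQuotient ε (fun t => X t ω) t := by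
    unfold forwardQuotient
    exact ((hx.comp (continuous_add_const ε)).sub hx).const_smul (ε⁻¹ : ℝ)
  have h1 := integral_exp_neg_norm_sq_mul_inner_nonneg hx hD (c := 1 / (4 * τ)) (by positivity) T
  have hc : Continuous fun p : ℝ × ℝ => Real.exp (-(1 / (4 * τ)) *
      ‖X p.1.toNNReal ω - X p.2.toNNReal ω‖ ^ 2) *
      inner ℝ (forwardQuotient ε (fun t => X t ω) p.1) (forwardQuotient ε (fun t => X t ω) p.2) := by
    have h2 : Continuous fun p : ℝ × ℝ => X p.1.toNNReal ω := hx.comp continuous_fst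
    have h3 : Continuous fun p : ℝ × ℝ => X p.2.toNNReal ω := hx.comp continuous_snd
    have h4 : Continuous fun p : ℝ × ℝ => forwardQuotient ε (fun t => X t ω) p.1 :=
      hD.comp continuous_fst
    have h5 : Continuous fun p : ℝ × ℝ => forwardQuotient ε (fun t => X t ω) p.2 :=
      hD.comp continuous_snd
    exact (Real.continuous_exp.comp (continuous_const.mul ((h2.sub h3).norm.pow 2))).mul
      (h4.inner h5)
  have h6 := lintegral_ofReal_add_ofReal_neg_integral (hc.integrable_timeSquare T)
  rw [ENNReal.ofReal_of_nonpos (p := -∫ _, _ ∂_) (by linarith), add_zero] at h6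
  have e : ∀ σ (p : ℝ × ℝ), _ := fun σ p => heatFactor_mul_innerPart X τ σ ε p.1 p.2 ω
  simp only [Prod.mk.eta] at e
  simp only [e, neg_one_mul, one_mul]
  rw [h6]
  exact le_self_add

end IsFractionalBrownian

/-! ### Quantitative lower bound for τ of order ε^(2H) -/

lemma continuous_add_abs_rpow_rpow {p τ : ℝ} (hp : 0 < p) (hτ : 0 < τ) (a : ℝ) :
    Continuous fun x : ℝ => (τ + |x| ^ p / 2) ^ a := by
  have h : Continuous fun x : ℝ => |x| ^ p := continuous_abs.rpow_const fun _ => Or.inr hp.le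
  exact (continuous_const.add (h.div_const 2)).rpow_const fun x =>
    Or.inl (by positivity : 0 < τ + |x| ^ p / 2).ne'

lemma heatMean_eq {d : ℕ} {p τ : ℝ} (hτ : 0 < τ) (ε x : ℝ) :
    heatMean d p τ ε x = ε⁻¹ ^ 2 * d * τ ^ ((d : ℝ) / 2) *
      ((τ + |x| ^ p / 2) ^ (-((d : ℝ) / 2) - 1) *
        ((τ + |x| ^ p / 2) * ((|x + ε| ^ p + |x - ε| ^ p - 2 * |x| ^ p) / 2) -
        (|x + ε| ^ p - |x| ^ p - ε ^ p) * (ε ^ p + |x| ^ p - |x - ε| ^ p) / 8)) := by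
  have hw : 0 < τ + |x| ^ p / 2 := by positivity
  unfold heatMean
  rw [sqrt_pow_eq_rpow (by positivity), Real.div_rpow hτ.le hw.le,
    Real.rpow_sub_one hw.ne', Real.rpow_neg hw.le]
  field_simp

lemma continuous_heatMean {d : ℕ} {p τ : ℝ} (hp : 0 < p) (hτ : 0 < τ) (ε : ℝ) :
    Continuous (heatMean d p τ ε) := by
  have h : ∀ a : ℝ, Continuous fun x : ℝ => |x + a| ^ p := fun a =>
    (continuous_add_const a).abs.rpow_const fun _ => Or.inr hp.le
  have h0 : Continuous fun x : ℝ => |x| ^ p := by simpa using h 0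
  have h1 : Continuous fun x : ℝ => |x - ε| ^ p := by simpa [sub_eq_add_neg] using h (-ε)
  have h2 := continuous_add_abs_rpow_rpow hp hτ (-((d : ℝ) / 2) - 1)
  have e : heatMean d p τ ε = fun x => _ := funext fun x => heatMean_eq hτ ε x
  rw [e]
  have h3 := h ε
  fun_prop

lemma le_heatMean {d : ℕ} (hd : 1 ≤ d) {p τ ε x : ℝ} (hp : 1 ≤ p) (hτ : 0 < τ) (hε : 0 < ε)
    (hcube : ∀ r : ℝ, 0 ≤ r → ((r + ε) ^ p - r ^ p) ^ 3 - (r ^ p - |r - ε| ^ p) ^ 3 ≤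
      3 / ((d : ℝ) / 2 + 1) * (ε ^ p) ^ 2 * (τ + r ^ p / 2)) :
    ε⁻¹ ^ 2 * d * τ ^ ((d : ℝ) / 2) * ((heatProfile ((d : ℝ) / 2) p τ (x + ε) +
      heatProfile ((d : ℝ) / 2) p τ (x - ε) - 2 * heatProfile ((d : ℝ) / 2) p τ x) / d +
        (τ + |x| ^ p / 2) ^ (-((d : ℝ) / 2) - 1) * ((ε ^ p) ^ 2 / 32)) ≤ heatMean d p τ ε x := by
  have hd' : (1 : ℝ) ≤ d := by exact_mod_cast hd
  have key := second_difference_heatProfile_le (D := (d : ℝ) / 2) (by linarith) hp hτ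
    (abs_nonneg x) hε (hcube _ (abs_nonneg x))
  rw [mul_div_cancel₀ _ (two_ne_zero' ℝ)] at key
  have e : heatProfile ((d : ℝ) / 2) p τ (|x| + ε) + heatProfile ((d : ℝ) / 2) p τ (|x| - ε) -
      2 * heatProfile ((d : ℝ) / 2) p τ |x| = heatProfile ((d : ℝ) / 2) p τ (x + ε) +
      heatProfile ((d : ℝ) / 2) p τ (x - ε) - 2 * heatProfile ((d : ℝ) / 2) p τ x := by
    rcases le_total 0 x with h | h
    · rw [abs_of_nonneg h]
    · have hn : ∀ y, heatProfile ((d : ℝ) / 2) p τ (-y) = heatProfile ((d : ℝ) / 2) p τ y :=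
        fun y => by unfold heatProfile; rw [abs_neg]
      rw [abs_of_nonpos h, show -x + ε = -(x - ε) by ring, show -x - ε = -(x + ε) by ring, hn, hn,
        hn]
      ring
  rw [e] at key
  rw [← heatMean_abs, heatMean_eq hτ, abs_abs, abs_of_nonneg (by positivity : 0 ≤ |x| + ε)]
  gcongr

/-- The parallelogram 0 ≤ t ≤ T/2, t ≤ s ≤ t + ε lies in the square, within the strip, and has area
Tε/2. -/
lemma mul_ofReal_le_lintegral_timeSquare {F : ℝ × ℝ → ℝ≥0∞} (hF : Measurable F) {T ε : ℝ}
    (hε : 0 ≤ ε) (hεT : ε ≤ T / 2) {c : ℝ≥0∞} (h : ∀ p, |p.1 - p.2| ≤ ε → c ≤ F p) :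
    c * ENNReal.ofReal (T / 2 * ε) ≤ ∫⁻ p, F p ∂(timeSquare T) := by
  rw [timeSquare_eq_prod, lintegral_prod _ hF.aemeasurable]
  calc _ = ∫⁻ t in Icc 0 (T / 2), ∫⁻ _ in Icc t (t + ε), c := by
        simp_rw [setLIntegral_const, Real.volume_Icc, add_sub_cancel_left]
        rw [setLIntegral_const, Real.volume_Icc, sub_zero, mul_assoc,
          ← ENNReal.ofReal_mul hε, mul_comm ε]
    _ ≤ ∫⁻ t in Icc 0 (T / 2), ∫⁻ s in Icc 0 T, F (t, s) := by
        refine setLIntegral_mono' measurableSet_Icc fun t ht => ?_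
        refine (setLIntegral_mono' (g := fun s => F (t, s)) measurableSet_Icc fun s hs => ?_).trans
          (lintegral_mono_set (Icc_subset_Icc ht.1 (by linarith [ht.2])))
        exact h _ (by rw [abs_le]; constructor <;> linarith [hs.1, hs.2])
    _ ≤ _ := lintegral_mono_set (Icc_subset_Icc le_rfl (by linarith))

/-- The exact second difference of the profile integrates to a nonnegative quantity, and the
positive remainder is kept on the strip |t - s| ≤ ε only. -/
lemma le_integral_heatMean {d : ℕ} (hd : 1 ≤ d) {p τ ε T : ℝ} (hp : 1 ≤ p) (hτ : 0 < τ)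
    (hε : 0 < ε) (hεT : ε ≤ T / 2)
    (hcube : ∀ r : ℝ, 0 ≤ r → ((r + ε) ^ p - r ^ p) ^ 3 - (r ^ p - |r - ε| ^ p) ^ 3 ≤
      3 / ((d : ℝ) / 2 + 1) * (ε ^ p) ^ 2 * (τ + r ^ p / 2)) :
    ε⁻¹ ^ 2 * d * τ ^ ((d : ℝ) / 2) * ((τ + ε ^ p / 2) ^ (-((d : ℝ) / 2) - 1) *
      ((ε ^ p) ^ 2 / 32) * (T / 2 * ε)) ≤
      ∫ q, heatMean d p τ ε (q.1 - q.2) ∂(timeSquare T) := by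
  set D : ℝ := (d : ℝ) / 2
  have hp0 : 0 < p := by linarith
  have hsub : Continuous fun q : ℝ × ℝ => q.1 - q.2 := by fun_prop
  have c1 := continuous_heatProfile (D := D) hp0 hτ
  set f1 : ℝ × ℝ → ℝ := fun q => heatProfile D p τ (q.1 - q.2 + ε) +
    heatProfile D p τ (q.1 - q.2 - ε) - 2 * heatProfile D p τ (q.1 - q.2)
  set f2 : ℝ × ℝ → ℝ := fun q => (τ + |q.1 - q.2| ^ p / 2) ^ (-D - 1)
  have hf1 : Continuous f1 := by fun_prop
  have hf2 : Continuous f2 := (continuous_add_abs_rpow_rpow hp0 hτ (-D - 1)).comp hsub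
  have hf2n : ∀ q, 0 ≤ f2 q := fun q => by positivity
  have i1 := hf1.integrable_timeSquare T
  have i2 := hf2.integrable_timeSquare T
  have n1 : 0 ≤ ∫ q, f1 q ∂(timeSquare T) := integral_second_difference_nonneg c1
    (fun x y h => heatProfile_le_heatProfile hp0.le hτ h) hε.le hεT
  have n2 : (τ + ε ^ p / 2) ^ (-D - 1) * (T / 2 * ε) ≤ ∫ q, f2 q ∂(timeSquare T) := by
    rw [← ENNReal.ofReal_le_ofReal_iff (integral_nonneg hf2n),
      ofReal_integral_eq_lintegral_ofReal i2 (ae_of_all _ hf2n), ENNReal.ofReal_mul (by positivity)]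
    refine mul_ofReal_le_lintegral_timeSquare hf2.measurable.ennreal_ofReal hε.le hεT fun q hq => ?_
    refine ENNReal.ofReal_le_ofReal (Real.rpow_le_rpow_of_nonpos (by positivity) (by gcongr) ?_)
    have : 0 ≤ D := by positivity
    linarith
  calc _ ≤ ε⁻¹ ^ 2 * d * τ ^ D * ((∫ q, f1 q ∂(timeSquare T)) / d +
        (∫ q, f2 q ∂(timeSquare T)) * ((ε ^ p) ^ 2 / 32)) := by
        refine mul_le_mul_of_nonneg_left ?_ (by positivity)
        have h1 : 0 ≤ (∫ q, f1 q ∂(timeSquare T)) / d := by positivity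
        have h2 := mul_le_mul_of_nonneg_right n2 (by positivity : 0 ≤ (ε ^ p) ^ 2 / 32)
        linarith
    _ = ∫ q, ε⁻¹ ^ 2 * d * τ ^ D * (f1 q / d + f2 q * ((ε ^ p) ^ 2 / 32)) ∂(timeSquare T) := by
        rw [integral_const_mul, integral_add (i1.div_const _) (i2.mul_const _), integral_div,
          integral_mul_const]
    _ ≤ _ := integral_mono (((i1.div_const _).add (i2.mul_const _)).const_mul _)
        (((continuous_heatMean hp0 hτ ε).comp hsub).integrable_timeSquare T)
        fun q => le_heatMean hd hp hτ hε hcube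

namespace IsFractionalBrownian

variable {Ω : Type*} [MeasurableSpace Ω] {P : Measure Ω} [IsProbabilityMeasure P] {d : ℕ} {H : ℝ}
  {X : ℝ≥0 → Ω → EuclideanSpace ℝ (Fin d)}

lemma partMean_one_eq (hX : IsFractionalBrownian H X P) (hH : 0 < H) (T : ℝ) {τ ε : ℝ}
    (hτ : 0 < τ) (hε : 0 < ε)
    (h0 : 0 ≤ ∫ q, heatMean d (2 * H) τ ε (q.1 - q.2) ∂(timeSquare T)) :
    partMean P X T ε 1 τ = partMean P X T ε (-1) τ +
      ENNReal.ofReal (∫ q, heatMean d (2 * H) τ ε (q.1 - q.2) ∂(timeSquare T)) := by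
  have hc : Continuous fun q : ℝ × ℝ => heatMean d (2 * H) τ ε (q.1 - q.2) :=
    (continuous_heatMean (by linarith) hτ ε).comp (by fun_prop)
  have hi := hc.integrable_timeSquare T
  have h1 := lintegral_ofReal_add_ofReal_neg_integral hi
  rw [ENNReal.ofReal_of_nonpos (p := -∫ _, _ ∂_) (by linarith), add_zero] at h1
  have h2 : partMean P X T ε 1 τ +
      ∫⁻ q, ENNReal.ofReal (-heatMean d (2 * H) τ ε (q.1 - q.2)) ∂(timeSquare T) =
      partMean P X T ε (-1) τ +
      ∫⁻ q, ENNReal.ofReal (heatMean d (2 * H) τ ε (q.1 - q.2)) ∂(timeSquare T) := by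
    unfold partMean
    rw [← lintegral_add_left' (hX.aemeasurable_lintegral_heatFactor_mul τ 1 ε T),
      ← lintegral_add_left' (hX.aemeasurable_lintegral_heatFactor_mul τ (-1) ε T)]
    refine lintegral_congr_ae ((ae_timeSquare T).mono fun q hq => ?_)
    exact hX.lintegral_heatFactor_mul_add hH hτ hε hq.1 hq.2.1 hq.2.2
  rw [h1, add_comm (∫⁻ _, _ ∂_), ← add_assoc] at h2
  exact (ENNReal.add_left_inj hi.neg.lintegral_lt_top.ne).1 h2

end IsFractionalBrownian

/-- On the window τ ≍ e all factors are comparable to powers of e, which leaves e^(α-d/2-2). -/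
lemma le_heatWeight_mul {d : ℕ} {α θ e τ K : ℝ} (hα : 0 < α) (hθ : 0 < θ) (he : 0 < e) (he1 : e ≤ 1)
    (hK : 0 ≤ K) (hτ : τ ∈ Icc (θ * e) (2 * θ * e)) :
    ENNReal.ofReal (1 / (Real.Gamma α * (4 * Real.pi) ^ ((d : ℝ) / 2)) *
      ((θ ^ α * (2 * θ)⁻¹ * (2 * θ + 1 / 2) ^ (-((d : ℝ) / 2) - 1) * Real.exp (-(2 * θ))) *
        e ^ (α - (d : ℝ) / 2 - 2) * K)) ≤
      heatWeight d α τ * ENNReal.ofReal (τ ^ ((d : ℝ) / 2) *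
        ((τ + e / 2) ^ (-((d : ℝ) / 2) - 1) * K)) := by
  have hΓ := Real.Gamma_pos_of_pos hα
  have hτ0 : 0 < τ := lt_of_lt_of_le (by positivity) hτ.1
  unfold heatWeight
  rw [mul_assoc (ENNReal.ofReal _), ← ENNReal.ofReal_mul (by positivity),
    ← ENNReal.ofReal_mul (by positivity)]
  refine ENNReal.ofReal_le_ofReal (mul_le_mul_of_nonneg_left ?_ (by positivity))
  set D : ℝ := (d : ℝ) / 2
  have hD : 0 ≤ D := by positivity
  -- The sign of α - 1 is unknown, so τ^(α-1) is split as τ^α τ⁻¹, estimated at opposite ends of the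
  -- window.
  have h1 : θ ^ α * (2 * θ)⁻¹ * e ^ (α - 1) ≤ τ ^ (α - 1) := by
    calc θ ^ α * (2 * θ)⁻¹ * e ^ (α - 1) = (θ * e) ^ α * (2 * θ * e)⁻¹ := by
          rw [Real.mul_rpow hθ.le he.le, Real.rpow_sub_one he.ne', mul_inv (2 * θ)]
          ring
      _ ≤ τ ^ α * τ⁻¹ := by
          gcongr
          · exact hτ.1
          · exact hτ.2
      _ = _ := by rw [Real.rpow_sub_one hτ0.ne']; rfl
  have h2 : (2 * θ + 1 / 2) ^ (-D - 1) * e ^ (-D - 1) ≤ (τ + e / 2) ^ (-D - 1) := by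
    rw [← Real.mul_rpow (by positivity) he.le]
    refine Real.rpow_le_rpow_of_nonpos (by positivity) ?_ (by linarith)
    linarith [hτ.2]
  have h3 : Real.exp (-(2 * θ)) ≤ Real.exp (-τ) := by
    refine Real.exp_le_exp.2 (neg_le_neg (hτ.2.trans ?_))
    nlinarith
  calc _ = (θ ^ α * (2 * θ)⁻¹ * e ^ (α - 1)) * Real.exp (-(2 * θ)) *
        ((2 * θ + 1 / 2) ^ (-D - 1) * e ^ (-D - 1) * K) := by
        rw [show α - D - 2 = (α - 1) + (-D - 1) by ring, Real.rpow_add he]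
        ring
    _ ≤ τ ^ (α - 1) * Real.exp (-τ) * ((τ + e / 2) ^ (-D - 1) * K) := by gcongr
    _ = _ := by
        rw [show α - 1 = (α - D - 1) + D by ring, Real.rpow_add hτ0]
        ring

namespace IsFractionalBrownian

variable {Ω : Type*} [MeasurableSpace Ω] {P : Measure Ω} [IsProbabilityMeasure P] {d : ℕ} {H : ℝ}
  {X : ℝ≥0 → Ω → EuclideanSpace ℝ (Fin d)}

/-- Outside the window θe ≤ τ ≤ 2θe, with e = ε^(2H), only nonnegativity is used. Inside, the gain
is of order e^(α-d/2-2) · ε⁻² e² ε, and the window has length θe, so the total is of order ε⁻¹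
e^(α-d/2+1). -/
lemma exists_le_extIntegral_forwardZ (hX : IsFractionalBrownian H X P) (hd : 1 ≤ d)
    (hH : 1 / 2 ≤ H) (hH1 : H < 1) {T : ℝ} (hT : 0 < T) {α : ℝ} (hα : 0 < α) :
    ∃ c : ℝ, 0 < c ∧ ∀ ε : ℝ, 0 < ε → ε ≤ 1 → ε ≤ T / 2 →
      ((c * ε ^ (2 * H * (α - (d : ℝ) / 2 + 1) - 1) : ℝ) : EReal) ≤
        extIntegral P (forwardZ T X α ε) := by
  have hd' : (1 : ℝ) ≤ d := by exact_mod_cast hd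
  have hHpos : 0 < H := by linarith
  have hΓ := Real.Gamma_pos_of_pos hα
  -- η = 3/(D+1) with D = d/2 is what the cubic Taylor term tolerates; θ is then the multiple of
  -- ε^(2H) that τ must reach.
  obtain ⟨θ, hθ, hcube⟩ := exists_cube_sub_cube_rpow_le (p := 2 * H)
    (η := 3 / ((d : ℝ) / 2 + 1)) (by linarith) (by linarith) (by positivity)
  set κ : ℝ := 1 / (Real.Gamma α * (4 * Real.pi) ^ ((d : ℝ) / 2))
  set b : ℝ := θ ^ α * (2 * θ)⁻¹ * (2 * θ + 1 / 2) ^ (-((d : ℝ) / 2) - 1) * Real.exp (-(2 * θ))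
  refine ⟨κ * b * (d * T / 64) * θ, by positivity, fun ε hε hε1 hεT => ?_⟩
  set e : ℝ := ε ^ (2 * H) with he_def
  have he : 0 < e := by positivity
  have he1 : e ≤ 1 := Real.rpow_le_one hε.le hε1 (by positivity)
  set K : ℝ := ε⁻¹ ^ 2 * d * (e ^ 2 / 32 * (T / 2 * ε)) with hK_def
  have hK : 0 ≤ K := by positivity
  set I : Set ℝ := Icc (θ * e) (2 * θ * e)
  have hI : ∀ τ ∈ I, 0 < τ := fun τ hτ => lt_of_lt_of_le (by positivity) hτ.1
  set m : ℝ≥0∞ := ENNReal.ofReal (κ * (b * e ^ (α - (d : ℝ) / 2 - 2) * K))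
  have hpart : ∀ τ ∈ Ioi (0 : ℝ), heatWeight d α τ * partMean P X T ε (-1) τ +
      I.indicator (fun _ => m) τ ≤ heatWeight d α τ * partMean P X T ε 1 τ := by
    intro τ hτ
    by_cases hτI : τ ∈ I
    · rw [indicator_of_mem hτI]
      have h1 := le_integral_heatMean hd (p := 2 * H) (τ := τ) (T := T) (by linarith) hτ hε hεT
        fun r hr => (cube_sub_cube_rpow_le_of_scale hcube hr hε).trans (by
          gcongr
          exact hτI.1)
      have h2 : τ ^ ((d : ℝ) / 2) * ((τ + e / 2) ^ (-((d : ℝ) / 2) - 1) * K) ≤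
          ∫ q, heatMean d (2 * H) τ ε (q.1 - q.2) ∂(timeSquare T) := by
        refine le_trans (le_of_eq ?_) h1
        rw [hK_def]; ring
      have hτ' : 0 < τ := hτ
      rw [hX.partMean_one_eq hHpos T hτ hε (le_trans (by positivity) h2), mul_add]
      refine add_le_add le_rfl ((le_heatWeight_mul hα hθ he he1 hK hτI).trans ?_)
      gcongr
    · rw [indicator_of_notMem hτI, add_zero]
      exact mul_le_mul_right (hX.partMean_neg_le T ε hτ) _
  have hZ : forwardZ T X α ε = fun ω => _ := funext fun ω => forwardZ_eq T X α ε ω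
  have hneg := hX.lintegral_heatWeight_mul_partMean_neg_lt_top hH hH1 T hα hε
  have hm : m * ENNReal.ofReal (θ * e) = ENNReal.ofReal (κ * b * (d * T / 64) * θ *
      ε ^ (2 * H * (α - (d : ℝ) / 2 + 1) - 1)) := by
    rw [← ENNReal.ofReal_mul (by positivity)]
    congr 1
    have e1 : ε ^ (2 * H * (α - (d : ℝ) / 2 + 1) - 1) = e ^ (α - (d : ℝ) / 2 - 2) * e ^ 3 * ε⁻¹ := by
      rw [Real.rpow_sub_one hε.ne', Real.rpow_mul hε.le, ← he_def, ← Real.rpow_natCast e 3,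
        ← Real.rpow_add he, div_eq_mul_inv]
      congr 2
      push_cast; ring
    rw [e1, hK_def]
    field_simp
    ring
  rw [hZ]
  have hpos : 0 ≤ κ * b * (d * T / 64) * θ * ε ^ (2 * H * (α - (d : ℝ) / 2 + 1) - 1) := by positivity
  have hcoe : ((κ * b * (d * T / 64) * θ * ε ^ (2 * H * (α - (d : ℝ) / 2 + 1) - 1) : ℝ) : EReal) =
      ((ENNReal.ofReal (κ * b * (d * T / 64) * θ *
        ε ^ (2 * H * (α - (d : ℝ) / 2 + 1) - 1)) : ℝ≥0∞) : EReal) := by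
    rw [EReal.coe_ennreal_ofReal, max_eq_left hpos]
  rw [hcoe]
  refine le_extIntegral_sub (hX.aemeasurable_lintegral_besselKernel_mul α 1 ε T)
    (hX.aemeasurable_lintegral_besselKernel_mul α (-1) ε T) ?_ ?_
  · rw [hX.lintegral_besselKernel_mul]
    exact hneg.ne
  · rw [hX.lintegral_besselKernel_mul, hX.lintegral_besselKernel_mul, ← hm]
    calc _ = (∫⁻ τ in Ioi (0 : ℝ), heatWeight d α τ * partMean P X T ε (-1) τ) +
          ∫⁻ τ in Ioi (0 : ℝ), I.indicator (fun _ => m) τ := by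
          rw [lintegral_indicator measurableSet_Icc, setLIntegral_const,
            Measure.restrict_apply measurableSet_Icc,
            inter_eq_left.2 (show Icc (θ * e) (2 * θ * e) ⊆ Ioi (0 : ℝ) from hI), Real.volume_Icc]
          congr 3
          ring
      _ = ∫⁻ τ in Ioi (0 : ℝ), (heatWeight d α τ * partMean P X T ε (-1) τ +
            I.indicator (fun _ => m) τ) :=
          (lintegral_add_right _ (measurable_const.indicator measurableSet_Icc)).symm
      _ ≤ _ := setLIntegral_mono' measurableSet_Ioi hpart

end IsFractionalBrownian

/-! ### Conclusion -/

theorem mainTheorem6 {Ω : Type*} [MeasurableSpace Ω] (P : Measure Ω) [IsProbabilityMeasure P]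
    (d : ℕ) (hd : 1 ≤ d) (H : ℝ) (hH : 1 / 2 ≤ H) (hH1 : H < 1) (T : ℝ) (hT : 0 < T)
    (X : ℝ≥0 → Ω → EuclideanSpace ℝ (Fin d)) (hX : IsFractionalBrownian H X P) :
    (∀ α : ℝ, criticalExponent d H < α →
      (∀ ε : ℝ, 0 < ε →
        (∫⁻ ω, ∫⁻ p, (forwardIntegrand α ε (fun t => X t ω) p).abs ∂(timeSquare T) ∂P) < ∞) ∧
      (⨆ ε ∈ Ioi (0 : ℝ), extIntegral P (forwardZ T X α ε)) < ⊤) ∧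
    (∀ α : ℝ, 0 < α → α < criticalExponent d H →
      liminf (fun ε : ℝ => extIntegral P (forwardZ T X α ε)) (𝓝[>] 0) = ⊤) := by
  have hHpos : 0 < H := by linarith
  refine ⟨fun α hα => ?_, fun α hα hαc => ?_⟩
  · obtain ⟨β, hβ, hβd, hβα, hβH⟩ := exists_exponent hd hH hH1 hα
    refine ⟨fun ε hε => hX.lintegral_abs_forwardIntegrand_lt_top hHpos T hβ hβd hβα ?_ hε, ?_⟩
    · rcases hβH with ⟨-, rfl⟩ | hh <;> linarith
    · obtain ⟨M, hM, h⟩ := hX.exists_extIntegral_forwardZ_le hH hH1 T hβ hβd hβα hβH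
      refine (iSup₂_le fun ε hε => h ε hε).trans_lt ?_
      simpa [lt_top_iff_ne_top] using hM.ne
  · obtain ⟨c, hc, h⟩ := hX.exists_le_extIntegral_forwardZ hd hH hH1 hT hα
    have hexp : 2 * H * (α - (d : ℝ) / 2 + 1) - 1 < 0 := by
      unfold criticalExponent at hαc
      have : 2 * H * (α - (d : ℝ) / 2 + 1) < 2 * H * (1 / (2 * H)) := by gcongr; linarith
      rw [mul_one_div_cancel (by positivity)] at this
      linarith
    have ht : Tendsto (fun ε : ℝ => ((c * ε ^ (2 * H * (α - (d : ℝ) / 2 + 1) - 1) : ℝ) : EReal))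
        (𝓝[>] 0) (𝓝 ⊤) :=
      EReal.tendsto_coe_nhds_top_iff.2 ((tendsto_rpow_neg_nhdsGT_zero hexp).const_mul_atTop hc)
    refine Tendsto.liminf_eq (tendsto_of_tendsto_of_tendsto_of_le_of_le' ht tendsto_const_nhds ?_
      (Eventually.of_forall fun _ => le_top))
    have h0 : (0 : ℝ) < min 1 (T / 2) := by positivity
    filter_upwards [Ioo_mem_nhdsGT h0] with ε hε
    exact h ε hε.1 (hε.2.le.trans (min_le_left _ _)) (hε.2.le.trans (min_le_right _ _))
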